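/- Let $n\ge 1$. A partition of the $2n$ points $1,\dots,n$ (upper row) and $1',\dots,n'$ (lower row) is an equivalence relation on these points; its classes are called blocks. The partition monoid $\mathcal P_n$ consists of all of them. The product $\alpha\beta$ is obtained by stacking $\alpha$ on top of $\beta$, identifying the lower row of $\alpha$ with the upper row of $\beta$, forming connected components, and deleting the middle row; $m(\alpha,\beta)$ denotes the number of connected components contained in the middle row. The rank of $\alpha$ is the number of its blocks that meet both rows. The Jones monoid $\mathcal J_n$ is the submonoid of all partitions whose blocks all have size $2$ and which can be drawn without crossings in the rectangle between the two rows. Put $I_r(\mathcal J_n)=\{\alpha\in\mathcal J_n:\operatorname{rank}(\alpha)\le r\}$, and let $\operatorname{rank}(I_r(\mathcal J_n))$ be the least size of a set generating $I_r(\mathcal J_n)$ as a semigroup. For $\delta\in\mathbb C$ let $\psi(\alpha,\beta)=\delta^{m(\alpha,\beta)}$ (with $0^0=1$), and let the Temperley--Lieb algebra $\mathbb C^\psi[\mathcal J_n]$ be the complex vector space with basis $\mathcal J_n$ and product $\alpha\star\beta=\psi(\alpha,\beta)\,\alpha\beta$. If $\mathbb C^\psi[\mathcal J_n]$ is semisimple,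 then its irreducible left modules are, up to isomorphism and without repetition, modules $J_n^r$ indexed by the set $$\hat J_n=\{r\in\mathbb Z_{\ge 0} : r=n-2k \text{ for some integer } k\ge 0\},$$ where $J_n^r$ belongs to the diagrams of rank $r$ in the sense that every $\alpha\in\mathcal J_n$ of rank less than $r$ acts on $J_n^r$ as zero while some $\alpha\in\mathcal J_n$ of rank $r$ does not. Moreover, for $0\le r=n-2k\le n-2$, $$\dim_{\mathbb C}(J_n^r)=\operatorname{rank}(I_r(\mathcal J_n))=\frac{r+1}{n+1}\binom{n+1}{k}.$$ -/

import Mathlib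

namespace Diagram

section Rows
variable {A B C D : Type*}

/-- Inclusion of the upper two of three rows. -/
def upper : A ⊕ B → A ⊕ B ⊕ C := Sum.elim Sum.inl (fun b => Sum.inr (Sum.inl b))

/-- Inclusion of the lower two of three rows. -/
def lower : B ⊕ C → A ⊕ B ⊕ C := Sum.inr

/-- Inclusion of the outer two of three rows. -/
def outer : A ⊕ C → A ⊕ B ⊕ C := Sum.elim Sum.inl (fun c => Sum.inr (Sum.inr c))

/-- Inclusion of the middle one of three rows. -/
def mid : B → A ⊕ B ⊕ C := fun b => Sum.inr (Sum.inl b)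

/-- The connected components of the graph obtained by stacking `α` on top of `β`. -/
def stack (α : Setoid (A ⊕ B)) (β : Setoid (B ⊕ C)) : Setoid (A ⊕ B ⊕ C) :=
  Setoid.map α upper ⊔ Setoid.map β lower

/-- The composite: stack the two diagrams and delete the middle row. -/
def comp (α : Setoid (A ⊕ B)) (β : Setoid (B ⊕ C)) : Setoid (A ⊕ C) :=
  Setoid.comap outer (stack α β)

/-- The number of classes of an equivalence relation that are contained in a given set. -/
noncomputable def classesIn {X : Type*} (r : Setoid X) (U : Set X) : ℕ :=
  {c ∈ r.classes | c ⊆ U}.ncard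

/-- The number of components contained in the middle row of the stacked graph. -/
noncomputable def loops (α : Setoid (A ⊕ B)) (β : Setoid (B ⊕ C)) : ℕ :=
  classesIn (stack α β) (Set.range mid)

end Rows

section Glue

theorem map_le_iff {X Y : Type*} {r : Setoid X} {f : X → Y} {s : Setoid Y} :
    Setoid.map r f ≤ s ↔ ∀ x y, r x y → s (f x) (f y) := by
  constructor
  · intro h x y hxy
    exact h (Relation.EqvGen.rel _ _ ⟨x, y, hxy, rfl, rfl⟩)
  · intro h
    refine Setoid.eqvGen_le ?_
    rintro _ _ ⟨a, b, hab, rfl, rfl⟩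
    exact h a b hab

theorem map_rel {X Y : Type*} (r : Setoid X) (f : X → Y) {x y : X} (h : r x y) :
    Setoid.map r f (f x) (f y) := map_le_iff.1 le_rfl x y h

theorem map_sup {X Y : Type*} (r s : Setoid X) (f : X → Y) :
    Setoid.map (r ⊔ s) f = Setoid.map r f ⊔ Setoid.map s f := by
  apply le_antisymm
  · rw [map_le_iff]
    have : r ⊔ s ≤ Setoid.comap f (Setoid.map r f ⊔ Setoid.map s f) := by
      refine sup_le ?_ ?_
      · intro x y h
        exact (le_sup_left : Setoid.map r f ≤ _) (map_rel r f h)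
      · intro x y h
        exact (le_sup_right : Setoid.map s f ≤ _) (map_rel s f h)
    exact fun x y h => this h
  · refine sup_le ?_ ?_ <;> rw [map_le_iff] <;> intro x y h <;> apply map_rel
    · exact (le_sup_left : r ≤ _) h
    · exact (le_sup_right : s ≤ _) h

theorem map_map {X Y Z : Type*} (r : Setoid X) (f : X → Y) (g : Y → Z) :
    Setoid.map (Setoid.map r f) g = Setoid.map r (g ∘ f) := by
  apply le_antisymm
  · rw [map_le_iff]
    have : Setoid.map r f ≤ Setoid.comap g (Setoid.map r (g ∘ f)) := by
      rw [map_le_iff]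
      intro x y h
      exact map_rel r (g ∘ f) h
    exact fun x y h => this h
  · rw [map_le_iff]
    intro x y h
    exact map_rel _ g (map_rel r f h)

theorem map_iff {X Y : Type*} (r : Setoid X) {f : X → Y} (hf : f.Injective) {x y : Y} :
    Setoid.map r f x y ↔ (∃ a b, r a b ∧ f a = x ∧ f b = y) ∨ x = y := by
  have h := Setoid.coe_map_of_ker_le r f (Setoid.ker_eq_bot_iff.2 hf ▸ bot_le)
  have h2 := congrFun (congrFun h x) y
  simp only [Pi.sup_apply, sup_Prop_eq] at h2
  rw [h2]; rfl

variable {W X Y Z : Type*}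

theorem comap_sup_map (i : Y → X) (r : Setoid X) (s : Setoid Y) :
    Setoid.comap i (r ⊔ Setoid.map s i) = Setoid.comap i r ⊔ s := by
  classical
  apply le_antisymm
  · -- a relation on `X` extending the right-hand side
    let t : Setoid X :=
      { r := fun x y => r x y ∨ ∃ a b, r x (i a) ∧ (Setoid.comap i r ⊔ s) a b ∧ r (i b) y
        iseqv :=
          { refl := fun x => Or.inl (r.refl' x)
            symm := by
              rintro x y (h | ⟨a, b, h1, h2, h3⟩)
              · exact Or.inl (r.symm' h)
              · exact Or.inr ⟨b, a, r.symm' h3, Setoid.symm' _ h2, r.symm' h1⟩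
            trans := by
              rintro x y z (h | ⟨a, b, h1, h2, h3⟩) (h' | ⟨a', b', h1', h2', h3'⟩)
              · exact Or.inl (r.trans' h h')
              · exact Or.inr ⟨a', b', r.trans' h h1', h2', h3'⟩
              · exact Or.inr ⟨a, b, h1, h2, r.trans' h3 h'⟩
              · refine Or.inr ⟨a, b', h1, ?_, h3'⟩
                have : Setoid.comap i r b a' := r.trans' h3 h1'
                exact Setoid.trans' _ (Setoid.trans' _ h2
                  ((le_sup_left : Setoid.comap i r ≤ _) this)) h2' } }
    have ht : r ⊔ Setoid.map s i ≤ t := by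
      refine sup_le (fun x y h => Or.inl h) ?_
      rw [map_le_iff]
      intro a b h
      exact Or.inr ⟨a, b, r.refl' _, (le_sup_right : s ≤ _) h, r.refl' _⟩
    intro x y h
    rcases ht h with h | ⟨a, b, h1, h2, h3⟩
    · exact (le_sup_left : Setoid.comap i r ≤ _) h
    · exact Setoid.trans' _ (Setoid.trans' _ ((le_sup_left : Setoid.comap i r ≤ _) h1) h2)
        ((le_sup_left : Setoid.comap i r ≤ _) h3)
  · refine sup_le ?_ ?_
    · intro x y h
      exact (le_sup_left : r ≤ r ⊔ Setoid.map s i) h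
    · intro x y h
      exact (le_sup_right : Setoid.map s i ≤ r ⊔ Setoid.map s i) (map_rel s i h)

theorem comap_map_pullback {i : Y → X} {j : Z → X} {i' : W → Z} {j' : W → Y}
    (hj : j.Injective) (hi : i.Injective) (hj' : j'.Injective) (hsq : ∀ w, i (j' w) = j (i' w))
    (hpb : ∀ y z, i y = j z → ∃ w, y = j' w ∧ z = i' w) (q : Setoid Z) :
    Setoid.comap i (Setoid.map q j) = Setoid.map (Setoid.comap i' q) j' := by
  apply Setoid.ext
  intro x y
  rw [map_iff _ hj', Setoid.comap_rel, map_iff _ hj]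
  constructor
  · rintro (⟨a, b, h, ha, hb⟩ | h)
    · obtain ⟨w, rfl, rfl⟩ := hpb x a ha.symm
      obtain ⟨v, rfl, rfl⟩ := hpb y b hb.symm
      exact Or.inl ⟨w, v, h, rfl, rfl⟩
    · exact Or.inr (hi h)
  · rintro (⟨a, b, h, rfl, rfl⟩ | h)
    · exact Or.inl ⟨i' a, i' b, h, (hsq a).symm, (hsq b).symm⟩
    · exact Or.inr (congrArg i h)

theorem classesIn_sup_map [Finite X] {i : Y → X} (hi : i.Injective) (r : Setoid X)
    (s : Setoid Y) (U : Set Y) :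
    classesIn (r ⊔ Setoid.map s i) (i '' U ∪ (Set.range i)ᶜ)
      = classesIn r (Set.range i)ᶜ + classesIn (Setoid.comap i r ⊔ s) U := by
  classical
  set t := r ⊔ Setoid.map s i with ht
  have htc : Setoid.comap i t = Setoid.comap i r ⊔ s := comap_sup_map i r s
  rw [← htc]
  -- relations starting off the range of `i`
  have off : ∀ x y, (∀ z, r x z → z ∉ Set.range i) → t x y → r x y := by
    intro x y hx hxy
    let u : Setoid X :=
      { r := fun a b => r x a ↔ r x b
        iseqv := ⟨fun _ => Iff.rfl, fun h => h.symm, fun h h' => h.trans h'⟩ }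
    have hu : t ≤ u := by
      refine sup_le ?_ ?_
      · intro a b h
        exact ⟨fun h' => r.trans' h' h, fun h' => r.trans' h' (r.symm' h)⟩
      · rw [map_le_iff]
        intro a b _
        exact ⟨fun h' => absurd ⟨a, rfl⟩ (hx _ h'), fun h' => absurd ⟨b, rfl⟩ (hx _ h')⟩
    exact (hu hxy).1 (r.refl' x)
  have hrt : r ≤ t := le_sup_left
  have hsplit : {c ∈ t.classes | c ⊆ i '' U ∪ (Set.range i)ᶜ} =
      {c ∈ r.classes | c ⊆ (Set.range i)ᶜ} ∪
      {c ∈ t.classes | c ⊆ i '' U ∪ (Set.range i)ᶜ ∧ ∃ y, i y ∈ c} := by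
    ext c
    constructor
    · rintro ⟨⟨x, rfl⟩, hc⟩
      by_cases hy : ∃ y, i y ∈ {z | t z x}
      · exact Or.inr ⟨⟨x, rfl⟩, hc, hy⟩
      · left
        have h1 : ∀ z, r x z → z ∉ Set.range i := by
          rintro _ hz ⟨y, rfl⟩
          exact hy ⟨y, t.symm' (hrt hz)⟩
        refine ⟨⟨x, ?_⟩, ?_⟩
        · ext z
          exact ⟨fun h => r.symm' (off x z h1 (t.symm' h)), fun h => hrt h⟩
        · rintro _ hz ⟨y, rfl⟩
          exact hy ⟨y, hz⟩
    · rintro (⟨⟨x, rfl⟩, hc⟩ | ⟨h1, h2, -⟩)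
      · have h1 : ∀ z, r x z → z ∉ Set.range i := fun z hz => hc (r.symm' hz)
        refine ⟨⟨x, ?_⟩, fun z hz => Or.inr (hc hz)⟩
        ext z
        exact ⟨fun h => hrt h, fun h => r.symm' (off x z h1 (t.symm' h))⟩
      · exact ⟨h1, h2⟩
  have hdisj : Disjoint {c ∈ r.classes | c ⊆ (Set.range i)ᶜ}
      {c ∈ t.classes | c ⊆ i '' U ∪ (Set.range i)ᶜ ∧ ∃ y, i y ∈ c} := by
    rw [Set.disjoint_left]
    rintro c ⟨-, hc⟩ ⟨-, -, y, hy⟩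
    exact hc hy ⟨y, rfl⟩
  unfold classesIn
  rw [hsplit, Set.ncard_union_eq hdisj (Set.toFinite _) (Set.toFinite _)]
  congr 1
  refine Set.ncard_congr (fun c _ => i ⁻¹' c) ?_ ?_ ?_
  · rintro c ⟨⟨x, rfl⟩, hc, y, hy⟩
    refine ⟨⟨y, ?_⟩, ?_⟩
    · ext z
      exact ⟨fun h => t.trans' h (t.symm' hy), fun h => t.trans' h hy⟩
    · intro z hz
      rcases hc hz with ⟨z', hz', h⟩ | h
      · exact hi h ▸ hz'
      · exact absurd ⟨z, rfl⟩ h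
  · rintro c d ⟨⟨x, rfl⟩, hc, y, hy⟩ ⟨⟨x', rfl⟩, hc', y', hy'⟩ h
    have h1 : t (i y) x' := by
      have : y ∈ i ⁻¹' {z | t z x'} := h ▸ hy
      exact this
    ext z
    exact ⟨fun h => t.trans' (t.trans' h (t.symm' hy)) h1,
      fun h => t.trans' (t.trans' h (t.symm' h1)) hy⟩
  · rintro c ⟨⟨y, rfl⟩, hc⟩
    refine ⟨{z | t z (i y)}, ⟨⟨i y, rfl⟩, ?_, y, t.refl' _⟩, rfl⟩
    intro z hz
    by_cases hzr : z ∈ Set.range i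
    · obtain ⟨w, rfl⟩ := hzr
      exact Or.inl ⟨w, hc hz, rfl⟩
    · exact Or.inr hzr

theorem classesIn_map {j : Z → X} (hj : j.Injective) (q : Setoid Z) (U : Set X)
    (hU : U ⊆ Set.range j) : classesIn (Setoid.map q j) U = classesIn q (j ⁻¹' U) := by
  unfold classesIn
  symm
  refine Set.ncard_congr (fun c _ => j '' c) ?_ ?_ ?_
  · rintro c ⟨⟨x, rfl⟩, hc⟩
    refine ⟨⟨j x, ?_⟩, Set.image_subset_iff.2 hc⟩
    ext z
    constructor
    · rintro ⟨w, hw, rfl⟩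
      exact map_rel q j hw
    · intro h
      rcases (map_iff q hj).1 h with ⟨a, b, hab, rfl, hb⟩ | h
      · exact ⟨a, (hj hb) ▸ hab, rfl⟩
      · exact ⟨x, q.refl' x, h.symm⟩
  · intro c d _ _ h
    exact hj.image_injective h
  · rintro c ⟨⟨x, rfl⟩, hc⟩
    obtain ⟨y, rfl⟩ := hU (hc (show Setoid.map q j x x from Setoid.refl' _ x))
    refine ⟨{z | q z y}, ⟨⟨y, rfl⟩, ?_⟩, ?_⟩
    · intro z hz
      exact hc (map_rel q j hz)
    · ext z
      constructor
      · rintro ⟨w, hw, rfl⟩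
        exact map_rel q j hw
      · intro h
        rcases (map_iff q hj).1 h with ⟨a, b, hab, rfl, hb⟩ | h
        · exact ⟨a, (hj hb) ▸ hab, rfl⟩
        · exact ⟨y, q.refl' y, h.symm⟩

/-- Gluing along a pullback square of injections: relations. -/
theorem glue_rel {i : Y → X} {j : Z → X} {i' : W → Z} {j' : W → Y}
    (hj : j.Injective) (hi : i.Injective) (hj' : j'.Injective) (hsq : ∀ w, i (j' w) = j (i' w))
    (hpb : ∀ y z, i y = j z → ∃ w, y = j' w ∧ z = i' w) (q : Setoid Z) (s : Setoid Y) :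
    Setoid.comap i (Setoid.map q j ⊔ Setoid.map s i)
      = Setoid.map (Setoid.comap i' q) j' ⊔ s := by
  rw [comap_sup_map i, comap_map_pullback hj hi hj' hsq hpb]

/-- Gluing along a pullback square of injections: numbers of classes. -/
theorem glue_classes [Finite X] {i : Y → X} {j : Z → X} {i' : W → Z} {j' : W → Y}
    (hj : j.Injective) (hi : i.Injective) (hj' : j'.Injective) (hsq : ∀ w, i (j' w) = j (i' w))
    (hpb : ∀ y z, i y = j z → ∃ w, y = j' w ∧ z = i' w) (q : Setoid Z) (s : Setoid Y)
    (U : Set Y) (V : Set X) (T : Set Z) (hV : V = i '' U ∪ (Set.range i)ᶜ)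
    (hT : T = j ⁻¹' (Set.range i)ᶜ) (hcov : (Set.range i)ᶜ ⊆ Set.range j) :
    classesIn (Setoid.map q j ⊔ Setoid.map s i) V
      = classesIn q T + classesIn (Setoid.map (Setoid.comap i' q) j' ⊔ s) U := by
  rw [hV, hT, classesIn_sup_map hi, classesIn_map hj _ _ hcov,
    comap_map_pullback hj hi hj' hsq hpb]

end Glue

section Assoc
variable {A B C D : Type*}

theorem upper_injective : (upper : A ⊕ B → A ⊕ B ⊕ C).Injective := by
  rintro (a | b) (a' | b') h <;> simp_all [upper]

theorem lower_injective : (lower : B ⊕ C → A ⊕ B ⊕ C).Injective := Sum.inr_injective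

theorem outer_injective : (outer : A ⊕ C → A ⊕ B ⊕ C).Injective := by
  rintro (a | b) (a' | b') h <;> simp_all [outer]

/-- Embeddings of three of four rows. -/
def skip4 : A ⊕ B ⊕ C → A ⊕ B ⊕ C ⊕ D :=
  Sum.elim Sum.inl (Sum.elim (fun b => Sum.inr (Sum.inl b)) fun c => Sum.inr (Sum.inr (Sum.inl c)))

def skip3 : A ⊕ B ⊕ D → A ⊕ B ⊕ C ⊕ D :=
  Sum.elim Sum.inl (Sum.elim (fun b => Sum.inr (Sum.inl b)) fun d => Sum.inr (Sum.inr (Sum.inr d)))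

def skip2 : A ⊕ C ⊕ D → A ⊕ B ⊕ C ⊕ D := Sum.elim Sum.inl (fun x => Sum.inr (Sum.inr x))

def skip1 : B ⊕ C ⊕ D → A ⊕ B ⊕ C ⊕ D := Sum.inr

theorem skip4_injective : (skip4 : A ⊕ B ⊕ C → A ⊕ B ⊕ C ⊕ D).Injective := by
  rintro (a | b | c) (a' | b' | c') h <;> simp_all [skip4]
theorem skip3_injective : (skip3 : A ⊕ B ⊕ D → A ⊕ B ⊕ C ⊕ D).Injective := by
  rintro (a | b | c) (a' | b' | c') h <;> simp_all [skip3]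
theorem skip2_injective : (skip2 : A ⊕ C ⊕ D → A ⊕ B ⊕ C ⊕ D).Injective := by
  rintro (a | b | c) (a' | b' | c') h <;> simp_all [skip2]
theorem skip1_injective : (skip1 : B ⊕ C ⊕ D → A ⊕ B ⊕ C ⊕ D).Injective := Sum.inr_injective

theorem sq_left (w : A ⊕ C) :
    (skip2 (upper w) : A ⊕ B ⊕ C ⊕ D) = skip4 (outer w) := by
  rcases w with a | c <;> rfl

theorem pb_left (y : A ⊕ C ⊕ D) (z : A ⊕ B ⊕ C) (h : (skip2 y : A ⊕ B ⊕ C ⊕ D) = skip4 z) :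
    ∃ w : A ⊕ C, y = upper w ∧ z = outer w := by
  rcases y with a | c | d <;> rcases z with a' | b' | c' <;> simp [skip2, skip4] at h
  · exact ⟨Sum.inl a, rfl, by rw [h]; rfl⟩
  · exact ⟨Sum.inr c, rfl, by rw [h]; rfl⟩

theorem sq_right (w : B ⊕ D) :
    (skip3 (lower w) : A ⊕ B ⊕ C ⊕ D) = skip1 (outer w) := by
  rcases w with a | c <;> rfl

theorem pb_right (y : A ⊕ B ⊕ D) (z : B ⊕ C ⊕ D) (h : (skip3 y : A ⊕ B ⊕ C ⊕ D) = skip1 z) :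
    ∃ w : B ⊕ D, y = lower w ∧ z = outer w := by
  rcases y with a | c | d <;> rcases z with a' | b' | c' <;> simp [skip3, skip1] at h
  · exact ⟨Sum.inl c, rfl, by rw [h]; rfl⟩
  · exact ⟨Sum.inr d, rfl, by rw [h]; rfl⟩

variable (α : Setoid (A ⊕ B)) (β : Setoid (B ⊕ C)) (γ : Setoid (C ⊕ D))

theorem stack3 : Setoid.map (stack α β) (skip4 : A ⊕ B ⊕ C → A ⊕ B ⊕ C ⊕ D) ⊔
      Setoid.map (Setoid.map γ lower) skip2
    = Setoid.map (stack β γ) skip1 ⊔ Setoid.map (Setoid.map α upper) skip3 := by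
  have e1 : (skip4 ∘ upper : A ⊕ B → A ⊕ B ⊕ C ⊕ D) = skip3 ∘ upper := by
    funext x; rcases x with x | x <;> rfl
  have e2 : (skip4 ∘ lower : B ⊕ C → A ⊕ B ⊕ C ⊕ D) = skip1 ∘ upper := by
    funext x; rcases x with x | x <;> rfl
  have e3 : (skip2 ∘ lower : C ⊕ D → A ⊕ B ⊕ C ⊕ D) = skip1 ∘ lower := by
    funext x; rcases x with x | x <;> rfl
  unfold stack
  rw [map_sup, map_sup]
  simp only [map_map]
  rw [e1, e2, e3]
  ac_rfl

theorem stack_comp_left : stack (comp α β) γ = Setoid.comap skip2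
    (Setoid.map (stack α β) (skip4 : A ⊕ B ⊕ C → A ⊕ B ⊕ C ⊕ D) ⊔
      Setoid.map (Setoid.map γ lower) skip2) :=
  (glue_rel skip4_injective skip2_injective upper_injective sq_left pb_left _ _).symm

theorem stack_comp_right : stack α (comp β γ) = Setoid.comap skip3
    (Setoid.map (stack β γ) (skip1 : B ⊕ C ⊕ D → A ⊕ B ⊕ C ⊕ D) ⊔
      Setoid.map (Setoid.map α upper) skip3) := by
  rw [glue_rel skip1_injective skip3_injective lower_injective sq_right pb_right, sup_comm]
  rfl

theorem comp_assoc : comp (comp α β) γ = comp α (comp β γ) := by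
  change Setoid.comap outer (stack (comp α β) γ) = Setoid.comap outer (stack α (comp β γ))
  rw [stack_comp_left, stack_comp_right, stack3, ← Setoid.comap_comp, ← Setoid.comap_comp]
  apply Setoid.ext
  rintro (x | x) (y | y) <;> exact Iff.rfl

theorem loops_assoc [Finite A] [Finite B] [Finite C] [Finite D] :
    loops α β + loops (comp α β) γ = loops β γ + loops α (comp β γ) := by
  have hl := glue_classes (skip4_injective (A := A) (B := B) (C := C) (D := D)) skip2_injective
    upper_injective sq_left pb_left (stack α β) (Setoid.map γ lower) (Set.range mid)
    ({x | ∃ b, x = Sum.inr (Sum.inl b)} ∪ {x | ∃ c, x = Sum.inr (Sum.inr (Sum.inl c))})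
    (Set.range mid)
    (by
      ext x
      rcases x with x | x | x | x <;> simp [skip2, mid])
    (by
      ext x
      rcases x with x | x | x  <;> simp [skip2, skip4, mid])
    (by
      intro x
      rcases x with x | x | x | x <;> simp [skip2, skip4])
  have hr := glue_classes (skip1_injective (A := A) (B := B) (C := C) (D := D)) skip3_injective
    lower_injective sq_right pb_right (stack β γ) (Setoid.map α upper) (Set.range mid)
    ({x | ∃ b, x = Sum.inr (Sum.inl b)} ∪ {x | ∃ c, x = Sum.inr (Sum.inr (Sum.inl c))})
    (Set.range mid)
    (by
      ext x
      rcases x with x | x | x | x <;> simp [skip3, mid])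
    (by
      ext x
      rcases x with x | x | x  <;> simp [skip1, skip3, mid])
    (by
      intro x
      rcases x with x | x | x | x <;> simp [skip1, skip3])
  rw [stack3, hr] at hl
  rw [sup_comm (Setoid.map (Setoid.comap outer (stack β γ)) lower)] at hl
  exact hl.symm

/-- The identity diagram, with blocks `{i, i'}`. -/
def idDiag (A : Type*) : Setoid (A ⊕ A) := Setoid.ker (Sum.elim id id)

theorem id_comp (α : Setoid (A ⊕ B)) : comp (idDiag A) α = α := by
  apply le_antisymm
  · let φ : A ⊕ A ⊕ B → A ⊕ B := Sum.elim Sum.inl (Sum.elim Sum.inl Sum.inr)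
    have h : stack (idDiag A) α ≤ Setoid.comap φ α := by
      refine sup_le ?_ ?_ <;> rw [map_le_iff]
      · rintro (x | x) (y | y) h <;> (obtain rfl : x = y := h; exact α.refl' _)
      · rintro (x | x) (y | y) h <;> exact h
    rintro (x | x) (y | y) hxy <;> exact h hxy
  · have h1 : ∀ x : A ⊕ B, stack (idDiag A) α (outer x) (lower x) := by
      rintro (x | x)
      · refine (le_sup_left : Setoid.map (idDiag A) upper ≤ _) ?_
        exact map_rel (idDiag A) upper (show idDiag A (Sum.inl x) (Sum.inr x) from rfl)
      · exact Setoid.refl' _ _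
    intro x y h
    exact Setoid.trans' (stack (idDiag A) α) (Setoid.trans' _ (h1 x)
      ((le_sup_right : Setoid.map α lower ≤ _) (map_rel α lower h))) (Setoid.symm' _ (h1 y))

theorem comp_id (α : Setoid (A ⊕ B)) : comp α (idDiag B) = α := by
  apply le_antisymm
  · let φ : A ⊕ B ⊕ B → A ⊕ B := Sum.elim Sum.inl (Sum.elim Sum.inr Sum.inr)
    have h : stack α (idDiag B) ≤ Setoid.comap φ α := by
      refine sup_le ?_ ?_ <;> rw [map_le_iff]
      · rintro (x | x) (y | y) h <;> exact h
      · rintro (x | x) (y | y) h <;> (obtain rfl : x = y := h; exact α.refl' _)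
    rintro (x | x) (y | y) hxy <;> exact h hxy
  · have h1 : ∀ x : A ⊕ B, stack α (idDiag B) (outer x) (upper x) := by
      rintro (x | x)
      · exact Setoid.refl' _ _
      · refine (le_sup_right : Setoid.map (idDiag B) lower ≤ _) ?_
        exact map_rel (idDiag B) lower (show idDiag B (Sum.inr x) (Sum.inl x) from rfl)
    intro x y h
    exact Setoid.trans' (stack α (idDiag B)) (Setoid.trans' _ (h1 x)
      ((le_sup_left : Setoid.map α upper ≤ _) (map_rel α upper h))) (Setoid.symm' _ (h1 y))

theorem loops_id_left (α : Setoid (A ⊕ B)) : loops (idDiag A) α = 0 := by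
  unfold loops classesIn
  convert Set.ncard_empty (Set (A ⊕ A ⊕ B))
  rw [Set.eq_empty_iff_forall_notMem]
  rintro c ⟨⟨x, rfl⟩, hc⟩
  obtain ⟨y, rfl⟩ := hc (show stack (idDiag A) α x x from Setoid.refl' _ x)
  have h : stack (idDiag A) α (Sum.inl y) (mid y) :=
    (le_sup_left : Setoid.map (idDiag A) upper ≤ _)
      (map_rel (idDiag A) upper (show idDiag A (Sum.inl y) (Sum.inr y) from rfl))
  obtain ⟨z, hz⟩ := hc h
  simp [mid] at hz

theorem loops_id_right (α : Setoid (A ⊕ B)) : loops α (idDiag B) = 0 := by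
  unfold loops classesIn
  convert Set.ncard_empty (Set (A ⊕ B ⊕ B))
  rw [Set.eq_empty_iff_forall_notMem]
  rintro c ⟨⟨x, rfl⟩, hc⟩
  obtain ⟨y, rfl⟩ := hc (show stack α (idDiag B) x x from Setoid.refl' _ x)
  have h : stack α (idDiag B) (Sum.inr (Sum.inr y)) (mid y) :=
    (le_sup_right : Setoid.map (idDiag B) lower ≤ _)
      (map_rel (idDiag B) lower (show idDiag B (Sum.inr y) (Sum.inl y) from rfl))
  obtain ⟨z, hz⟩ := hc h
  simp [mid] at hz

end Assoc
end Diagram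

namespace Diagram

section Pairing
variable {A B C X : Type*}

/-- Every block has exactly two elements. -/
def AllPairs (r : Setoid X) : Prop := ∀ c ∈ r.classes, c.ncard = 2

theorem allPairs_iff {r : Setoid X} :
    AllPairs r ↔ ∀ x, ∃ y, y ≠ x ∧ ∀ z, r x z ↔ z = x ∨ z = y := by
  constructor
  · intro h x
    have h2 := h _ (r.mem_classes x)
    obtain ⟨a, b, hab, hs⟩ := Set.ncard_eq_two.1 h2
    have hz : ∀ z, r x z ↔ z = a ∨ z = b := by
      intro z
      have : z ∈ {w | r w x} ↔ z ∈ ({a, b} : Set X) := by rw [hs]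
      rw [r.comm']
      simpa using this
    rcases (hz x).1 (r.refl' x) with rfl | rfl
    · exact ⟨b, hab.symm, hz⟩
    · exact ⟨a, hab, fun z => (hz z).trans or_comm⟩
  · rintro h _ ⟨x, rfl⟩
    obtain ⟨y, hy, hz⟩ := h x
    rw [Set.ncard_eq_two]
    refine ⟨x, y, hy.symm, ?_⟩
    ext z
    rw [Set.mem_ofPred_eq, r.comm', hz]
    simp

theorem AllPairs.exists_partner {r : Setoid X} (h : AllPairs r) :
    ∃ p : X → X, p.Involutive ∧ (∀ x, p x ≠ x) ∧ ∀ x z, r x z ↔ z = x ∨ z = p x := by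
  choose p hp hr using allPairs_iff.1 h
  refine ⟨p, fun x => ?_, hp, hr⟩
  have h1 : r (p x) x := r.symm' ((hr x (p x)).2 (Or.inr rfl))
  rcases (hr _ _).1 h1 with h2 | h2
  · exact absurd h2.symm (hp x)
  · exact h2.symm

theorem two_endpoints [Finite X] {f g : X → X} (hf : f.Involutive) (hg : g.Involutive)
    {t : Setoid X} (htf : ∀ a, t a (f a)) (htg : ∀ a, t a (g a))
    (ht : ∀ s : Setoid X, (∀ a, s a (f a)) → (∀ a, s a (g a)) → t ≤ s)
    {x : X} (hgx : g x = x) (hfx : f x ≠ x) :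
    ∃ y, y ≠ x ∧ t x y ∧ (f y = y ∨ g y = y) ∧
      ∀ z, t x z → (f z = z ∨ g z = z) → z = x ∨ z = y := by
  set h : X → X := f ∘ g with hh
  have hinj : h.Injective := hf.injective.comp hg.injective
  have hper : x ∈ Function.periodicPts h := by
    have := hinj.mem_periodicPts x
    exact this
  set N := Function.minimalPeriod h x with hN
  have hN0 : 0 < N := Function.minimalPeriod_pos_of_mem_periodicPts hper
  have hNx : h^[N] x = x := Function.iterate_minimalPeriod
  have hN1 : N ≠ 1 := by
    intro h1
    rw [h1] at hNx
    apply hfx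
    simpa [hh, hgx] using hNx
  have key : ∀ i, h^[i] (g (h^[i] x)) = x := by
    intro i
    induction i with
    | zero => exact hgx
    | succ i ih =>
      rw [Function.iterate_succ_apply, Function.iterate_succ_apply' h i x]
      have : h (g (h (h^[i] x))) = g (h^[i] x) := by
        simp only [hh, Function.comp_apply, hg _, hf _]
      rw [this, ih]
  have hdvd : ∀ m, h^[m] x = x → N ∣ m := fun m hm =>
    Function.IsPeriodicPt.minimalPeriod_dvd hm
  have hfg : ∀ z, f z = h (g z) := fun z => by simp only [hh, Function.comp_apply, hg _]
  have htO : ∀ i, t x (h^[i] x) := by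
    intro i
    induction i with
    | zero => exact t.refl' x
    | succ i ih =>
      rw [Function.iterate_succ_apply']
      exact t.trans' ih (t.trans' (htg _) (htf _))
  have hgO : ∀ z, (∃ i, h^[i] x = z) → ∃ i, h^[i] x = g z := by
    rintro _ ⟨i, rfl⟩
    refine ⟨i * (N - 1), hinj.iterate i ?_⟩
    rw [key, ← Function.iterate_add_apply]
    have : i + i * (N - 1) = N * i := by
      obtain ⟨M, hM⟩ : ∃ M, N = M + 1 := ⟨N - 1, by omega⟩
      rw [hM, Nat.add_sub_cancel]; ring
    rw [this]
    exact Function.IsPeriodicPt.mul_const (show Function.IsPeriodicPt h N x from hNx) i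
  have hfO : ∀ z, (∃ i, h^[i] x = z) → ∃ i, h^[i] x = f z := by
    intro z hz
    obtain ⟨i, hi⟩ := hgO z hz
    exact ⟨i + 1, by rw [Function.iterate_succ_apply', hi, ← hfg]⟩
  have hO : ∀ z, t x z → ∃ i, h^[i] x = z := by
    intro z hz
    let s : Setoid X :=
      { r := fun a b => (∃ i, h^[i] x = a) ↔ (∃ i, h^[i] x = b)
        iseqv := ⟨fun _ => Iff.rfl, fun h => h.symm, fun h h' => h.trans h'⟩ }
    have hs : t ≤ s := by
      refine ht s (fun a => ⟨hfO a, fun h' => ?_⟩) (fun a => ⟨hgO a, fun h' => ?_⟩)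
      · have := hfO _ h'; rwa [hf] at this
      · have := hgO _ h'; rwa [hg] at this
    exact (hs hz).1 ⟨0, rfl⟩
  have hgfix : ∀ i, g (h^[i] x) = h^[i] x ↔ h^[2 * i] x = x := by
    intro i
    rw [two_mul, Function.iterate_add_apply]
    constructor
    · intro h1
      have := key i
      rwa [h1] at this
    · intro h1
      exact hinj.iterate i ((key i).trans h1.symm)
  have hffix : ∀ i, 0 < i → (f (h^[i] x) = h^[i] x ↔ h^[2 * i - 1] x = x) := by
    intro i hi
    obtain ⟨j, rfl⟩ : ∃ j, i = j + 1 := ⟨i - 1, by omega⟩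
    have k1 : h^[j] (f (h^[j+1] x)) = x := by
      rw [hfg, ← Function.iterate_succ_apply]
      exact key (j + 1)
    have e : 2 * (j + 1) - 1 = j + (j + 1) := by omega
    rw [e, Function.iterate_add_apply h j (j + 1)]
    constructor
    · intro h1
      rwa [h1] at k1
    · intro h1
      exact hinj.iterate j (k1.trans h1.symm)
  have hc1 : 0 < (N + 1) / 2 := by omega
  have hc2 : (N + 1) / 2 < N := by omega
  refine ⟨h^[(N + 1) / 2] x, ?_, htO _, ?_, ?_⟩
  · intro h1
    exact absurd (Nat.le_of_dvd hc1 (hdvd _ h1)) (by omega)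
  · rcases Nat.even_or_odd' N with ⟨m, hm | hm⟩
    · right
      rw [hgfix]
      have : 2 * ((N + 1) / 2) = N := by omega
      rw [this, hNx]
    · left
      rw [hffix _ hc1]
      have : 2 * ((N + 1) / 2) - 1 = N := by omega
      rw [this, hNx]
  · intro z hz hfix
    obtain ⟨i, rfl⟩ := hO z hz
    rw [← Function.iterate_mod_minimalPeriod_eq, ← hN] at hfix ⊢
    have hi := Nat.mod_lt i hN0
    generalize i % N = k at *
    rcases Nat.eq_zero_or_pos k with rfl | hk
    · exact Or.inl rfl
    · right
      have : k = (N + 1) / 2 := by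
        rcases hfix with h1 | h1
        · rw [hffix _ hk] at h1
          obtain ⟨c, hc⟩ := hdvd _ h1
          have : c = 1 := by
            have h3 : c < 2 := by
              by_contra h4
              have : N * 2 ≤ N * c := Nat.mul_le_mul_left N (by omega)
              omega
            have h5 : c ≠ 0 := by rintro rfl; omega
            omega
          subst this
          omega
        · rw [hgfix] at h1
          obtain ⟨c, hc⟩ := hdvd _ h1
          have : c = 1 := by
            have h3 : c < 2 := by
              by_contra h4
              have : N * 2 ≤ N * c := Nat.mul_le_mul_left N (by omega)
              omega
            have h5 : c ≠ 0 := by rintro rfl; omega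
            omega
          subst this
          omega
      rw [this]

theorem AllPairs.comp [Finite A] [Finite B] [Finite C] {α : Setoid (A ⊕ B)}
    {β : Setoid (B ⊕ C)} (hα : AllPairs α) (hβ : AllPairs β) : AllPairs (comp α β) := by
  obtain ⟨p, hp, hp', hpr⟩ := hα.exists_partner
  obtain ⟨q, hq, hq', hqr⟩ := hβ.exists_partner
  let f : A ⊕ B ⊕ C → A ⊕ B ⊕ C := Sum.elim (fun a => upper (p (Sum.inl a)))
    (Sum.elim (fun b => upper (p (Sum.inr b))) (fun c => Sum.inr (Sum.inr c)))
  let g : A ⊕ B ⊕ C → A ⊕ B ⊕ C := Sum.elim Sum.inl (fun y => lower (q y))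
  have fu : ∀ w : A ⊕ B, f (upper w) = upper (p w) := by rintro (w | w) <;> rfl
  have gl : ∀ w : B ⊕ C, g (lower w) = lower (q w) := fun w => rfl
  have hf : f.Involutive := by
    rintro (a | b | c)
    · exact (fu (p (Sum.inl a))).trans (by rw [hp]; rfl)
    · exact (fu (p (Sum.inr b))).trans (by rw [hp]; rfl)
    · rfl
  have hg : g.Involutive := by
    rintro (a | y)
    · rfl
    · exact (gl (q y)).trans (by rw [hq]; rfl)
  have hup : ∀ w, stack α β (upper w) (upper (p w)) := fun w =>
    (le_sup_left : Setoid.map α upper ≤ _) (map_rel α upper ((hpr _ _).2 (Or.inr rfl)))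
  have hlo : ∀ w, stack α β (lower w) (lower (q w)) := fun w =>
    (le_sup_right : Setoid.map β lower ≤ _) (map_rel β lower ((hqr _ _).2 (Or.inr rfl)))
  have htf : ∀ x, stack α β x (f x) := by
    rintro (a | b | c)
    · exact hup (Sum.inl a)
    · exact hup (Sum.inr b)
    · exact Setoid.refl' _ _
  have htg : ∀ x, stack α β x (g x) := by
    rintro (a | y)
    · exact Setoid.refl' _ _
    · exact hlo y
  have ht : ∀ s : Setoid (A ⊕ B ⊕ C), (∀ a, s a (f a)) → (∀ a, s a (g a)) → stack α β ≤ s := by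
    intro s hsf hsg
    refine sup_le ?_ ?_ <;> rw [map_le_iff] <;> intro x y hxy
    · rcases (hpr _ _).1 hxy with rfl | rfl
      · exact s.refl' _
      · rw [← fu]; exact hsf _
    · rcases (hqr _ _).1 hxy with rfl | rfl
      · exact s.refl' _
      · rw [← gl]; exact hsg _
  have ffix : ∀ x, f x = x → ∃ c, x = Sum.inr (Sum.inr c) := by
    rintro (a | b | c) h
    · exact absurd (upper_injective (a₂ := Sum.inl a) h) (hp' _)
    · exact absurd (upper_injective (a₂ := Sum.inr b) h) (hp' _)
    · exact ⟨c, rfl⟩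
  have gfix : ∀ x, g x = x → ∃ a, x = Sum.inl a := by
    rintro (a | y) h
    · exact ⟨a, rfl⟩
    · exact absurd (Sum.inr_injective h) (hq' _)
  have ofix : ∀ x, (f x = x ∨ g x = x) ↔ ∃ w, x = outer w := by
    intro x
    constructor
    · rintro (h | h)
      · obtain ⟨c, rfl⟩ := ffix x h
        exact ⟨Sum.inr c, rfl⟩
      · obtain ⟨c, rfl⟩ := gfix x h
        exact ⟨Sum.inl c, rfl⟩
    · rintro ⟨w | w, rfl⟩
      · exact Or.inr rfl
      · exact Or.inl rfl
  rw [allPairs_iff]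
  intro w
  have main : ∃ y, y ≠ outer w ∧ stack α β (outer w) y ∧ (f y = y ∨ g y = y) ∧
      ∀ z, stack α β (outer w) z → (f z = z ∨ g z = z) → z = outer w ∨ z = y := by
    rcases w with a | c
    · refine two_endpoints hf hg htf htg ht rfl fun h => ?_
      obtain ⟨c, hc⟩ := ffix _ h
      simp [outer] at hc
    · have := two_endpoints (x := outer (Sum.inr c)) hg hf htg htf
        (fun s h1 h2 => ht s h2 h1) rfl fun h => by
        obtain ⟨c, hc⟩ := gfix _ h
        simp [outer] at hc
      simpa only [or_comm (a := g _ = _)] using this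
  obtain ⟨y, hy, hty, hyf, hyu⟩ := main
  obtain ⟨v, rfl⟩ := (ofix y).1 hyf
  refine ⟨v, fun h => hy (h ▸ rfl), fun z => ⟨fun h => ?_, ?_⟩⟩
  · rcases hyu (outer z) h ((ofix _).2 ⟨z, rfl⟩) with h | h
    · exact Or.inl (outer_injective h)
    · exact Or.inr (outer_injective h)
  · rintro (rfl | rfl)
    · exact Setoid.refl' _ _
    · exact hty

theorem allPairs_id (A : Type*) : AllPairs (idDiag A) := by
  rw [allPairs_iff]
  rintro (a | a)
  · refine ⟨Sum.inr a, by simp, ?_⟩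
    rintro (z | z) <;> change a = z ↔ _ <;> simp [eq_comm]
  · refine ⟨Sum.inl a, by simp, ?_⟩
    rintro (z | z) <;> change a = z ↔ _ <;> simp [eq_comm]

end Pairing

section Planar
variable {n : ℕ}

/-- Position of a vertex on the boundary of the rectangle, read as
`1, …, n, n', …, 1'` (counted from zero). -/
def circ : Fin n ⊕ Fin n → ℕ :=
  Sum.elim (fun i => (i : ℕ)) (fun i => 2 * n - 1 - (i : ℕ))

/-- The diagram can be drawn in the rectangle without crossings: no two distinct blocks
interleave along the boundary of the rectangle. -/
def Planar (r : Setoid (Fin n ⊕ Fin n)) : Prop :=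
  ∀ a b c d, circ a < circ b → circ b < circ c → circ c < circ d → r a c → r b d → r a b

theorem circ_injective : (circ : Fin n ⊕ Fin n → ℕ).Injective := by
  rintro (i | i) (j | j) h <;> simp [circ] at h
  · exact congrArg _ (Fin.ext h)
  · omega
  · omega
  · exact congrArg _ (Fin.ext (by omega))

open Classical in
/-- Parity of the number of points of `P` before `u`. -/
noncomputable def cpar (P : Set (Fin n ⊕ Fin n)) (u : Fin n ⊕ Fin n) : ZMod 2 :=
  ∑ w, if circ w < circ u ∧ w ∈ P then 1 else 0

open Classical in
/-- Parity of the number of points of `Q` to the left of `i`. -/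
noncomputable def rpar (Q : Set (Fin n)) (i : Fin n) : ZMod 2 :=
  ∑ j, if j < i ∧ j ∈ Q then 1 else 0

open Classical in
theorem sum_pairs {X : Type*} [Fintype X] {r : Setoid X} (h : AllPairs r) (S : Set X)
    (hS : ∀ x y, r x y → x ∈ S → y ∈ S) : (∑ w, if w ∈ S then (1 : ZMod 2) else 0) = 0 := by
  obtain ⟨p, hp, hp', hpr⟩ := h.exists_partner
  have hrp : ∀ x, r x (p x) := fun x => (hpr _ _).2 (Or.inr rfl)
  refine Finset.sum_involution (fun x _ => p x) ?_ ?_ ?_ ?_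
  · intro a _
    have : p a ∈ S ↔ a ∈ S := ⟨hS _ _ (r.symm' (hrp a)), hS _ _ (hrp a)⟩
    simp only [this]
    split_ifs
    · decide
    · decide
  · intro a _ _
    exact hp' a
  · intro a _; exact Finset.mem_univ _
  · intro a _; exact hp a

open Classical in
theorem cpar_eq_rpar (P : Set (Fin n ⊕ Fin n))
    (htot : (∑ w, if w ∈ P then (1 : ZMod 2) else 0) = 0) (v : Fin n ⊕ Fin n) (hv : v ∉ P) :
    cpar P v = Sum.elim (rpar (Sum.inl ⁻¹' P)) (rpar (Sum.inr ⁻¹' P)) v := by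
  rw [Fintype.sum_sum_type] at htot
  unfold cpar
  rw [Fintype.sum_sum_type]
  rcases v with i | i
  · have : (∑ j : Fin n, if circ (Sum.inr j : Fin n ⊕ Fin n) < circ (Sum.inl i : Fin n ⊕ Fin n) ∧
        (Sum.inr j : Fin n ⊕ Fin n) ∈ P then (1 : ZMod 2) else 0) = 0 := by
      refine Finset.sum_eq_zero fun j _ => if_neg ?_
      rintro ⟨h, -⟩
      simp only [circ, Sum.elim_inl, Sum.elim_inr] at h
      omega
    rw [this, add_zero]
    rfl
  · have h1 : (∑ j : Fin n, if circ (Sum.inl j : Fin n ⊕ Fin n) < circ (Sum.inr i : Fin n ⊕ Fin n) ∧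
        (Sum.inl j : Fin n ⊕ Fin n) ∈ P then (1 : ZMod 2) else 0)
        = ∑ j : Fin n, if (Sum.inl j : Fin n ⊕ Fin n) ∈ P then (1 : ZMod 2) else 0 := by
      refine Finset.sum_congr rfl fun j _ => ?_
      have : circ (Sum.inl j : Fin n ⊕ Fin n) < circ (Sum.inr i : Fin n ⊕ Fin n) := by
        simp only [circ, Sum.elim_inl, Sum.elim_inr]
        omega
      simp [this]
    have h2 : (∑ j : Fin n, if (Sum.inr j : Fin n ⊕ Fin n) ∈ P then (1 : ZMod 2) else 0)
        = rpar (Sum.inr ⁻¹' P) i +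
        ∑ j : Fin n, if circ (Sum.inr j : Fin n ⊕ Fin n) < circ (Sum.inr i : Fin n ⊕ Fin n) ∧
        (Sum.inr j : Fin n ⊕ Fin n) ∈ P then (1 : ZMod 2) else 0 := by
      unfold rpar
      rw [← Finset.sum_add_distrib]
      refine Finset.sum_congr rfl fun j _ => ?_
      have hc : circ (Sum.inr j : Fin n ⊕ Fin n) < circ (Sum.inr i : Fin n ⊕ Fin n) ↔ i < j := by
        simp only [circ, Sum.elim_inr, Fin.lt_def]
        omega
      simp only [hc, Set.mem_preimage]
      rcases lt_trichotomy i j with h | h | h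
      · simp [h, h.not_gt]
      · subst h
        simp [hv]
      · simp [h, h.not_gt]
    rw [h1]
    rw [h2] at htot
    simp only [Sum.elim_inr]
    have h3 : ∀ a b c : ZMod 2, a + (b + c) = 0 → a + c = b := by decide
    exact h3 _ _ _ htot

open Classical in
theorem cpar_eq_of_rel {r : Setoid (Fin n ⊕ Fin n)} (hr : AllPairs r) (hpl : Planar r)
    {P : Set (Fin n ⊕ Fin n)} (hP : ∀ x y, r x y → x ∈ P → y ∈ P) {u v : Fin n ⊕ Fin n}
    (huv : r u v) (hu : u ∉ P) : cpar P u = cpar P v := by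
  wlog hlt : circ u < circ v generalizing u v
  · rcases Nat.lt_or_ge (circ v) (circ u) with h | h
    · exact (this (r.symm' huv) (fun h' => hu (hP _ _ (r.symm' huv) h')) h).symm
    · rw [circ_injective (le_antisymm (not_lt.1 hlt) h)]
  obtain ⟨y, hy, hyr⟩ := allPairs_iff.1 hr u
  have hvy : v = y := by
    rcases (hyr v).1 huv with h | h
    · subst h; exact absurd hlt (lt_irrefl _)
    · exact h
  subst hvy
  have key := sum_pairs hr {w | (circ u < circ w ∧ circ w < circ v) ∧ w ∈ P} (by
    rintro w w' hww ⟨⟨h1, h2⟩, h3⟩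
    have hw : ¬ r u w := by
      intro h
      rcases (hyr w).1 h with rfl | rfl <;> omega
    have hw' : ¬ r u w' := fun h => hw (r.trans' h (r.symm' hww))
    refine ⟨⟨?_, ?_⟩, hP _ _ hww h3⟩
    · by_contra h
      have hne : circ w' ≠ circ u := fun h' => hw' (circ_injective h' ▸ r.refl' _)
      exact hw' (r.symm' (hpl w' u w v (by omega) h1 h2 (r.symm' hww) huv))
    · by_contra h
      have hne : circ w' ≠ circ v := fun h' => hw' (circ_injective h' ▸ huv)
      exact hw (hpl u w v w' h1 h2 (by omega) huv hww))
  have hsum : cpar P v = cpar P u +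
      ∑ w, if w ∈ {w | (circ u < circ w ∧ circ w < circ v) ∧ w ∈ P} then (1 : ZMod 2) else 0 := by
    unfold cpar
    rw [← Finset.sum_add_distrib]
    refine Finset.sum_congr rfl fun w _ => ?_
    simp only [Set.mem_ofPred_eq]
    by_cases hw : w ∈ P
    · have hne : circ w ≠ circ u := fun h => hu (circ_injective h ▸ hw)
      simp only [hw, and_true]
      rcases Nat.lt_or_gt_of_ne hne with h | h
      · simp [h, h.trans hlt, h.not_gt]
      · simp [h, h.not_gt]
    · simp [hw]
  rw [hsum]
  exact left_eq_add.2 (by convert key)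

theorem Planar.comp {α β : Setoid (Fin n ⊕ Fin n)} (hα : AllPairs α) (hβ : AllPairs β)
    (pα : Planar α) (pβ : Planar β) : Planar (comp α β) := by
  classical
  intro a b c d hab hbc hcd hac hbd
  by_contra hnab
  let K : Set (Fin n ⊕ Fin n ⊕ Fin n) := {x | stack α β (outer a) x}
  have hK : ∀ x y, stack α β x y → x ∈ K → y ∈ K := fun x y h hx => Setoid.trans' _ hx h
  let col : Fin n ⊕ Fin n ⊕ Fin n → ZMod 2 := Sum.elim (rpar (Sum.inl ⁻¹' K))
    (Sum.elim (rpar (mid ⁻¹' K)) (rpar ((fun i => Sum.inr (Sum.inr i)) ⁻¹' K)))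
  let s : Setoid (Fin n ⊕ Fin n ⊕ Fin n) :=
    { r := fun x y => (x ∈ K ↔ y ∈ K) ∧ (x ∉ K → col x = col y)
      iseqv :=
        { refl := fun x => ⟨Iff.rfl, fun _ => rfl⟩
          symm := fun h => ⟨h.1.symm, fun hy => (h.2 (fun hx => hy (h.1.1 hx))).symm⟩
          trans := fun h h' => ⟨h.1.trans h'.1, fun hx =>
            (h.2 hx).trans (h'.2 (fun hy => hx (h.1.2 hy)))⟩ } }
  have hs : stack α β ≤ s := by
    refine sup_le ?_ ?_ <;> rw [map_le_iff] <;> intro x y hxy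
    · have hst : ∀ x y, α x y → stack α β (upper x) (upper y) := fun x y h =>
        (le_sup_left : Setoid.map α upper ≤ _) (map_rel α upper h)
      have hP : ∀ x y, α x y → x ∈ upper ⁻¹' K → y ∈ upper ⁻¹' K :=
        fun x y h => hK _ _ (hst x y h)
      refine ⟨⟨hP _ _ hxy, hP _ _ (α.symm' hxy)⟩, fun hx => ?_⟩
      have htot := sum_pairs hα _ hP
      have hy : y ∉ upper ⁻¹' K := fun h => hx (hP _ _ (α.symm' hxy) h)
      have e := cpar_eq_of_rel hα pα hP hxy hx
      rw [cpar_eq_rpar _ htot x hx, cpar_eq_rpar _ htot y hy] at e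
      have hcol : ∀ x, col (upper x) = Sum.elim (rpar (Sum.inl ⁻¹' (upper ⁻¹' K)))
          (rpar (Sum.inr ⁻¹' (upper ⁻¹' K))) x := by
        rintro (x | x) <;> rfl
      rw [hcol, hcol, e]
    · have hst : ∀ x y, β x y → stack α β (lower x) (lower y) := fun x y h =>
        (le_sup_right : Setoid.map β lower ≤ _) (map_rel β lower h)
      have hP : ∀ x y, β x y → x ∈ lower ⁻¹' K → y ∈ lower ⁻¹' K :=
        fun x y h => hK _ _ (hst x y h)
      refine ⟨⟨hP _ _ hxy, hP _ _ (β.symm' hxy)⟩, fun hx => ?_⟩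
      have htot := sum_pairs hβ _ hP
      have hy : y ∉ lower ⁻¹' K := fun h => hx (hP _ _ (β.symm' hxy) h)
      have e := cpar_eq_of_rel hβ pβ hP hxy hx
      rw [cpar_eq_rpar _ htot x hx, cpar_eq_rpar _ htot y hy] at e
      have hcol : ∀ x, col (lower x) = Sum.elim (rpar (Sum.inl ⁻¹' (lower ⁻¹' K)))
          (rpar (Sum.inr ⁻¹' (lower ⁻¹' K))) x := by
        rintro (x | x) <;> rfl
      rw [hcol, hcol, e]
  have hpair := hα.comp hβ
  have hP : ∀ x y, Diagram.comp α β x y → x ∈ outer ⁻¹' K → y ∈ outer ⁻¹' K :=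
    fun x y h => hK _ _ h
  have htot := sum_pairs hpair _ hP
  have hb : b ∉ outer ⁻¹' K := hnab
  have hd : d ∉ outer ⁻¹' K := fun h => hb (hP _ _ (Setoid.symm' _ hbd) h)
  have hcol : ∀ x, col (outer x) = Sum.elim (rpar (Sum.inl ⁻¹' (outer ⁻¹' K)))
      (rpar (Sum.inr ⁻¹' (outer ⁻¹' K))) x := by
    rintro (x | x) <;> rfl
  have e : cpar (outer ⁻¹' K) b = cpar (outer ⁻¹' K) d := by
    rw [cpar_eq_rpar _ htot b hb, cpar_eq_rpar _ htot d hd, ← hcol, ← hcol]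
    exact (hs hbd).2 hb
  have hmem : ∀ w, w ∈ outer ⁻¹' K ↔ w = a ∨ w = c := by
    obtain ⟨y, hy, hyr⟩ := allPairs_iff.1 hpair a
    have : c = y := by
      rcases (hyr c).1 hac with h | h
      · subst h; omega
      · exact h
    subst this
    exact hyr
  have hcard : ∀ u, cpar (outer ⁻¹' K) u = (if circ a < circ u then 1 else 0) +
      (if circ c < circ u then 1 else 0) := by
    intro u
    unfold cpar
    have hne : a ≠ c := by rintro rfl; omega
    rw [← Finset.sum_subset (Finset.subset_univ {a, c}), Finset.sum_pair hne]
    · simp [hmem]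
    · intro w _ hw
      rw [if_neg]
      rintro ⟨-, h⟩
      rw [hmem] at h
      simp at hw
      tauto
  rw [hcard, hcard, if_pos hab, if_neg (by omega), if_pos (by omega), if_pos hcd] at e
  exact absurd e (by decide)

theorem planar_id : Planar (idDiag (Fin n)) := by
  intro a b c d h1 h2 h3 h4 h5
  change Sum.elim id id a = Sum.elim id id c at h4
  change Sum.elim id id b = Sum.elim id id d at h5
  change Sum.elim id id a = Sum.elim id id b
  rcases a with a | a <;> rcases b with b | b <;> rcases c with c | c <;>
    rcases d with d | d <;> simp [circ] at * <;> omega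

end Planar
end Diagram

/-- The partition monoid: set partitions of the two rows of `n` vertices (`Sum.inl` the upper
row, `Sum.inr` the lower row). -/
@[ext]
structure PartitionMonoid (n : ℕ) where
  rel : Setoid (Fin n ⊕ Fin n)

namespace PartitionMonoid
variable {n : ℕ}

instance : Monoid (PartitionMonoid n) where
  mul α β := ⟨Diagram.comp α.rel β.rel⟩
  one := ⟨Diagram.idDiag (Fin n)⟩
  mul_assoc α β γ := PartitionMonoid.ext (Diagram.comp_assoc α.rel β.rel γ.rel)
  one_mul α := PartitionMonoid.ext (Diagram.id_comp α.rel)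
  mul_one α := PartitionMonoid.ext (Diagram.comp_id α.rel)

/-- The number of transversal blocks. -/
noncomputable def rank (α : PartitionMonoid n) : ℕ :=
  {c ∈ α.rel.classes | (∃ i, Sum.inl i ∈ c) ∧ ∃ j, Sum.inr j ∈ c}.ncard

end PartitionMonoid

/-- The Jones monoid: planar partitions all of whose blocks have size two. -/
def JonesMonoid (n : ℕ) : Submonoid (PartitionMonoid n) where
  carrier := {α | Diagram.AllPairs α.rel ∧ Diagram.Planar α.rel}
  mul_mem' ha hb := ⟨ha.1.comp hb.1, Diagram.Planar.comp ha.1 hb.1 ha.2 hb.2⟩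
  one_mem' := ⟨Diagram.allPairs_id (Fin n), Diagram.planar_id⟩

/-- The set `I_r` of elements of the Jones monoid of rank at most `r`. -/
def jonesIdeal (n r : ℕ) : Set (JonesMonoid n) := {α | α.1.rank ≤ r}

/-- The rank of a subsemigroup `T` (given as a set): the least size of a subset that generates
`T` as a semigroup. -/
noncomputable def semigroupRank {S : Type*} [Semigroup S] (T : Set S) : ℕ :=
  sInf {m | ∃ A : Finset S, A.card = m ∧ (Subsemigroup.closure (A : Set S) : Set S) = T}

/-- A twisting of a monoid `S` with values in `R`. -/
structure Twisting (S R : Type*) [Monoid S] [CommRing R] where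
  toFun : S → S → R
  cocycle : ∀ a b c, toFun a b * toFun (a * b) c = toFun a (b * c) * toFun b c
  one_left : ∀ a, toFun 1 a = 1
  one_right : ∀ a, toFun a 1 = 1

/-- The twisted semigroup algebra: the free module on `S` with `a ⋆ b = ψ(a, b) ab`. -/
def TwistedAlgebra {S R : Type*} [Monoid S] [CommRing R] (_ψ : Twisting S R) : Type _ := S →₀ R

namespace TwistedAlgebra
variable {S R : Type*} [Monoid S] [CommRing R] (ψ : Twisting S R)

noncomputable instance : AddCommGroup (TwistedAlgebra ψ) :=
  inferInstanceAs (AddCommGroup (S →₀ R))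

noncomputable instance : Module R (TwistedAlgebra ψ) :=
  inferInstanceAs (Module R (S →₀ R))

/-- The basis element belonging to `a : S`. -/
noncomputable def of (a : S) : TwistedAlgebra ψ := Finsupp.single a (1 : R)

/-- The elements `of ψ a` form a basis. -/
noncomputable def basis : Module.Basis S R (TwistedAlgebra ψ) :=
  Module.Basis.ofRepr (LinearEquiv.refl R (S →₀ R))

theorem basis_apply (a : S) : basis ψ a = of ψ a := rfl

/-- The bilinear multiplication with `of ψ a * of ψ b = ψ(a, b) of ψ (a * b)`. -/
noncomputable def mulHom :
    TwistedAlgebra ψ →ₗ[R] TwistedAlgebra ψ →ₗ[R] TwistedAlgebra ψ :=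
  (basis ψ).constr R fun a => (basis ψ).constr R fun b => ψ.toFun a b • of ψ (a * b)

theorem mulHom_of (a b : S) : mulHom ψ (of ψ a) (of ψ b) = ψ.toFun a b • of ψ (a * b) := by
  simp only [mulHom, ← basis_apply, Module.Basis.constr_basis]

theorem mulHom_assoc (x y z : TwistedAlgebra ψ) :
    mulHom ψ (mulHom ψ x y) z = mulHom ψ x (mulHom ψ y z) := by
  have h1 : ∀ a b z, mulHom ψ (mulHom ψ (of ψ a) (of ψ b)) z
      = mulHom ψ (of ψ a) (mulHom ψ (of ψ b) z) := by
    intro a b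
    refine LinearMap.congr_fun (f := mulHom ψ (mulHom ψ (of ψ a) (of ψ b)))
      (g := mulHom ψ (of ψ a) ∘ₗ mulHom ψ (of ψ b)) ((basis ψ).ext fun c => ?_)
    simp only [basis_apply, LinearMap.comp_apply, mulHom_of, map_smul, LinearMap.smul_apply,
      smul_smul, mul_assoc, ψ.cocycle]
    rw [mul_comm, mul_comm (ψ.toFun b c), ← ψ.cocycle, mul_comm]
  have h2 : ∀ a y, mulHom ψ (mulHom ψ (of ψ a) y) z = mulHom ψ (of ψ a) (mulHom ψ y z) := by
    intro a
    refine LinearMap.congr_fun (f := (mulHom ψ).flip z ∘ₗ mulHom ψ (of ψ a))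
      (g := mulHom ψ (of ψ a) ∘ₗ (mulHom ψ).flip z) ((basis ψ).ext fun b => ?_)
    exact h1 a b z
  refine LinearMap.congr_fun (f := (mulHom ψ).flip z ∘ₗ (mulHom ψ).flip y)
    (g := (mulHom ψ).flip (mulHom ψ y z)) ((basis ψ).ext fun a => ?_) x
  exact h2 a y

theorem one_mulHom (x : TwistedAlgebra ψ) : mulHom ψ (of ψ 1) x = x := by
  refine LinearMap.congr_fun (f := mulHom ψ (of ψ 1)) (g := LinearMap.id)
    ((basis ψ).ext fun a => ?_) x
  rw [basis_apply, mulHom_of, ψ.one_left, one_mul, one_smul, LinearMap.id_apply]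

theorem mulHom_one (x : TwistedAlgebra ψ) : mulHom ψ x (of ψ 1) = x := by
  refine LinearMap.congr_fun (f := (mulHom ψ).flip (of ψ 1)) (g := LinearMap.id)
    ((basis ψ).ext fun a => ?_) x
  rw [basis_apply, LinearMap.flip_apply, mulHom_of, ψ.one_right, mul_one, one_smul,
    LinearMap.id_apply]

noncomputable instance : Ring (TwistedAlgebra ψ) :=
  { (inferInstance : AddCommGroup (TwistedAlgebra ψ)) with
    mul := fun x y => mulHom ψ x y
    one := of ψ 1
    left_distrib := fun x y z => map_add (mulHom ψ x) y z
    right_distrib := fun x y z => LinearMap.map_add₂ (mulHom ψ) x y z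
    zero_mul := fun x => LinearMap.map_zero₂ (mulHom ψ) x
    mul_zero := fun x => map_zero (mulHom ψ x)
    mul_assoc := mulHom_assoc ψ
    one_mul := one_mulHom ψ
    mul_one := mulHom_one ψ }

theorem of_mul_of (a b : S) : of ψ a * of ψ b = ψ.toFun a b • of ψ (a * b) := mulHom_of ψ a b

theorem one_def : (1 : TwistedAlgebra ψ) = of ψ 1 := rfl

noncomputable instance : Algebra R (TwistedAlgebra ψ) :=
  Algebra.ofModule (fun r x y => LinearMap.map_smul₂ (mulHom ψ) r x y)
    (fun r x y => map_smul (mulHom ψ x) r y)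

end TwistedAlgebra

/-- The twisting `ψ(α, β) = δ ^ m(α, β)`, where `m(α, β)` is the number of components removed
from the middle row when `αβ` is formed. -/
noncomputable def jonesTwisting (n : ℕ) (δ : ℂ) : Twisting (JonesMonoid n) ℂ where
  toFun α β := δ ^ Diagram.loops α.1.rel β.1.rel
  cocycle α β γ := by
    rw [← pow_add, ← pow_add]
    exact congrArg _ ((Diagram.loops_assoc α.1.rel β.1.rel γ.1.rel).trans (add_comm _ _))
  one_left α := by
    change δ ^ Diagram.loops (Diagram.idDiag (Fin n)) α.1.rel = 1
    rw [Diagram.loops_id_left, pow_zero]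
  one_right α := by
    change δ ^ Diagram.loops α.1.rel (Diagram.idDiag (Fin n)) = 1
    rw [Diagram.loops_id_right, pow_zero]

/-- The complex Temperley–Lieb algebra. -/
abbrev TemperleyLieb (n : ℕ) (δ : ℂ) : Type := TwistedAlgebra (jonesTwisting n δ)

/-- The basis element of the Temperley–Lieb algebra belonging to a planar diagram. -/
noncomputable def tlBasis {n : ℕ} (δ : ℂ) (α : JonesMonoid n) : TemperleyLieb n δ :=
  TwistedAlgebra.of (jonesTwisting n δ) α

/-! Read along the boundary of the rectangle, a planar pairing is a nonnegative lattice path of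
length `2n` from height `0` back to height `0`: the height at a position is the number of blocks
that cross it (`height`, with inverse `ofHeight`). The height in the middle is the rank. The first
`n` steps depend only on the pairing induced on the upper row; the last `n`, read backwards, depend
only on the lower row. So a diagram is determined by its two halves (`ext_upRel_loRel`), and any two
half paths that end at the same height fit together (`exists_upPath_star_eq`). The halves of rank
`r` form `halfPaths n r`, counted by a ballot number (`ncard_halfPaths`); both quantities in the
theorem turn out to be this number.

The ideal. A product that has the rank of its left factor also has its upper half (`upRel_mul`), so
a generating set needs an element for every half path. Conversely the projections `β * star β` of
rank `r`, one for each half path, suffice. The reason is that the Jones monoid is generated by hooks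
(`hookMonoid_eq_top`) and that a hook lowers the rank by `0` or `2`. Elements of smaller rank
therefore factor through rank exactly `r` (`exists_factor_left`, `hook_mul_mem`, where `r ≤ n - 2`
enters), and inside rank `r` each hook can be traded for projections (`mul_mem_of_rank_eq`).

The modules. Diagrams with a fixed lower half of rank `r` span a cell module in which products of
smaller rank are zero. A diagram of rank `r` acts on it as an operator of rank at most one
(`tlBasis_smul_eq_pairing`), so the module is simple as soon as no nonzero vector is killed by all
of these diagrams. A semisimple ring is von Neumann regular, and this excludes such a vector
(`exists_tlBasis_smul_ne_zero`). A simple module receives a nonzero map from the cell module of the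
least rank that does not annihilate it, an isomorphism by Schur's lemma. That least rank separates
the modules, and the dimension counts upper halves. -/

namespace Diagram

/-! ### Pairings, and loops in stacked pairings -/

section Chains
variable {A B C X : Type*}

/-- A block of two elements already fills any block of two elements that contains it. Equality of
diagrams is from here on proved by a single inclusion. -/
theorem AllPairs.eq_of_le {r s : Setoid X} (hr : AllPairs r) (hs : AllPairs s) (h : r ≤ s) :
    r = s := by
  refine le_antisymm h fun x z hxz => ?_
  obtain ⟨y, hy, hyr⟩ := allPairs_iff.1 hr x
  obtain ⟨y', hy', hyr'⟩ := allPairs_iff.1 hs x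
  have hry : r x y := (hyr y).2 (Or.inr rfl)
  rcases (hyr' y).1 (h hry) with h1 | h1
  · exact absurd h1 hy
  · rcases (hyr' z).1 hxz with h2 | h2
    · rw [h2]
    · rw [h2, ← h1]; exact hry

theorem AllPairs.eq_of_rel {r : Setoid X} (hr : AllPairs r) {x y z : X} (hxy : r x y)
    (hxz : r x z) (hy : y ≠ x) (hz : z ≠ x) : y = z := by
  obtain ⟨w, -, hw⟩ := allPairs_iff.1 hr x
  have h1 := ((hw y).1 hxy).resolve_left hy
  have h2 := ((hw z).1 hxz).resolve_left hz
  rw [h1, h2]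

theorem AllPairs.exists_rel {r : Setoid X} (hr : AllPairs r) (x : X) : ∃ y, y ≠ x ∧ r x y := by
  obtain ⟨w, h, hw⟩ := allPairs_iff.1 hr x
  exact ⟨w, h, (hw w).2 (Or.inr rfl)⟩

variable {α : Setoid (A ⊕ B)} {β : Setoid (B ⊕ C)}

theorem stack_upper {x y : A ⊕ B} (h : α x y) : stack α β (upper x) (upper y) :=
  (le_sup_left : Setoid.map α upper ≤ _) (map_rel α upper h)

theorem stack_lower {x y : B ⊕ C} (h : β x y) : stack α β (lower x) (lower y) :=
  (le_sup_right : Setoid.map β lower ≤ _) (map_rel β lower h)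

theorem stack_le {s : Setoid (A ⊕ B ⊕ C)} (h1 : ∀ x y, α x y → s (upper x) (upper y))
    (h2 : ∀ x y, β x y → s (lower x) (lower y)) : stack α β ≤ s :=
  sup_le (map_le_iff.2 h1) (map_le_iff.2 h2)

theorem comp_inl_inl {i j : A} (h : α (Sum.inl i) (Sum.inl j)) :
    comp α β (Sum.inl i) (Sum.inl j) :=
  stack_upper h

theorem comp_inr_inr {i j : C} (h : β (Sum.inr i) (Sum.inr j)) :
    comp α β (Sum.inr i) (Sum.inr j) :=
  stack_lower h

theorem comp_inl_inr {i : A} {j : B} {k : C} (h : α (Sum.inl i) (Sum.inr j))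
    (h' : β (Sum.inl j) (Sum.inr k)) : comp α β (Sum.inl i) (Sum.inr k) :=
  (stack α β).trans' (stack_upper h) (stack_lower h')

/-- A component that never leaves the middle row uses only edges inside that row, and those are the
same in both stackings. So the component, as a set `K`, is also closed under the edges of the second
stacking. -/
theorem mid_class_transfer {α' : Setoid (A ⊕ B)} {β' : Setoid (B ⊕ C)}
    (hα : AllPairs α) (hα' : AllPairs α') (hβ : AllPairs β) (hβ' : AllPairs β')
    (h1 : ∀ i j, α (Sum.inr i) (Sum.inr j) ↔ α' (Sum.inr i) (Sum.inr j))
    (h2 : ∀ i j, β (Sum.inl i) (Sum.inl j) ↔ β' (Sum.inl i) (Sum.inl j)) (b : B)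
    (hb : ∀ x, stack α β (mid b) x → x ∈ Set.range mid) (x : A ⊕ B ⊕ C)
    (hx : stack α' β' (mid b) x) : x ∈ Set.range mid ∧ stack α β (mid b) x := by
  let K : Set (A ⊕ B ⊕ C) := {x | x ∈ Set.range mid ∧ stack α β (mid b) x}
  let s : Setoid (A ⊕ B ⊕ C) :=
    { r := fun x y => x ∈ K ↔ y ∈ K
      iseqv := ⟨fun _ => Iff.rfl, fun h => h.symm, fun h h' => h.trans h'⟩ }
  have hup : ∀ x y, α' x y → upper x ∈ K → upper y ∈ K := by
    rintro (a | i) y hxy ⟨⟨m, hm⟩, hs⟩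
    · simp [mid, upper] at hm
    · obtain ⟨z, hz, hiz⟩ := hα.exists_rel (Sum.inr i)
      rcases z with a | j
      · obtain ⟨m', hm'⟩ := hb _ ((stack α β).trans' hs (stack_upper hiz))
        simp [mid, upper] at hm'
      · have hj : upper (Sum.inr j) ∈ K :=
          ⟨⟨j, rfl⟩, (stack α β).trans' hs (stack_upper hiz)⟩
        by_cases hy : y = Sum.inr i
        · rw [hy]; exact ⟨⟨m, hm⟩, hs⟩
        · rw [hα'.eq_of_rel hxy ((h1 i j).1 hiz) hy hz]; exact hj
  have hlo : ∀ x y, β' x y → lower x ∈ K → lower y ∈ K := by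
    rintro (i | a) y hxy ⟨⟨m, hm⟩, hs⟩
    · obtain ⟨z, hz, hiz⟩ := hβ.exists_rel (Sum.inl i)
      rcases z with j | a
      · have hj : lower (Sum.inl j) ∈ K :=
          ⟨⟨j, rfl⟩, (stack α β).trans' hs (stack_lower hiz)⟩
        by_cases hy : y = Sum.inl i
        · rw [hy]; exact ⟨⟨m, hm⟩, hs⟩
        · rw [hβ'.eq_of_rel hxy ((h2 i j).1 hiz) hy hz]; exact hj
      · obtain ⟨m', hm'⟩ := hb _ ((stack α β).trans' hs (stack_lower hiz))
        simp [mid, lower] at hm'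
    · simp [mid, lower] at hm
  have hs : stack α' β' ≤ s := stack_le
    (fun x y h => ⟨hup x y h, hup y x (α'.symm' h)⟩)
    (fun x y h => ⟨hlo x y h, hlo y x (β'.symm' h)⟩)
  exact (hs hx).1 ⟨⟨b, rfl⟩, (stack α β).refl' _⟩

theorem mid_classes_subset {α' : Setoid (A ⊕ B)} {β' : Setoid (B ⊕ C)}
    (hα : AllPairs α) (hα' : AllPairs α') (hβ : AllPairs β) (hβ' : AllPairs β')
    (h1 : ∀ i j, α (Sum.inr i) (Sum.inr j) ↔ α' (Sum.inr i) (Sum.inr j))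
    (h2 : ∀ i j, β (Sum.inl i) (Sum.inl j) ↔ β' (Sum.inl i) (Sum.inl j)) :
    {c ∈ (stack α β).classes | c ⊆ Set.range mid}
      ⊆ {c ∈ (stack α' β').classes | c ⊆ Set.range mid} := by
  rintro c ⟨⟨x, rfl⟩, hc⟩
  obtain ⟨b, rfl⟩ := hc (show stack α β x x from (stack α β).refl' x)
  have hb : ∀ x, stack α β (mid b) x → x ∈ Set.range mid :=
    fun x hx => hc ((stack α β).symm' hx)
  have k1 := mid_class_transfer hα hα' hβ hβ' h1 h2 b hb
  -- The converse direction needs the component of the second stacking to stay in the middle row,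
  -- which `k1` has just shown.
  have k2 := mid_class_transfer hα' hα hβ' hβ (fun i j => (h1 i j).symm)
    (fun i j => (h2 i j).symm) b fun x hx => (k1 x hx).1
  refine ⟨⟨mid b, ?_⟩, hc⟩
  ext x
  exact ⟨fun h => (stack α' β').symm' (k2 x ((stack α β).symm' h)).2,
    fun h => (stack α β).symm' (k1 x ((stack α' β').symm' h)).2⟩

/-- The number of loops depends only on the two facing rows. -/
theorem loops_congr {α' : Setoid (A ⊕ B)} {β' : Setoid (B ⊕ C)}
    (hα : AllPairs α) (hα' : AllPairs α') (hβ : AllPairs β) (hβ' : AllPairs β')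
    (h1 : ∀ i j, α (Sum.inr i) (Sum.inr j) ↔ α' (Sum.inr i) (Sum.inr j))
    (h2 : ∀ i j, β (Sum.inl i) (Sum.inl j) ↔ β' (Sum.inl i) (Sum.inl j)) :
    loops α β = loops α' β' := by
  unfold loops classesIn
  rw [(mid_classes_subset hα hα' hβ hβ' h1 h2).antisymm
    (mid_classes_subset hα' hα hβ' hβ (fun i j => (h1 i j).symm) fun i j => (h2 i j).symm)]

end Chains

/-! ### Reflection in a horizontal line -/

section Flip
variable {A B C : Type*}

/-- Reflection of a diagram in a horizontal line. -/
def flip (α : Setoid (A ⊕ B)) : Setoid (B ⊕ A) := Setoid.comap Sum.swap α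

theorem allPairs_flip {α : Setoid (A ⊕ B)} (h : AllPairs α) : AllPairs (flip α) := by
  rw [allPairs_iff] at h ⊢
  intro x
  obtain ⟨y, hy, hyr⟩ := h x.swap
  refine ⟨y.swap, fun e => hy (by rw [← e, Sum.swap_swap]), fun z => ?_⟩
  change α x.swap z.swap ↔ _
  rw [hyr, Sum.swap_leftInverse.injective.eq_iff]
  refine or_congr Iff.rfl ⟨fun e => ?_, fun e => ?_⟩
  · rw [← e, Sum.swap_swap]
  · rw [e, Sum.swap_swap]

theorem circ_swap {n : ℕ} (x : Fin n ⊕ Fin n) : circ x.swap = 2 * n - 1 - circ x := by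
  rcases x with i | i <;> simp [circ]; omega

theorem circ_lt {n : ℕ} (x : Fin n ⊕ Fin n) : circ x < 2 * n := by
  rcases x with i | i <;> simp [circ] <;> omega

theorem planar_flip {n : ℕ} {α : Setoid (Fin n ⊕ Fin n)} (h : Planar α) : Planar (flip α) := by
  intro a b c d hab hbc hcd hac hbd
  have e := @circ_swap n
  have l := @circ_lt n
  -- Reflection reverses the order along the boundary, so the four points enter in reverse.
  have h1 := h d.swap c.swap b.swap a.swap
    (by rw [e, e]; have := l d; have := l c; omega)
    (by rw [e, e]; have := l c; have := l b; omega)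
    (by rw [e, e]; have := l a; have := l b; omega) (α.symm' hbd) (α.symm' hac)
  exact α.trans' hac (α.trans' (α.symm' h1) (α.symm' hbd))

theorem flip_swap {α : Setoid (A ⊕ B)} {x y : A ⊕ B} (h : α x y) : flip α x.swap y.swap := by
  change α x.swap.swap y.swap.swap
  rwa [Sum.swap_swap, Sum.swap_swap]

theorem flip_comp (α : Setoid (A ⊕ B)) (β : Setoid (B ⊕ C)) :
    flip (comp α β) = comp (flip β) (flip α) := by
  let φ : A ⊕ B ⊕ C → C ⊕ B ⊕ A :=
    Sum.elim (fun a => Sum.inr (Sum.inr a)) (Sum.elim (fun b => Sum.inr (Sum.inl b)) Sum.inl)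
  let ψ : C ⊕ B ⊕ A → A ⊕ B ⊕ C :=
    Sum.elim (fun a => Sum.inr (Sum.inr a)) (Sum.elim (fun b => Sum.inr (Sum.inl b)) Sum.inl)
  have hφ : stack α β ≤ Setoid.comap φ (stack (flip β) (flip α)) := by
    refine stack_le ?_ ?_
    · intro x y h
      have := stack_lower (α := flip β) (flip_swap h)
      rcases x with x | x <;> rcases y with y | y <;> exact this
    · intro x y h
      have := stack_upper (β := flip α) (flip_swap h)
      rcases x with x | x <;> rcases y with y | y <;> exact this
  have hψ : stack (flip β) (flip α) ≤ Setoid.comap ψ (stack α β) := by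
    refine stack_le ?_ ?_
    · intro x y h
      have := stack_lower (α := α) (show β x.swap y.swap from h)
      rcases x with x | x <;> rcases y with y | y <;> exact this
    · intro x y h
      have := stack_upper (β := β) (show α x.swap y.swap from h)
      rcases x with x | x <;> rcases y with y | y <;> exact this
  apply Setoid.ext
  rintro (x | x) (y | y) <;> exact ⟨fun h => hφ h, fun h => hψ h⟩

end Flip
end Diagram

/-! ### Halves of a diagram, rank and the involution -/

namespace Jones
open Diagram
variable {n : ℕ}

/-- The reflected diagram. -/
def star (α : JonesMonoid n) : JonesMonoid n :=
  ⟨⟨flip α.1.rel⟩, allPairs_flip α.2.1, planar_flip α.2.2⟩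

/-- The relation induced on the upper row. -/
def upRel (α : JonesMonoid n) : Setoid (Fin n) := Setoid.comap Sum.inl α.1.rel

/-- The relation induced on the lower row. -/
def loRel (α : JonesMonoid n) : Setoid (Fin n) := Setoid.comap Sum.inr α.1.rel

/-- The upper vertices that are joined to the lower row. -/
def through (α : JonesMonoid n) : Set (Fin n) := {i | ∃ j, α.1.rel (Sum.inl i) (Sum.inr j)}

theorem upRel_star (α : JonesMonoid n) : upRel (star α) = loRel α := rfl

theorem ext_rel {α β : JonesMonoid n} (h : α.1.rel = β.1.rel) : α = β :=
  Subtype.ext (PartitionMonoid.ext h)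

theorem eq_of_le {α β : JonesMonoid n} (h : α.1.rel ≤ β.1.rel) : α = β :=
  ext_rel (α.2.1.eq_of_le β.2.1 h)

theorem star_star (α : JonesMonoid n) : star (star α) = α := by
  refine ext_rel (Setoid.ext fun x y => ?_)
  change α.1.rel x.swap.swap y.swap.swap ↔ _
  rw [Sum.swap_swap, Sum.swap_swap]

theorem star_mul (α β : JonesMonoid n) : star (α * β) = star β * star α :=
  ext_rel (flip_comp α.1.rel β.1.rel)

/-- Since blocks have two elements, a vertex reaches the lower row exactly when it has no partner in
its own row. This makes `through`, and with it the rank, a function of `upRel` alone. -/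
theorem mem_through_iff (α : JonesMonoid n) (i : Fin n) :
    i ∈ through α ↔ ∀ j, upRel α i j → j = i := by
  constructor
  · rintro ⟨j, hj⟩ k hk
    by_contra h
    have := α.2.1.eq_of_rel hj hk (by simp) (by simpa using h)
    simp at this
  · intro h
    obtain ⟨y, hy, hr⟩ := α.2.1.exists_rel (Sum.inl i)
    rcases y with k | k
    · exact absurd (congrArg Sum.inl (h k hr)) hy
    · exact ⟨k, hr⟩

theorem rank_eq (α : JonesMonoid n) : α.1.rank = (through α).ncard := by
  unfold PartitionMonoid.rank
  symm
  refine Set.ncard_congr (fun i _ => {z | α.1.rel z (Sum.inl i)}) ?_ ?_ ?_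
  · rintro i ⟨j, hj⟩
    exact ⟨⟨_, rfl⟩, ⟨i, α.1.rel.refl' _⟩, j, α.1.rel.symm' hj⟩
  · rintro i i' hi - h
    have : Sum.inl i ∈ {z | α.1.rel z (Sum.inl i')} := by
      rw [← h]; exact α.1.rel.refl' _
    exact ((mem_through_iff α i).1 hi i' this).symm
  · rintro c ⟨⟨x, rfl⟩, ⟨i, hi⟩, j, hj⟩
    refine ⟨i, ⟨j, α.1.rel.trans' hi (α.1.rel.symm' hj)⟩, ?_⟩
    ext z
    exact ⟨fun h => α.1.rel.trans' h hi, fun h => α.1.rel.trans' h (α.1.rel.symm' hi)⟩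

theorem rank_congr {α β : JonesMonoid n} (h : upRel α = upRel β) : α.1.rank = β.1.rank := by
  rw [rank_eq, rank_eq]
  congr 1
  ext i
  rw [mem_through_iff, mem_through_iff, h]

theorem rank_star (α : JonesMonoid n) : (star α).1.rank = α.1.rank := by
  classical
  rw [rank_eq, rank_eq]
  have hex : ∀ i, i ∈ through (star α) → ∃ j, α.1.rel (Sum.inr i) (Sum.inl j) := fun i h => h
  refine Set.ncard_congr (fun i hi => (hex i hi).choose) ?_ ?_ ?_
  · intro i hi
    exact ⟨i, α.1.rel.symm' (hex i hi).choose_spec⟩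
  · intro i i' hi hi' h
    have h1 := (hex i hi).choose_spec
    have h2 := (hex i' hi').choose_spec
    rw [show (hex i' hi').choose = (hex i hi).choose from h.symm] at h2
    have := α.2.1.eq_of_rel (α.1.rel.symm' h1) (α.1.rel.symm' h2) (by simp) (by simp)
    simpa using this
  · rintro j ⟨i, hi⟩
    have hi' : i ∈ through (star α) := ⟨j, α.1.rel.symm' hi⟩
    refine ⟨i, hi', ?_⟩
    have := α.2.1.eq_of_rel (hex i hi').choose_spec (α.1.rel.symm' hi) (by simp) (by simp)
    simpa using this

theorem rank_congr_lo {α β : JonesMonoid n} (h : loRel α = loRel β) : α.1.rank = β.1.rank := by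
  rw [← rank_star α, ← rank_star β]
  exact rank_congr h

theorem upRel_le_mul (α β : JonesMonoid n) : upRel α ≤ upRel (α * β) :=
  fun _ _ h => comp_inl_inl h

theorem loRel_le_mul (α β : JonesMonoid n) : loRel β ≤ loRel (α * β) :=
  fun _ _ h => comp_inr_inr h

theorem through_mul_subset (α β : JonesMonoid n) : through (α * β) ⊆ through α := by
  intro i hi
  rw [mem_through_iff] at hi ⊢
  exact fun j hj => hi j (upRel_le_mul α β hj)

theorem rank_mul_le_left (α β : JonesMonoid n) : (α * β).1.rank ≤ α.1.rank := by
  rw [rank_eq, rank_eq]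
  exact Set.ncard_le_ncard (through_mul_subset α β)

theorem rank_mul_le_right (α β : JonesMonoid n) : (α * β).1.rank ≤ β.1.rank := by
  rw [← rank_star, star_mul, ← rank_star β]
  exact rank_mul_le_left _ _

/-- Upper arcs of `α` survive in the product, and a new one would use up vertices of `through α`.
Equal rank means that none of these is lost. -/
theorem upRel_mul {α β : JonesMonoid n} (h : (α * β).1.rank = α.1.rank) :
    upRel (α * β) = upRel α := by
  refine le_antisymm (fun i j hij => ?_) (upRel_le_mul α β)
  have ht : through (α * β) = through α := by
    refine Set.eq_of_subset_of_ncard_le (through_mul_subset α β) ?_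
    rw [← rank_eq, ← rank_eq, h]
  by_cases hj : j = i
  · rw [hj]
  · have hi : i ∉ through α := by
      rw [← ht, mem_through_iff]
      exact fun h => hj (h j hij)
    rw [mem_through_iff] at hi
    push Not at hi
    obtain ⟨k, hk, hki⟩ := hi
    have := (α * β).2.1.eq_of_rel hij (upRel_le_mul α β hk) (by simpa using hj)
      (by simpa using hki)
    rw [Sum.inl_injective this]
    exact hk

theorem loRel_mul {α β : JonesMonoid n} (h : (α * β).1.rank = β.1.rank) :
    loRel (α * β) = loRel β := by
  rw [← upRel_star, star_mul, ← upRel_star]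
  exact upRel_mul (by rw [← star_mul, rank_star, rank_star, h])

/-- The strands of `β` and of `α` end at the same lower vertices, so each strand of `β` runs back
through `star α` and returns through `α` to its old end. With `β = α` this makes the Jones monoid a
regular `*`-semigroup. -/
theorem mul_star_mul {α β : JonesMonoid n} (h : loRel β = loRel α) :
    β * star α * α = β := by
  symm
  refine eq_of_le fun x y hxy => ?_
  have key : ∀ i j, β.1.rel (Sum.inl i) (Sum.inr j) →
      (β * star α * α).1.rel (Sum.inl i) (Sum.inr j) := by
    intro i j hij
    have hj : j ∈ through (star α) := by
      rw [mem_through_iff, upRel_star, ← h, ← upRel_star, ← mem_through_iff]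
      exact ⟨i, β.1.rel.symm' hij⟩
    obtain ⟨k, hk⟩ := hj
    exact comp_inl_inr (α := (β * star α).1.rel)
      (comp_inl_inr (β := (star α).1.rel) hij hk) (α.1.rel.symm' hk)
  rcases x with i | i <;> rcases y with j | j
  · exact upRel_le_mul _ _ (upRel_le_mul _ _ hxy)
  · exact key i j hxy
  · exact Setoid.symm' _ (key j i (β.1.rel.symm' hxy))
  · refine loRel_le_mul _ _ ?_
    rw [← h]; exact hxy

theorem star_mul_mul {α β : JonesMonoid n} (h : upRel β = upRel α) :
    α * (star α * β) = β := by
  have := congrArg star (mul_star_mul (α := star α) (β := star β) h)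
  simpa only [star_mul, star_star] using this

theorem mul_star_self_mul (α : JonesMonoid n) : α * star α * α = α := mul_star_mul rfl

theorem rank_mul_star_self (α : JonesMonoid n) : (α * star α).1.rank = α.1.rank := by
  refine le_antisymm (rank_mul_le_left _ _) ?_
  conv_lhs => rw [← mul_star_self_mul α]
  exact rank_mul_le_left _ _

theorem rank_one : (1 : JonesMonoid n).1.rank = n := by
  rw [rank_eq]
  have : through (1 : JonesMonoid n) = Set.univ :=
    Set.eq_univ_of_forall fun i => ⟨i, rfl⟩
  rw [this, Set.ncard_univ, Nat.card_eq_fintype_card, Fintype.card_fin]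

end Jones

namespace Diagram

/-! ### Planar pairings as lattice paths -/

section Height

/-- The height of the lower end of the step from `i` to `i + 1`. -/
def level (h : ℕ → ℕ) (i : ℕ) : ℕ := min (h i) (h (i + 1))

/-- Two steps of a path are related if they have the same level and the path stays strictly
above that level between them. -/
def arcs (h : ℕ → ℕ) : Setoid ℕ where
  r a b := level h a = level h b ∧ ∀ z, (a < z ∧ z ≤ b ∨ b < z ∧ z ≤ a) → level h a < h z
  iseqv :=
    { refl := fun a => ⟨rfl, fun z hz => by omega⟩
      symm := fun h => ⟨h.1.symm, fun z hz => h.1 ▸ h.2 z (by omega)⟩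
      trans := by
        rintro a b c ⟨h1, h2⟩ ⟨h3, h4⟩
        refine ⟨h1.trans h3, fun z hz => ?_⟩
        by_cases hb : a < z ∧ z ≤ b ∨ b < z ∧ z ≤ a
        · exact h2 z hb
        · rw [h1]
          exact h4 z (by omega) }

/-- Steps of size one. -/
def UnitSteps (N : ℕ) (h : ℕ → ℕ) : Prop := ∀ i < N, h (i + 1) = h i + 1 ∨ h i = h (i + 1) + 1

/-- Related to a step on its left, `b` has its starting height above the common level; related to a
step on its right, it has its final height above it. But the level of `b` is one of these two
heights. -/
theorem arcs_not_three {h : ℕ → ℕ} {a b c : ℕ} (hab : a < b) (hbc : b < c) (h1 : arcs h a b)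
    (h2 : arcs h b c) : False := by
  have e1 := h1.2 b (by omega)
  have e2 := h2.2 (b + 1) (by omega)
  have e3 := h1.1
  have : level h b = h b ∨ level h b = h (b + 1) := by
    unfold level; omega
  omega

theorem arcs_unique {h : ℕ → ℕ} {a b c : ℕ} (hab : arcs h a b) (hac : arcs h a c) (hb : b ≠ a)
    (hc : c ≠ a) : b = c := by
  by_contra hbc
  have hba := (arcs h).symm' hab
  have hca := (arcs h).symm' hac
  have h1 := (arcs h).trans' hba hac
  have h2 := (arcs h).symm' h1
  rcases Nat.lt_or_gt_of_ne hb with h3 | h3 <;> rcases Nat.lt_or_gt_of_ne hc with h4 | h4 <;>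
    rcases Nat.lt_or_gt_of_ne hbc with h5 | h5
  · exact arcs_not_three h5 h4 h1 hca
  · exact arcs_not_three h5 h3 h2 hba
  · exact arcs_not_three h3 h4 hba hac
  · omega
  · omega
  · exact arcs_not_three h4 h3 hca hab
  · exact arcs_not_three h3 h5 hab h1
  · exact arcs_not_three h4 h5 hac h2

/-- The partner of an up-step is the step by which the path first returns to the height `h a`; the
path ends at `0`, so it does return. -/
theorem arcs_exists_gt {h : ℕ → ℕ} {N a : ℕ} (hs : UnitSteps N h) (hN : h N = 0) (ha : a < N)
    (hu : h (a + 1) = h a + 1) : ∃ b, a < b ∧ b < N ∧ arcs h a b := by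
  classical
  have hex : ∃ z, a < z ∧ z ≤ N ∧ h z ≤ h a := ⟨N, ha, le_rfl, by omega⟩
  obtain ⟨h1, h2, h3⟩ := Nat.find_spec hex
  have hmin := fun m (hm : m < Nat.find hex) => Nat.find_min hex hm
  generalize Nat.find hex = z at *
  obtain ⟨b, rfl⟩ : ∃ b, z = b + 1 := ⟨z - 1, by omega⟩
  have hab : a < b := by
    rcases Nat.lt_or_ge a b with h4 | h4
    · exact h4
    · have : a = b := by omega
      subst this; omega
  have hb := hmin b (by omega)
  have hbs := hs b (by omega)
  have hlb : level h b = h a := by unfold level; omega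
  have hla : level h a = h a := by unfold level; omega
  refine ⟨b, hab, by omega, hla.trans hlb.symm, fun z hz => ?_⟩
  have := hmin z (by omega)
  omega

/-- Dually, the partner of a down-step leaves the last position before it with height at most `h (a
+ 1)`. -/
theorem arcs_exists_lt {h : ℕ → ℕ} {N a : ℕ} (hs : UnitSteps N h) (h0 : h 0 = 0) (ha : a < N)
    (hd : h a = h (a + 1) + 1) : ∃ b, b < a ∧ arcs h a b := by
  classical
  have h1 : h (Nat.findGreatest (fun z => h z ≤ h (a + 1)) a) ≤ h (a + 1) :=
    Nat.findGreatest_spec (P := fun z => h z ≤ h (a + 1)) (Nat.zero_le a) (by omega)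
  have h2 : ∀ z, Nat.findGreatest (fun z => h z ≤ h (a + 1)) a < z → z ≤ a →
      ¬ h z ≤ h (a + 1) := fun z hz hz' =>
    Nat.findGreatest_is_greatest (P := fun z => h z ≤ h (a + 1)) hz hz'
  have h3 := Nat.findGreatest_le (P := fun z => h z ≤ h (a + 1)) a
  generalize Nat.findGreatest (fun z => h z ≤ h (a + 1)) a = b at *
  have hba : b < a := by
    rcases Nat.lt_or_ge b a with h4 | h4
    · exact h4
    · have : a = b := by omega
      subst this; omega
  have hb := h2 (b + 1) (by omega) (by omega)
  have hbs := hs b (by omega)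
  have hlb : level h b = h (a + 1) := by unfold level; omega
  have hla : level h a = h (a + 1) := by unfold level; omega
  refine ⟨b, hba, hla.trans hlb.symm, fun z hz => ?_⟩
  have := h2 z (by omega) (by omega)
  omega

variable {n : ℕ}

theorem exists_circ_eq {i : ℕ} (hi : i < 2 * n) : ∃ x : Fin n ⊕ Fin n, circ x = i := by
  rcases Nat.lt_or_ge i n with h | h
  · exact ⟨Sum.inl ⟨i, h⟩, rfl⟩
  · refine ⟨Sum.inr ⟨2 * n - 1 - i, by omega⟩, ?_⟩
    simp only [circ, Sum.elim_inr]
    omega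

/-- The diagram belonging to a path. -/
def ofHeight (n : ℕ) (h : ℕ → ℕ) : Setoid (Fin n ⊕ Fin n) := Setoid.comap circ (arcs h)

theorem allPairs_ofHeight {h : ℕ → ℕ} (hs : UnitSteps (2 * n) h) (h0 : h 0 = 0)
    (hN : h (2 * n) = 0) : AllPairs (ofHeight n h) := by
  rw [allPairs_iff]
  intro x
  have hx := circ_lt x
  have : ∃ b, b ≠ circ x ∧ b < 2 * n ∧ arcs h (circ x) b := by
    rcases hs _ hx with hu | hd
    · obtain ⟨b, h1, h2, h3⟩ := arcs_exists_gt hs hN hx hu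
      exact ⟨b, by omega, h2, h3⟩
    · obtain ⟨b, h1, h2⟩ := arcs_exists_lt hs h0 hx hd
      exact ⟨b, by omega, by omega, h2⟩
  obtain ⟨b, h1, h2, h3⟩ := this
  obtain ⟨y, rfl⟩ := exists_circ_eq h2
  refine ⟨y, fun e => h1 (e ▸ rfl), fun z => ⟨fun hz => ?_, ?_⟩⟩
  · by_cases hzx : z = x
    · exact Or.inl hzx
    · exact Or.inr (circ_injective
        (arcs_unique hz h3 (fun e => hzx (circ_injective e)) h1))
  · rintro (rfl | rfl)
    · exact Setoid.refl' _ _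
    · exact h3

/-- Interleaving would put the level of `b` above that of `a`, and the level of `c` above that of
`b`, although `a` and `c` have the same level. -/
theorem planar_ofHeight (h : ℕ → ℕ) : Planar (ofHeight n h) := by
  intro a b c d hab hbc hcd hac hbd
  exfalso
  have e1 := hac.1
  have e2 := hbd.1
  have l1 : level h (circ c) = h (circ c) ∨ level h (circ c) = h (circ c + 1) := by
    unfold level; omega
  have l2 : level h (circ b) = h (circ b) ∨ level h (circ b) = h (circ b + 1) := by
    unfold level; omega
  have a1 := hac.2 (circ b) (by omega)
  have a2 := hac.2 (circ b + 1) (by omega)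
  have b1 := hbd.2 (circ c) (by omega)
  have b2 := hbd.2 (circ c + 1) (by omega)
  omega

/-- The number of blocks of a diagram that cross a given position of the boundary. -/
noncomputable def height (α : Setoid (Fin n ⊕ Fin n)) (i : ℕ) : ℕ :=
  {x | circ x < i ∧ ∃ y, i ≤ circ y ∧ α x y}.ncard

theorem height_zero (α : Setoid (Fin n ⊕ Fin n)) : height α 0 = 0 := by
  refine (Set.ncard_eq_zero (Set.toFinite _)).2 (Set.eq_empty_iff_forall_notMem.2 ?_)
  rintro x ⟨h, -⟩
  omega

theorem height_last (α : Setoid (Fin n ⊕ Fin n)) : height α (2 * n) = 0 := by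
  refine (Set.ncard_eq_zero (Set.toFinite _)).2 (Set.eq_empty_iff_forall_notMem.2 ?_)
  rintro x ⟨-, y, hy, -⟩
  have := circ_lt y
  omega

/-- Passing the earlier end of a block opens it: the set of earlier ends of crossing blocks gains
exactly `x`. -/
theorem height_succ_of_lt {α : Setoid (Fin n ⊕ Fin n)} (hα : AllPairs α) {x y : Fin n ⊕ Fin n}
    (h : circ x < circ y) (hxy : α x y) :
    height α (circ x + 1) = height α (circ x) + 1 := by
  unfold height
  have hxn : x ∉ {z | circ z < circ x ∧ ∃ y, circ x ≤ circ y ∧ α z y} := fun hx => by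
    simp at hx
  rw [← Set.ncard_insert_of_notMem hxn]
  congr 1
  ext z
  simp only [Set.mem_ofPred_eq, Set.mem_insert_iff]
  constructor
  · rintro ⟨h1, w, h2, h3⟩
    by_cases hz : z = x
    · exact Or.inl hz
    · have : circ z ≠ circ x := fun e => hz (circ_injective e)
      exact Or.inr ⟨by omega, w, by omega, h3⟩
  · rintro (rfl | ⟨h1, w, h2, h3⟩)
    · exact ⟨by omega, y, h, hxy⟩
    · refine ⟨by omega, w, ?_, h3⟩
      rcases Nat.lt_or_ge (circ x) (circ w) with h4 | h4
      · exact h4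
      · have hw : w = x := circ_injective (by omega)
        subst hw
        have := hα.eq_of_rel hxy (α.symm' h3) (fun e => by subst e; omega)
          (fun e => by subst e; omega)
        subst this; omega

/-- Passing the later end closes the block: the set loses exactly its earlier end `y`. -/
theorem height_succ_of_gt {α : Setoid (Fin n ⊕ Fin n)} (hα : AllPairs α) {x y : Fin n ⊕ Fin n}
    (h : circ y < circ x) (hxy : α x y) :
    height α (circ x) = height α (circ x + 1) + 1 := by
  unfold height
  have hyn : y ∉ {z | circ z < circ x + 1 ∧ ∃ y, circ x + 1 ≤ circ y ∧ α z y} := by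
    rintro ⟨-, w, h1, h2⟩
    have := hα.eq_of_rel (α.symm' hxy) h2 (fun e => by subst e; omega)
      (fun e => by subst e; omega)
    subst this; omega
  rw [← Set.ncard_insert_of_notMem hyn]
  congr 1
  ext z
  simp only [Set.mem_ofPred_eq, Set.mem_insert_iff]
  constructor
  · rintro ⟨h1, w, h2, h3⟩
    by_cases hw : w = x
    · subst hw
      exact Or.inl (hα.eq_of_rel (α.symm' h3) hxy (fun e => by subst e; omega)
        (fun e => by subst e; omega))
    · have : circ w ≠ circ x := fun e => hw (circ_injective e)
      exact Or.inr ⟨by omega, w, by omega, h3⟩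
  · rintro (rfl | ⟨h1, w, h2, h3⟩)
    · exact ⟨h, x, le_rfl, α.symm' hxy⟩
    · refine ⟨?_, w, by omega, h3⟩
      by_contra h4
      have hz : z = x := circ_injective (by omega)
      subst hz
      have := hα.eq_of_rel hxy h3 (fun e => by subst e; omega) (fun e => by subst e; omega)
      subst this; omega

theorem unitSteps_height {α : Setoid (Fin n ⊕ Fin n)} (hα : AllPairs α) :
    UnitSteps (2 * n) (height α) := by
  intro i hi
  obtain ⟨x, rfl⟩ := exists_circ_eq hi
  obtain ⟨y, hy, hxy⟩ := hα.exists_rel x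
  rcases Nat.lt_or_gt_of_ne (fun e => hy (circ_injective e) : circ y ≠ circ x) with h | h
  · exact Or.inr (height_succ_of_gt hα h hxy)
  · exact Or.inl (height_succ_of_lt hα h hxy)

/-- Both paths start at `0` and take the same steps, because up-steps are matched to the right and
down-steps to the left. With `ofHeight_height` this identifies planar pairings with paths. -/
theorem height_ofHeight {h : ℕ → ℕ} (hs : UnitSteps (2 * n) h) (h0 : h 0 = 0)
    (hN : h (2 * n) = 0) {i : ℕ} (hi : i ≤ 2 * n) : height (ofHeight n h) i = h i := by
  have hp := allPairs_ofHeight hs h0 hN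
  induction i with
  | zero => rw [height_zero, h0]
  | succ i ih =>
    have ih := ih (by omega)
    obtain ⟨x, hx⟩ := exists_circ_eq (n := n) (i := i) (by omega)
    rcases hs i (by omega) with hu | hd
    · obtain ⟨b, h1, h2, h3⟩ := arcs_exists_gt hs hN (by omega) hu
      obtain ⟨y, rfl⟩ := exists_circ_eq h2
      subst hx
      rw [height_succ_of_lt hp h1 h3, ih, hu]
    · obtain ⟨b, h1, h2⟩ := arcs_exists_lt hs h0 (by omega) hd
      obtain ⟨y, rfl⟩ := exists_circ_eq (n := n) (i := b) (by omega)
      subst hx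
      have := height_succ_of_gt hp h1 h2
      omega

/-- For a block with ends `x` before `y`, planarity keeps every block open at `x` open past `y`, and
closes every block opened in between. So the path stays strictly above its height at `x` until it
has passed `y`, where it is back at that height: `x` and `y` are matched steps. -/
theorem ofHeight_height {α : Setoid (Fin n ⊕ Fin n)} (hα : AllPairs α) (pα : Planar α) :
    ofHeight n (height α) = α := by
  symm
  refine hα.eq_of_le (allPairs_ofHeight (unitSteps_height hα) (height_zero α) (height_last α)) ?_
  intro x y hxy
  wlog hlt : circ x < circ y generalizing x y
  · rcases Nat.lt_or_ge (circ y) (circ x) with h | h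
    · exact Setoid.symm' _ (this (α.symm' hxy) h)
    · rw [circ_injective (le_antisymm h (not_lt.1 hlt))]
  have hx1 := height_succ_of_lt hα hlt hxy
  have hy1 := height_succ_of_gt hα hlt (α.symm' hxy)
  -- blocks that cross before `x` also cross at every point up to `y + 1`
  have key : ∀ u v, circ u < circ x → circ x ≤ circ v → α u v → circ y < circ v := by
    intro u v h1 h2 huv
    have hvx : v ≠ x := by
      rintro rfl
      have := hα.eq_of_rel hxy (α.symm' huv) (fun e => by subst e; omega)
        (fun e => by subst e; omega)
      subst this; omega
    have hvx' : circ v ≠ circ x := fun e => hvx (circ_injective e)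
    have hvy : v ≠ y := by
      rintro rfl
      have := hα.eq_of_rel (α.symm' hxy) (α.symm' huv) (fun e => by subst e; omega)
        (fun e => by subst e; omega)
      subst this; omega
    have hvy' : circ v ≠ circ y := fun e => hvy (circ_injective e)
    by_contra h3
    have h4 := pα u x v y h1 (by omega) (by omega) huv hxy
    have := hα.eq_of_rel (α.symm' h4) hxy (fun e => by subst e; omega)
        (fun e => by subst e; omega)
    subst this; omega
  -- The set counted at `x` is contained in the one counted at `z`, and `x` itself is an additional
  -- element.
  have hmono : ∀ z, circ x < z → z ≤ circ y → height α (circ x) < height α z := by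
    intro z h1 h2
    refine Set.ncard_lt_ncard (Set.ssubset_iff_of_subset ?_ |>.2 ⟨x, ⟨h1, y, h2, hxy⟩, ?_⟩)
    · rintro u ⟨h3, v, h4, h5⟩
      have := key u v h3 h4 h5
      exact ⟨by omega, v, by omega, h5⟩
    · simp
  have hend : height α (circ y + 1) = height α (circ x) := by
    unfold height
    congr 1
    ext u
    constructor
    · rintro ⟨h3, v, h4, h5⟩
      have hux : u ≠ x := by
        rintro rfl
        have := hα.eq_of_rel hxy h5 (fun e => by subst e; omega) (fun e => by subst e; omega)
        subst this; omega
      have hux' : circ u ≠ circ x := fun e => hux (circ_injective e)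
      have huy : u ≠ y := by
        rintro rfl
        have := hα.eq_of_rel (α.symm' hxy) h5 (fun e => by subst e; omega)
          (fun e => by subst e; omega)
        subst this; omega
      have huy' : circ u ≠ circ y := fun e => huy (circ_injective e)
      refine ⟨?_, v, by omega, h5⟩
      by_contra h6
      have h7 := pα x u y v (by omega) (by omega) (by omega) hxy h5
      have := hα.eq_of_rel hxy h7 (fun e => by subst e; omega) (fun e => by subst e; omega)
      subst this; omega
    · rintro ⟨h3, v, h4, h5⟩
      have := key u v h3 h4 h5
      exact ⟨by omega, v, by omega, h5⟩
  have hlx : level (height α) (circ x) = height α (circ x) := by unfold level; omega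
  have hly : level (height α) (circ y) = height α (circ x) := by unfold level; omega
  refine ⟨hlx.trans hly.symm, fun z hz => ?_⟩
  rw [hlx]
  exact hmono z (by omega) (by omega)

theorem height_flip {α : Setoid (Fin n ⊕ Fin n)} (hα : AllPairs α) {i : ℕ} (hi : i ≤ 2 * n) :
    height (flip α) i = height α (2 * n - i) := by
  obtain ⟨p, hp, hp', hpr⟩ := hα.exists_partner
  have hrel : ∀ x y, α x y → circ x ≠ circ y → y = p x := by
    intro x y h hne
    rcases (hpr x y).1 h with h | h
    · exact absurd (congrArg circ h.symm) hne
    · exact h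
  unfold height
  -- Heights count the earlier ends of blocks; reflection turns earlier ends into later ones, hence
  -- the passage to the partner.
  refine Set.ncard_congr (fun x _ => p x.swap) ?_ ?_ ?_
  · rintro x ⟨h1, y, h2, h3⟩
    have e1 := circ_swap x
    have e2 := circ_swap y
    have l1 := circ_lt x
    have l2 := circ_lt y
    change α x.swap y.swap at h3
    rw [← hrel _ _ h3 (by omega)]
    exact ⟨by omega, x.swap, by omega, α.symm' h3⟩
  · intro x y _ _ h
    exact Sum.swap_leftInverse.injective (hp.injective h)
  · rintro x ⟨h1, y, h2, h3⟩
    have e1 := circ_swap x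
    have e2 := circ_swap y
    have l1 := circ_lt x
    have l2 := circ_lt y
    refine ⟨y.swap, ⟨by omega, x.swap, by omega, ?_⟩, ?_⟩
    · change α y.swap.swap x.swap.swap
      rw [Sum.swap_swap, Sum.swap_swap]
      exact α.symm' h3
    · rw [Sum.swap_swap]
      exact (hrel _ _ (α.symm' h3) (by omega)).symm

end Height
end Diagram

/-! ### The two halves of a diagram as the two halves of its path -/

namespace Jones
open Diagram
variable {n : ℕ}

/-- For `i ≤ n` a block is open at `i` exactly when its end among the first `i` upper vertices has
no partner among them. Thus the first half of the path sees only the upper row. -/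
theorem height_eq_of_upRel (α : JonesMonoid n) {i : ℕ} (hi : i ≤ n) :
    height α.1.rel i =
      {x : Fin n | (x : ℕ) < i ∧ ∀ j : Fin n, (j : ℕ) < i → upRel α x j → j = x}.ncard := by
  unfold height
  symm
  refine Set.ncard_congr (fun x _ => Sum.inl x) ?_ ?_ ?_
  · rintro x ⟨h1, h2⟩
    refine ⟨h1, ?_⟩
    obtain ⟨y, hy, hr⟩ := α.2.1.exists_rel (Sum.inl x)
    refine ⟨y, ?_, hr⟩
    rcases y with j | j
    · by_contra h
      exact hy (congrArg _ (h2 j (not_le.1 h) hr))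
    · simp only [circ, Sum.elim_inr]; omega
  · intro x y _ _ h
    exact Sum.inl_injective h
  · rintro (x | x) ⟨h1, y, h2, h3⟩
    · refine ⟨x, ⟨h1, fun j hj hr => ?_⟩, rfl⟩
      by_contra hjx
      have := α.2.1.eq_of_rel h3 hr
        (by rintro rfl; omega) (by simpa using hjx)
      subst this
      simp only [circ, Sum.elim_inl] at h2
      omega
    · simp only [circ, Sum.elim_inr] at h1; omega

theorem height_congr {α β : JonesMonoid n} (h : upRel α = upRel β) {i : ℕ} (hi : i ≤ n) :
    height α.1.rel i = height β.1.rel i := by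
  rw [height_eq_of_upRel α hi, height_eq_of_upRel β hi, h]

theorem height_star (α : JonesMonoid n) {i : ℕ} (hi : i ≤ 2 * n) :
    height (star α).1.rel i = height α.1.rel (2 * n - i) :=
  height_flip α.2.1 hi

theorem height_mid (α : JonesMonoid n) : height α.1.rel n = α.1.rank := by
  rw [height_eq_of_upRel α le_rfl, rank_eq]
  congr 1
  ext x
  rw [mem_through_iff]
  simp

theorem ext_height {α β : JonesMonoid n}
    (h : ∀ i ≤ 2 * n, height α.1.rel i = height β.1.rel i) : α = β := by
  refine eq_of_le fun x y hxy => ?_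
  rw [← ofHeight_height α.2.1 α.2.2] at hxy
  rw [← ofHeight_height β.2.1 β.2.2]
  have l1 := circ_lt x
  have l2 := circ_lt y
  obtain ⟨h1, h2⟩ := hxy
  have e : ∀ i < 2 * n, level (height α.1.rel) i = level (height β.1.rel) i := by
    intro i hi
    unfold level
    rw [h i (by omega), h (i + 1) (by omega)]
  refine ⟨by rw [← e _ l1, ← e _ l2, h1], fun z hz => ?_⟩
  rw [← e _ l1, ← h z (by omega)]
  exact h2 z hz

/-- A planar pairing is determined by the relations it induces on the two rows. -/
theorem ext_upRel_loRel {α β : JonesMonoid n} (h1 : upRel α = upRel β)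
    (h2 : loRel α = loRel β) : α = β := by
  refine ext_height fun i hi => ?_
  rcases Nat.lt_or_ge n i with h | h
  · have e : 2 * n - (2 * n - i) = i := by omega
    have := height_congr (α := star α) (β := star β) h2 (i := 2 * n - i) (by omega)
    rwa [height_star _ (by omega), height_star _ (by omega), e] at this
  · exact height_congr h1 h

/-- Whether two upper vertices are matched is read off from heights at positions at most `n`. -/
theorem upRel_eq_of_height {α β : JonesMonoid n}
    (h : ∀ i ≤ n, height α.1.rel i = height β.1.rel i) : upRel α = upRel β := by
  have key : ∀ {α β : JonesMonoid n}, (∀ i ≤ n, height α.1.rel i = height β.1.rel i) →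
      upRel α ≤ upRel β := by
    intro α β h x y hxy
    have hxy' : ofHeight n (height α.1.rel) (Sum.inl x) (Sum.inl y) := by
      rw [ofHeight_height α.2.1 α.2.2]; exact hxy
    have goal : ofHeight n (height β.1.rel) (Sum.inl x) (Sum.inl y) := by
      obtain ⟨h1, h2⟩ := hxy'
      have l1 : circ (Sum.inl x : Fin n ⊕ Fin n) < n := x.2
      have l2 : circ (Sum.inl y : Fin n ⊕ Fin n) < n := y.2
      have e : ∀ i < n, level (height α.1.rel) i = level (height β.1.rel) i := by
        intro i hi
        unfold level
        rw [h i (by omega), h (i + 1) (by omega)]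
      refine ⟨by rw [← e _ l1, ← e _ l2, h1], fun z hz => ?_⟩
      rw [← e _ l1, ← h z (by omega)]
      exact h2 z hz
    rw [ofHeight_height β.2.1 β.2.2] at goal
    exact goal
  exact le_antisymm (key h) (key fun i hi => (h i hi).symm)

end Jones

/-! ### Ballot paths and their number -/

namespace Diagram

/-- Nonnegative paths with `n` steps of size one from height `0` to height `r`; as functions
they are continued by zero. -/
def halfPaths (n r : ℕ) : Set (ℕ → ℕ) :=
  {h | h 0 = 0 ∧ UnitSteps n h ∧ h n = r ∧ ∀ i, n < i → h i = 0}

theorem halfPaths_zero (r : ℕ) : halfPaths 0 r = if r = 0 then {0} else ∅ := by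
  ext h
  split_ifs with hr
  · subst hr
    constructor
    · rintro ⟨h0, -, -, h1⟩
      funext i
      rcases Nat.eq_zero_or_pos i with rfl | hi
      · exact h0
      · exact h1 i hi
    · rintro rfl
      exact ⟨rfl, fun i hi => by omega, rfl, fun _ _ => rfl⟩
  · constructor
    · rintro ⟨h0, -, h1, -⟩
      exact hr (h1.symm.trans h0)
    · rintro ⟨⟩

/-- Classification by the last step. The form `s + 1 = r` leaves the second set empty for `r = 0`,
with no truncated subtraction. -/
theorem halfPaths_succ (n r : ℕ) : halfPaths (n + 1) r =
    (fun h => Function.update h (n + 1) r) ''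
      (halfPaths n (r + 1) ∪ {h | ∃ s, s + 1 = r ∧ h ∈ halfPaths n s}) := by
  ext h
  constructor
  · rintro ⟨h0, hs, hr, hz⟩
    have e : ∀ i ≤ n, Function.update h (n + 1) 0 i = h i := fun i hi =>
      Function.update_of_ne (by omega) _ _
    have hz' : ∀ i, n < i → Function.update h (n + 1) 0 i = 0 := by
      intro i hi
      by_cases hin : i = n + 1
      · rw [hin, Function.update_self]
      · rw [Function.update_of_ne hin]; exact hz i (by omega)
    have hs' : UnitSteps n (Function.update h (n + 1) 0) := by
      intro i hi
      rw [e _ hi, e _ hi.le]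
      exact hs i (by omega)
    refine ⟨Function.update h (n + 1) 0, ?_, ?_⟩
    · rcases hs n (by omega) with h1 | h1
      · exact Or.inr ⟨h n, by omega, by rw [e 0 (by omega), h0], hs', e n le_rfl, hz'⟩
      · exact Or.inl ⟨by rw [e 0 (by omega), h0], hs', by rw [e n le_rfl]; omega, hz'⟩
    · change Function.update (Function.update h (n + 1) 0) (n + 1) r = h
      rw [Function.update_idem, ← hr, Function.update_eq_self]
  · rintro ⟨g, hg, rfl⟩
    have e : ∀ i ≤ n, Function.update g (n + 1) r i = g i := fun i hi =>
      Function.update_of_ne (by omega) _ _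
    have key : ∀ s, g ∈ halfPaths n s → (s + 1 = r ∨ s = r + 1) →
        Function.update g (n + 1) r ∈ halfPaths (n + 1) r := by
      rintro s ⟨h0, hs, hr, hz⟩ hsr
      refine ⟨by rw [e 0 (by omega), h0], fun i hi => ?_, Function.update_self _ _ _,
        fun i hi => ?_⟩
      · by_cases hin : i = n
        · subst hin
          rw [e i le_rfl, Function.update_self]
          omega
        · rw [e i (by omega), e (i + 1) (by omega)]
          exact hs i (by omega)
      · rw [Function.update_of_ne (by omega)]
        exact hz i (by omega)
    rcases hg with hg | ⟨s, hs, hg⟩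
    · exact key _ hg (Or.inr rfl)
    · exact key s hg (Or.inl hs)

/-- Continuation by zero fixes the value at `n + 1` that the update overwrites, so nothing is lost.
-/
theorem halfPaths_update_injOn (n r : ℕ) :
    Set.InjOn (fun h : ℕ → ℕ => Function.update h (n + 1) r)
      (halfPaths n (r + 1) ∪ {h | ∃ s, s + 1 = r ∧ h ∈ halfPaths n s}) := by
  have hz : ∀ h ∈ halfPaths n (r + 1) ∪ {h | ∃ s, s + 1 = r ∧ h ∈ halfPaths n s},
      h (n + 1) = 0 := by
    rintro h (h1 | ⟨s, -, h1⟩) <;> exact h1.2.2.2 _ (by omega)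
  intro g hg h hh e
  funext i
  by_cases hi : i = n + 1
  · rw [hi, hz g hg, hz h hh]
  · have := congrFun e i
    simpa only [Function.update_of_ne hi] using this

theorem halfPaths_finite (n r : ℕ) : (halfPaths n r).Finite := by
  induction n generalizing r with
  | zero =>
    rw [halfPaths_zero]
    split_ifs
    · exact Set.finite_singleton _
    · exact Set.finite_empty
  | succ n ih =>
    rw [halfPaths_succ]
    refine Set.Finite.image _ ((ih _).union ?_)
    rcases r with _ | r
    · convert Set.finite_empty
      ext h
      simp
    · exact (ih r).subset fun h ⟨s, hs, hh⟩ => Nat.succ_injective hs ▸ hh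

theorem ncard_halfPaths_succ_zero (n : ℕ) :
    (halfPaths (n + 1) 0).ncard = (halfPaths n 1).ncard := by
  rw [halfPaths_succ, (halfPaths_update_injOn n 0).ncard_image]
  congr 1
  ext h
  simp

theorem ncard_halfPaths_succ_succ (n r : ℕ) :
    (halfPaths (n + 1) (r + 1)).ncard = (halfPaths n (r + 2)).ncard + (halfPaths n r).ncard := by
  rw [halfPaths_succ, (halfPaths_update_injOn n (r + 1)).ncard_image]
  have : {h | ∃ s, s + 1 = r + 1 ∧ h ∈ halfPaths n s} = halfPaths n r := by
    ext h
    simp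
  rw [this, Set.ncard_union_eq _ (halfPaths_finite _ _) (halfPaths_finite _ _)]
  rw [Set.disjoint_left]
  rintro h h1 h2
  have := h1.2.2.1.symm.trans h2.2.2.1
  omega

theorem ncard_halfPaths_of_lt {n r : ℕ} (h : n < r) : (halfPaths n r).ncard = 0 := by
  induction n generalizing r with
  | zero => rw [halfPaths_zero, if_neg (by omega), Set.ncard_empty]
  | succ n ih =>
    obtain ⟨r, rfl⟩ : ∃ s, r = s + 1 := ⟨r - 1, by omega⟩
    rw [ncard_halfPaths_succ_succ, ih (by omega), ih (by omega)]

/-- The ballot numbers. -/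
theorem ncard_halfPaths {n r k : ℕ} (h : r + 2 * k = n) :
    (n + 1) * (halfPaths n r).ncard = (r + 1) * (n + 1).choose k := by
  induction n generalizing r k with
  | zero =>
    obtain rfl : r = 0 := by omega
    obtain rfl : k = 0 := by omega
    simp [halfPaths_zero]
  | succ n ih =>
    rcases k with _ | k
    · obtain rfl : r = n + 1 := by omega
      have := ih (r := n) (k := 0) (by omega)
      rw [ncard_halfPaths_succ_succ, ncard_halfPaths_of_lt (by omega)]
      simp only [Nat.choose_zero_right, mul_one] at this ⊢
      have h1 : (halfPaths n n).ncard = 1 := by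
        have : (n + 1) * (halfPaths n n).ncard = (n + 1) * 1 := by omega
        exact Nat.eq_of_mul_eq_mul_left (by omega) this
      rw [h1]
      ring
    · rcases r with _ | r
      · obtain rfl : n = 2 * k + 1 := by omega
        have h1 := ih (r := 1) (k := k) (by omega)
        have c2 := Nat.add_one_mul_choose_eq (2 * k + 1 + 1) k
        rw [ncard_halfPaths_succ_zero]
        -- After multiplication by `k + 1` the claim follows from the absorption identity `c2`,
        -- since the induction hypothesis says `(k + 1) * X = a`.
        refine Nat.eq_of_mul_eq_mul_left (Nat.succ_pos k) ?_
        rw [Nat.succ_eq_add_one]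
        generalize (halfPaths (2 * k + 1) 1).ncard = X at *
        generalize (2 * k + 1 + 1).choose k = a at *
        generalize (2 * k + 1 + 1 + 1).choose (k + 1) = b at *
        have h2 : (k + 1) * X = a := by linarith
        calc (k + 1) * ((2 * k + 1 + 1 + 1) * X) = (2 * k + 1 + 1 + 1) * ((k + 1) * X) := by ring
          _ = (k + 1) * ((0 + 1) * b) := by rw [h2, c2]; ring
      · obtain rfl : n = r + 2 * k + 2 := by omega
        have h1 := ih (r := r + 2) (k := k) (by omega)
        have h2 := ih (r := r) (k := k + 1) (by omega)
        have c3 := Nat.choose_succ_right_eq (r + 2 * k + 2 + 1) k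
        rw [show r + 2 * k + 2 + 1 - k = r + k + 3 by omega] at c3
        rw [ncard_halfPaths_succ_succ, Nat.choose_succ_succ' (r + 2 * k + 2 + 1) k]
        -- The factor `r + 2k + 3` is the denominator in both induction hypotheses. Once they are
        -- inserted, the ratio `c3` of neighbouring binomial coefficients remains; `r + 2k + 4` is
        -- the factor on the left of the claim.
        refine Nat.eq_of_mul_eq_mul_left (Nat.succ_pos (r + 2 * k + 2)) ?_
        rw [Nat.succ_eq_add_one]
        generalize (halfPaths (r + 2 * k + 2) r).ncard = Y at *
        generalize (halfPaths (r + 2 * k + 2) (r + 2)).ncard = X at *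
        generalize (r + 2 * k + 2 + 1).choose k = a at *
        generalize (r + 2 * k + 2 + 1).choose (k + 1) = b at *
        zify at *
        linear_combination (r + 2 * k + 4 : ℤ) * h1 + (r + 2 * k + 4 : ℤ) * h2 - 2 * c3

theorem halfPaths_nonempty {n r k : ℕ} (h : r + 2 * k = n) : (halfPaths n r).Nonempty := by
  have h1 := ncard_halfPaths h
  refine Set.nonempty_of_ncard_ne_zero fun h0 => ?_
  rw [h0, mul_zero] at h1
  have h2 := Nat.choose_pos (n := n + 1) (k := k) (by omega)
  have h3 := Nat.mul_pos (Nat.succ_pos r) h2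
  rw [Nat.succ_eq_add_one, ← h1] at h3
  exact h3.false

end Diagram

/-! ### Diagrams with prescribed halves -/

namespace Jones
open Diagram
variable {n : ℕ}

/-- The path describing the upper half of a diagram. -/
noncomputable def upPath (α : JonesMonoid n) (i : ℕ) : ℕ :=
  if i ≤ n then height α.1.rel i else 0

theorem upPath_mem (α : JonesMonoid n) : upPath α ∈ halfPaths n α.1.rank := by
  refine ⟨?_, fun i hi => ?_, ?_, fun i hi => if_neg (by omega)⟩
  · rw [upPath, if_pos (by omega), height_zero]
  · rw [upPath, upPath, if_pos (by omega), if_pos (by omega)]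
    exact unitSteps_height α.2.1 i (by omega)
  · rw [upPath, if_pos le_rfl, height_mid]

theorem upPath_eq_iff {α β : JonesMonoid n} : upPath α = upPath β ↔ upRel α = upRel β := by
  constructor
  · intro h
    refine upRel_eq_of_height fun i hi => ?_
    have := congrFun h i
    rwa [upPath, upPath, if_pos hi, if_pos hi] at this
  · intro h
    funext i
    unfold upPath
    split_ifs with hi
    · exact height_congr h hi
    · rfl

/-- Follow `p`, then `q` backwards. The common end height makes the pieces fit, and the diagram of
the resulting closed path has these halves. So the two halves are independent apart from their rank.
-/
theorem exists_upPath_star_eq {r : ℕ} {p q : ℕ → ℕ} (hp : p ∈ halfPaths n r)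
    (hq : q ∈ halfPaths n r) : ∃ α : JonesMonoid n, upPath α = p ∧ upPath (star α) = q := by
  obtain ⟨p0, ps, pn, pz⟩ := hp
  obtain ⟨q0, qs, qn, qz⟩ := hq
  let h : ℕ → ℕ := fun i => if i ≤ n then p i else q (2 * n - i)
  have hle : ∀ i ≤ n, h i = p i := fun i hi => if_pos hi
  have hge : ∀ i, n ≤ i → h i = q (2 * n - i) := by
    intro i hi
    rcases hi.eq_or_lt with rfl | hi
    · rw [hle n le_rfl, show 2 * n - n = n by omega, pn, qn]
    · exact if_neg (by omega)
  have hs : UnitSteps (2 * n) h := by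
    intro i hi
    rcases Nat.lt_or_ge i n with h1 | h1
    · rw [hle i h1.le, hle (i + 1) h1]
      exact ps i h1
    · rw [hge i h1, hge (i + 1) (by omega)]
      have := qs (2 * n - (i + 1)) (by omega)
      rw [show 2 * n - (i + 1) + 1 = 2 * n - i by omega] at this
      exact this.symm
  have h0 : h 0 = 0 := by rw [hle 0 (by omega), p0]
  have hN : h (2 * n) = 0 := by rw [hge _ (by omega), Nat.sub_self, q0]
  let α : JonesMonoid n := ⟨⟨ofHeight n h⟩, allPairs_ofHeight hs h0 hN, planar_ofHeight h⟩
  have hα : ∀ i ≤ 2 * n, height α.1.rel i = h i := fun i hi => height_ofHeight hs h0 hN hi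
  refine ⟨α, ?_, ?_⟩
  · funext i
    unfold upPath
    split_ifs with hi
    · rw [hα i (by omega), hle i hi]
    · rw [pz i (by omega)]
  · funext i
    unfold upPath
    split_ifs with hi
    · rw [height_star _ (by omega), hα _ (by omega), hge _ (by omega)]
      congr 1; omega
    · rw [qz i (by omega)]

/-- Any two diagrams of the same rank have a common companion. -/
theorem exists_upRel_loRel {α β : JonesMonoid n} (h : α.1.rank = β.1.rank) :
    ∃ γ : JonesMonoid n, upRel γ = upRel α ∧ loRel γ = loRel β := by
  have hβ := upPath_mem (star β)
  rw [rank_star, ← h] at hβ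
  obtain ⟨γ, h1, h2⟩ := exists_upPath_star_eq (upPath_mem α) hβ
  exact ⟨γ, upPath_eq_iff.1 h1, upPath_eq_iff.1 h2⟩

theorem exists_rank_eq {r k : ℕ} (h : r + 2 * k = n) : ∃ α : JonesMonoid n, α.1.rank = r := by
  obtain ⟨p, hp⟩ := halfPaths_nonempty h
  obtain ⟨α, h1, -⟩ := exists_upPath_star_eq hp hp
  refine ⟨α, ?_⟩
  have h2 := (upPath_mem α).2.2.1
  rw [h1] at h2
  exact h2.symm.trans hp.2.2.1

end Jones

/-! ### Hooks and multiplication by hooks -/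

namespace Jones
open Diagram
variable {n : ℕ}

/-- Block labels of the diagram with hooks at `i`, `i + 1` in both rows. -/
def hookLabel (n i : ℕ) : Fin n ⊕ Fin n → ℕ :=
  -- Strands carry labels below `n`, so `n` and `n + 1` are free for the upper and the lower hook.
  Sum.elim (fun x => if (x : ℕ) = i ∨ (x : ℕ) = i + 1 then n else x)
    (fun x => if (x : ℕ) = i ∨ (x : ℕ) = i + 1 then n + 1 else x)

theorem allPairs_hook {i : ℕ} (hi : i + 1 < n) : AllPairs (Setoid.ker (hookLabel n i)) := by
  rw [allPairs_iff]
  have e : ∀ x y : Fin n, x = y ↔ (x : ℕ) = y := fun x y => Fin.ext_iff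
  rintro (x | x)
  · by_cases h1 : (x : ℕ) = i
    · refine ⟨Sum.inl ⟨i + 1, hi⟩, by simp [e]; omega, ?_⟩
      rintro (z | z) <;> have := z.2 <;>
        simp only [Setoid.ker_def, hookLabel, Sum.elim_inl, Sum.elim_inr, Sum.inl.injEq, e,
          reduceCtorEq, or_false, iff_false] <;> split_ifs <;> omega
    · by_cases h2 : (x : ℕ) = i + 1
      · refine ⟨Sum.inl ⟨i, by omega⟩, by simp [e]; omega, ?_⟩
        rintro (z | z) <;> have := z.2 <;>
          simp only [Setoid.ker_def, hookLabel, Sum.elim_inl, Sum.elim_inr, Sum.inl.injEq, e,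
            reduceCtorEq, or_false, iff_false] <;> split_ifs <;> omega
      · refine ⟨Sum.inr x, by simp, ?_⟩
        rintro (z | z) <;> have := z.2 <;>
          simp only [Setoid.ker_def, hookLabel, Sum.elim_inl, Sum.elim_inr, Sum.inl.injEq,
            Sum.inr.injEq, e, reduceCtorEq, or_false, false_or] <;> split_ifs <;> omega
  · by_cases h1 : (x : ℕ) = i
    · refine ⟨Sum.inr ⟨i + 1, hi⟩, by simp [e]; omega, ?_⟩
      rintro (z | z) <;> have := z.2 <;>
        simp only [Setoid.ker_def, hookLabel, Sum.elim_inl, Sum.elim_inr, Sum.inr.injEq, e,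
          reduceCtorEq, or_false, iff_false] <;> split_ifs <;> omega
    · by_cases h2 : (x : ℕ) = i + 1
      · refine ⟨Sum.inr ⟨i, by omega⟩, by simp [e]; omega, ?_⟩
        rintro (z | z) <;> have := z.2 <;>
          simp only [Setoid.ker_def, hookLabel, Sum.elim_inl, Sum.elim_inr, Sum.inr.injEq, e,
            reduceCtorEq, or_false, iff_false] <;> split_ifs <;> omega
      · refine ⟨Sum.inl x, by simp, ?_⟩
        rintro (z | z) <;> have := z.2 <;>
          simp only [Setoid.ker_def, hookLabel, Sum.elim_inl, Sum.elim_inr, Sum.inl.injEq,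
            Sum.inr.injEq, e, reduceCtorEq, or_false, false_or] <;> split_ifs <;> omega

theorem planar_hook (i : ℕ) : Planar (Setoid.ker (hookLabel n i)) := by
  intro a b c d h1 h2 h3 h4 h5
  exfalso
  rcases a with a | a <;> rcases b with b | b <;> rcases c with c | c <;> rcases d with d | d <;>
    simp only [circ, Sum.elim_inl, Sum.elim_inr] at h1 h2 h3 <;> try omega
  all_goals
    simp only [Setoid.ker_def, hookLabel, Sum.elim_inl, Sum.elim_inr] at h4 h5
    split_ifs at h4 h5 <;> omega

/-- The standard generators of the Jones monoid. -/
def hook (i : ℕ) (hi : i + 1 < n) : JonesMonoid n :=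
  ⟨⟨Setoid.ker (hookLabel n i)⟩, allPairs_hook hi, planar_hook i⟩

theorem hook_upper {i : ℕ} (hi : i + 1 < n) {x y : Fin n} (hx : (x : ℕ) = i ∨ (x : ℕ) = i + 1)
    (hy : (y : ℕ) = i ∨ (y : ℕ) = i + 1) : (hook i hi).1.rel (Sum.inl x) (Sum.inl y) := by
  change hookLabel n i _ = hookLabel n i _
  simp only [hookLabel, Sum.elim_inl, if_pos hx, if_pos hy]

theorem hook_lower {i : ℕ} (hi : i + 1 < n) {x y : Fin n} (hx : (x : ℕ) = i ∨ (x : ℕ) = i + 1)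
    (hy : (y : ℕ) = i ∨ (y : ℕ) = i + 1) : (hook i hi).1.rel (Sum.inr x) (Sum.inr y) := by
  change hookLabel n i _ = hookLabel n i _
  simp only [hookLabel, Sum.elim_inr, if_pos hx, if_pos hy]

theorem hook_strand {i : ℕ} (hi : i + 1 < n) {x : Fin n} (hx : ¬((x : ℕ) = i ∨ (x : ℕ) = i + 1)) :
    (hook i hi).1.rel (Sum.inl x) (Sum.inr x) := by
  change hookLabel n i _ = hookLabel n i _
  simp only [hookLabel, Sum.elim_inl, Sum.elim_inr, if_neg hx]

theorem star_hook {i : ℕ} (hi : i + 1 < n) : star (hook i hi) = hook i hi := by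
  symm
  refine eq_of_le fun x y hxy => ?_
  obtain ⟨z, hz, hxz⟩ := (star (hook i hi)).2.1.exists_rel x
  change hookLabel n i _ = hookLabel n i _ at hxy
  change hookLabel n i _ = hookLabel n i _
  rcases x with x | x <;> rcases y with y | y <;> have := x.2 <;> have := y.2 <;>
    simp only [hookLabel, Sum.elim_inl, Sum.elim_inr, Sum.swap_inl, Sum.swap_inr] at hxy ⊢ <;>
    split_ifs at hxy ⊢ <;> omega

/-- A vertex that is not one of the upper vertices `i`, `i + 1`. -/
def Off (i : ℕ) (x : Fin n ⊕ Fin n) : Prop :=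
  ∀ k : Fin n, x = Sum.inl k → ¬((k : ℕ) = i ∨ (k : ℕ) = i + 1)

theorem off_inr (i : ℕ) (k : Fin n) : Off i (Sum.inr k : Fin n ⊕ Fin n) := by
  intro _ h
  simp at h

theorem off_inl {i : ℕ} {k : Fin n} : Off i (Sum.inl k : Fin n ⊕ Fin n) ↔
    ¬((k : ℕ) = i ∨ (k : ℕ) = i + 1) :=
  ⟨fun h => h k rfl, fun h _ hj => Sum.inl_injective hj ▸ h⟩

theorem stack_hook_lower {i : ℕ} (hi : i + 1 < n) (β : JonesMonoid n) {x : Fin n ⊕ Fin n}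
    (hx : Off i x) : stack (hook i hi).1.rel β.1.rel (outer x) (lower x) := by
  rcases x with x | x
  · exact stack_upper (hook_strand hi (off_inl.1 hx))
  · exact Setoid.refl' _ _

theorem hook_mul_rel {i : ℕ} (hi : i + 1 < n) (β : JonesMonoid n) {x y : Fin n ⊕ Fin n}
    (hx : Off i x) (hy : Off i y) (h : β.1.rel x y) : (hook i hi * β).1.rel x y :=
  let s := stack (hook i hi).1.rel β.1.rel
  s.trans' (stack_hook_lower hi β hx)
    (s.trans' (stack_lower h) (s.symm' (stack_hook_lower hi β hy)))

theorem hook_mul_rel_of_lower {i : ℕ} (hi : i + 1 < n) (β : JonesMonoid n) {x y : Fin n ⊕ Fin n}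
    {b c : Fin n} (hx : Off i x) (hy : Off i y) (hb : (b : ℕ) = i ∨ (b : ℕ) = i + 1)
    (hc : (c : ℕ) = i ∨ (c : ℕ) = i + 1) (h : β.1.rel x (Sum.inl b))
    (h' : β.1.rel (Sum.inl c) y) : (hook i hi * β).1.rel x y :=
  let s := stack (hook i hi).1.rel β.1.rel
  s.trans' (stack_hook_lower hi β hx)
    (s.trans' (stack_lower h) (s.trans' (stack_upper (hook_lower hi hb hc))
      (s.trans' (stack_lower h') (s.symm' (stack_hook_lower hi β hy)))))

theorem hook_mul_upper {i : ℕ} (hi : i + 1 < n) (β : JonesMonoid n) {x y : Fin n}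
    (hx : (x : ℕ) = i ∨ (x : ℕ) = i + 1) (hy : (y : ℕ) = i ∨ (y : ℕ) = i + 1) :
    (hook i hi * β).1.rel (Sum.inl x) (Sum.inl y) :=
  comp_inl_inl (hook_upper hi hx hy)

/-- Points that are related to an end of a hook are ends of that hook. -/
theorem end_of_hook {α : JonesMonoid n} {i : ℕ} (hi : i + 1 < n)
    (h : α.1.rel (Sum.inl ⟨i, by omega⟩) (Sum.inl ⟨i + 1, hi⟩)) {x y : Fin n ⊕ Fin n}
    (hxy : α.1.rel x y) : (Off i x ∧ Off i y) ∨ ∃ a b : Fin n, x = Sum.inl a ∧ y = Sum.inl b ∧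
      ((a : ℕ) = i ∨ (a : ℕ) = i + 1) ∧ ((b : ℕ) = i ∨ (b : ℕ) = i + 1) := by
  have key : ∀ x y : Fin n ⊕ Fin n, α.1.rel x y → ¬ Off i x → ¬ Off i y := by
    intro x y hxy hx
    unfold Off at hx ⊢
    push Not at hx ⊢
    obtain ⟨k, rfl, hk⟩ := hx
    by_cases hy : y = Sum.inl k
    · exact ⟨k, hy, hk⟩
    · rcases hk with hk | hk
      · have hk' : k = ⟨i, by omega⟩ := Fin.ext hk
        rw [hk'] at hxy hy
        exact ⟨_, α.2.1.eq_of_rel hxy h hy (by simp), Or.inr rfl⟩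
      · have hk' : k = ⟨i + 1, by omega⟩ := Fin.ext hk
        rw [hk'] at hxy hy
        exact ⟨_, α.2.1.eq_of_rel hxy (α.1.rel.symm' h) hy (by simp), Or.inl rfl⟩
  by_cases hx : Off i x
  · refine Or.inl ⟨hx, ?_⟩
    by_contra hy
    exact key y x (α.1.rel.symm' hxy) hy hx
  · have hy := key x y hxy hx
    unfold Off at hx hy
    push Not at hx hy
    obtain ⟨a, ha, ha'⟩ := hx
    obtain ⟨b, hb, hb'⟩ := hy
    exact Or.inr ⟨a, b, ha, hb, ha', hb'⟩

theorem hook_mul_self {α : JonesMonoid n} {i : ℕ} (hi : i + 1 < n)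
    (h : α.1.rel (Sum.inl ⟨i, by omega⟩) (Sum.inl ⟨i + 1, hi⟩)) : hook i hi * α = α := by
  symm
  refine eq_of_le fun x y hxy => ?_
  rcases end_of_hook hi h hxy with ⟨hx, hy⟩ | ⟨a, b, rfl, rfl, ha, hb⟩
  · exact hook_mul_rel hi α hx hy hxy
  · exact hook_mul_upper hi α ha hb

/-- A form of the relation `e_{i+1} e_i e_{i+1} = e_{i+1}`. It serves to move hooks: `hook i * α`
has a hook one place further left, and `α` is recovered from it by another hook. -/
theorem hook_mul_hook_mul {α : JonesMonoid n} {i : ℕ} (hi : i + 1 + 1 < n)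
    (h : α.1.rel (Sum.inl ⟨i + 1, by omega⟩) (Sum.inl ⟨i + 1 + 1, hi⟩)) :
    hook (i + 1) hi * (hook i (by omega) * α) = α := by
  symm
  have hi' : i + 1 < n := by omega
  set β := hook i hi' * α with hβ
  refine eq_of_le fun x y hxy => ?_
  have hβ1 : β.1.rel (Sum.inl ⟨i, by omega⟩) (Sum.inl ⟨i + 1, hi'⟩) :=
    hook_mul_upper hi' α (Or.inl rfl) (Or.inr rfl)
  rcases end_of_hook hi h hxy with ⟨hx, hy⟩ | ⟨a, b, rfl, rfl, ha, hb⟩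
  swap
  · exact hook_mul_upper hi β ha hb
  -- the strand starting at `i`
  have strand : ∀ w, Off (i + 1) w → w ≠ Sum.inl ⟨i, by omega⟩ →
      α.1.rel (Sum.inl ⟨i, by omega⟩) w →
      (hook (i + 1) hi * β).1.rel (Sum.inl ⟨i, by omega⟩) w := by
    intro w hw hne hr
    have hw' : Off i w := by
      intro k hk hki
      rcases hki with hki | hki
      · exact hne (by rw [hk]; congr 1; exact Fin.ext hki)
      · exact hw k hk (Or.inl hki)
    -- In `β` the strand that started at `i` starts at `i + 2`; multiplication by `hook (i + 1)`
    -- brings it back.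
    have h2 : β.1.rel (Sum.inl ⟨i + 1 + 1, hi⟩) w :=
      hook_mul_rel_of_lower hi' α (b := ⟨i + 1, hi'⟩) (c := ⟨i, by omega⟩)
        (off_inl.2 (by dsimp only; omega)) hw' (Or.inr rfl) (Or.inl rfl) (α.1.rel.symm' h) hr
    exact hook_mul_rel_of_lower hi β (b := ⟨i + 1, hi'⟩) (c := ⟨i + 1 + 1, hi⟩)
        (off_inl.2 (by dsimp only; omega)) hw (Or.inl rfl) (Or.inr rfl) hβ1 h2
  by_cases hxi : x = Sum.inl ⟨i, by omega⟩
  · by_cases hyi : y = Sum.inl ⟨i, by omega⟩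
    · rw [hxi, hyi]
    · subst hxi
      exact strand y hy hyi hxy
  · by_cases hyi : y = Sum.inl ⟨i, by omega⟩
    · subst hyi
      exact Setoid.symm' _ (strand x hx hxi (α.1.rel.symm' hxy))
    · have off : ∀ w : Fin n ⊕ Fin n, Off (i + 1) w → w ≠ Sum.inl ⟨i, by omega⟩ → Off i w := by
        intro w hw hne k hk hki
        rcases hki with hki | hki
        · exact hne (by rw [hk]; congr 1; exact Fin.ext hki)
        · exact hw k hk (Or.inl hki)
      exact hook_mul_rel hi β hx hy
        (hook_mul_rel hi' α (off x hx hxi) (off y hy hyi) hxy)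

/-- Only the strands that start at `i` and `i + 1` can be lost. Together with `rank_parity` this
makes the rank descend without gaps. -/
theorem rank_le_hook_mul {i : ℕ} (hi : i + 1 < n) (α : JonesMonoid n) :
    α.1.rank ≤ (hook i hi * α).1.rank + 2 := by
  rw [← rank_star α, ← rank_star (hook i hi * α), rank_eq, rank_eq]
  have sub : ∀ k : Fin n, {j | α.1.rel (Sum.inr j) (Sum.inl k)}.ncard ≤ 1 := by
    intro k
    rw [Set.ncard_le_one_iff]
    intro a b ha hb
    exact Sum.inr_injective
      (α.2.1.eq_of_rel (α.1.rel.symm' ha) (α.1.rel.symm' hb) (by simp) (by simp))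
  have h : through (star α) ⊆ through (star (hook i hi * α)) ∪
      ({j | α.1.rel (Sum.inr j) (Sum.inl ⟨i, by omega⟩)} ∪
        {j | α.1.rel (Sum.inr j) (Sum.inl ⟨i + 1, hi⟩)}) := by
    rintro j ⟨k, hk⟩
    by_cases h1 : (k : ℕ) = i
    · have h1' : k = ⟨i, by omega⟩ := Fin.ext h1
      rw [h1'] at hk
      exact Or.inr (Or.inl hk)
    by_cases h2 : (k : ℕ) = i + 1
    · have h2' : k = ⟨i + 1, by omega⟩ := Fin.ext h2
      rw [h2'] at hk
      exact Or.inr (Or.inr hk)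
    · exact Or.inl ⟨k, hook_mul_rel hi α (off_inr i j) (off_inl.2 (by tauto)) hk⟩
  have e1 := Set.ncard_le_ncard h (Set.toFinite _)
  have e2 := Set.ncard_union_le (through (star (hook i hi * α)))
    ({j | α.1.rel (Sum.inr j) (Sum.inl ⟨i, by omega⟩)} ∪
        {j | α.1.rel (Sum.inr j) (Sum.inl ⟨i + 1, hi⟩)})
  have e3 := Set.ncard_union_le {j | α.1.rel (Sum.inr j) (Sum.inl ⟨i, by omega⟩)}
        {j | α.1.rel (Sum.inr j) (Sum.inl ⟨i + 1, hi⟩)}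
  have e4 := sub ⟨i, by omega⟩
  have e5 := sub ⟨i + 1, hi⟩
  omega

end Jones

/-! ### The hooks generate the Jones monoid -/

namespace Jones
open Diagram
variable {n : ℕ}

/-- A shortest upper arc joins neighbours: otherwise planarity confines the partner of the vertex
next to its left end to the inside of the arc, which gives a shorter arc. -/
theorem exists_upper_hook {α : JonesMonoid n} (h : α.1.rank < n) :
    ∃ (i : ℕ) (hi : i + 1 < n), α.1.rel (Sum.inl ⟨i, by omega⟩) (Sum.inl ⟨i + 1, hi⟩) := by
  classical
  have hex : ∃ d, ∃ a b : Fin n, (a : ℕ) + d = b ∧ 0 < d ∧ α.1.rel (Sum.inl a) (Sum.inl b) := by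
    have : ∃ i, i ∉ through α := by
      by_contra hall
      push Not at hall
      rw [rank_eq, Set.eq_univ_of_forall hall, Set.ncard_univ, Nat.card_eq_fintype_card,
        Fintype.card_fin] at h
      exact lt_irrefl _ h
    obtain ⟨i, hi⟩ := this
    rw [mem_through_iff] at hi
    push Not at hi
    obtain ⟨j, hj, hne⟩ := hi
    have hne' : (j : ℕ) ≠ i := fun e => hne (Fin.ext e)
    rcases Nat.lt_or_gt_of_ne hne' with hlt | hlt
    · exact ⟨i - j, j, i, by omega, by omega, α.1.rel.symm' hj⟩
    · exact ⟨j - i, i, j, by omega, by omega, hj⟩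
  obtain ⟨a, b, hab, hd, hr⟩ := Nat.find_spec hex
  have hmin := fun m (hm : m < Nat.find hex) => Nat.find_min hex hm
  generalize Nat.find hex = d at *
  have hb := b.2
  have hd1 : d = 1 := by
    by_contra hne
    have hc : (a : ℕ) + 1 < n := by omega
    obtain ⟨y, hy, hcy⟩ := α.2.1.exists_rel (Sum.inl ⟨a + 1, hc⟩)
    have ca : circ (Sum.inl a : Fin n ⊕ Fin n) = a := rfl
    have cb : circ (Sum.inl b : Fin n ⊕ Fin n) = b := rfl
    have cc : circ (Sum.inl ⟨a + 1, hc⟩ : Fin n ⊕ Fin n) = a + 1 := rfl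
    have contra : ¬ α.1.rel (Sum.inl a) (Sum.inl ⟨a + 1, hc⟩) := by
      intro hac
      have := Sum.inl_injective (α.2.1.eq_of_rel hr hac
        (fun e => by have := congrArg circ e; omega) (fun e => by have := congrArg circ e; omega))
      have := congrArg Fin.val this
      simp only at this
      omega
    have hya : circ y ≠ a := fun e => contra (by
      rw [← ca] at e
      rw [← circ_injective e]
      exact α.1.rel.symm' hcy)
    have hyb : circ y ≠ b := fun e => contra (by
      rw [← cb] at e
      rw [circ_injective e] at hcy
      exact α.1.rel.trans' hr (α.1.rel.symm' hcy))
    have hyc : circ y ≠ a + 1 := fun e => hy (circ_injective (e.trans cc.symm))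
    rcases Nat.lt_or_ge (circ y) a with h1 | h1
    · have := α.2.2 y (Sum.inl a) (Sum.inl ⟨a + 1, hc⟩) (Sum.inl b) (by omega) (by omega)
        (by omega) (α.1.rel.symm' hcy) hr
      exact contra (α.1.rel.trans' (α.1.rel.symm' this) (α.1.rel.symm' hcy))
    rcases Nat.lt_or_ge b (circ y) with h2 | h2
    · exact contra (α.2.2 (Sum.inl a) (Sum.inl ⟨a + 1, hc⟩) (Sum.inl b) y (by omega) (by omega)
        (by omega) hr hcy)
    · rcases y with y | y
      · change (y : ℕ) ≠ _ at hya hyb hyc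
        change _ ≤ (y : ℕ) at h1
        change (y : ℕ) ≤ b at h2
        exact hmin (y - (a + 1)) (by omega) ⟨⟨a + 1, hc⟩, y, by simp only; omega, by omega, hcy⟩
      · simp only [circ, Sum.elim_inr] at h2
        omega
  subst hd1
  refine ⟨a, by omega, ?_⟩
  have : b = ⟨a + 1, by omega⟩ := Fin.ext hab.symm
  rw [this] at hr
  exact hr

/-- The submonoid generated by the hooks. -/
def hookMonoid (n : ℕ) : Submonoid (JonesMonoid n) :=
  Submonoid.closure {α | ∃ (i : ℕ) (hi : i + 1 < n), α = hook i hi}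

theorem hook_mem {i : ℕ} (hi : i + 1 < n) : hook i hi ∈ hookMonoid n :=
  Submonoid.subset_closure ⟨i, hi, rfl⟩

theorem star_one : star (1 : JonesMonoid n) = 1 := by
  have := mul_star_self_mul (1 : JonesMonoid n)
  rwa [one_mul, mul_one] at this

theorem star_mem {α : JonesMonoid n} (h : α ∈ hookMonoid n) : star α ∈ hookMonoid n := by
  induction h using Submonoid.closure_induction with
  | mem x hx =>
    obtain ⟨i, hi, rfl⟩ := hx
    rw [star_hook]
    exact hook_mem hi
  | one => rw [star_one]; exact one_mem _
  | mul x y _ _ hx hy => rw [star_mul]; exact mul_mem hy hx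

/-- A hook can be moved to the left end of the row. -/
theorem mem_hookMonoid_of_shift {s : ℕ} (hs : s < n) (hn : 0 + 1 < n) (Q : Setoid (Fin n) → Prop)
    (H : ∀ α : JonesMonoid n, α.1.rank = s → Q (loRel α) →
      upRel α ⟨0, by omega⟩ ⟨0 + 1, hn⟩ → α ∈ hookMonoid n)
    (α : JonesMonoid n) (hα : α.1.rank = s) (hQ : Q (loRel α)) : α ∈ hookMonoid n := by
  obtain ⟨i, hi, hr⟩ := exists_upper_hook (hα.trans_lt hs)
  induction i generalizing α with
  | zero => exact H α hα hQ hr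
  | succ i ih =>
    have e := hook_mul_hook_mul hi hr
    have hi' : i + 1 < n := by omega
    -- By `e` each of `α` and `hook i * α` is a left multiple of the other. Equal rank then
    -- preserves the lower half, on which `Q` depends.
    have hrank : (hook i hi' * α).1.rank = α.1.rank := by
      refine le_antisymm (rank_mul_le_right _ _) ?_
      conv_lhs => rw [← e]
      exact rank_mul_le_right _ _
    rw [← e]
    refine mul_mem (hook_mem _) (ih _ (hrank.trans hα) ?_ hi'
      (hook_mul_upper hi' α (Or.inl rfl) (Or.inr rfl)))
    rwa [loRel_mul hrank]

/-- Block labels after replacing the hooks at the left end of both rows by two strands. -/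
noncomputable def openLabel (α : Setoid (Fin n ⊕ Fin n)) (x : Fin n ⊕ Fin n) :
    ℕ ⊕ Quotient α :=
  open Classical in
  -- The first two vertices of each row receive labels `0` and `1`, so equal labels join them
  -- vertically.
  if circ x < 2 then Sum.inl (circ x)
  else if 2 * n - 1 < circ x + 2 then Sum.inl (2 * n - 1 - circ x)
  else Sum.inr (Quotient.mk α x)

/-- The vertices with labels `1` and `2` in either row. -/
def Corner (x : Fin n ⊕ Fin n) : Prop := circ x < 2 ∨ 2 * n - 1 < circ x + 2

theorem openLabel_eq_iff (hn : 0 + 1 < n) (α : Setoid (Fin n ⊕ Fin n)) (x y : Fin n ⊕ Fin n) :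
    openLabel α x = openLabel α y ↔
      (Corner x ∧ Corner y ∧ (circ x = circ y ∨ circ x + circ y = 2 * n - 1)) ∨
      (¬ Corner x ∧ ¬ Corner y ∧ α x y) := by
  have lx := circ_lt x
  have ly := circ_lt y
  have hq : Quotient.mk α x = Quotient.mk α y ↔ α x y := Quotient.eq
  unfold openLabel Corner
  by_cases h1 : circ x < 2 <;> by_cases h2 : 2 * n - 1 < circ x + 2 <;>
    by_cases h3 : circ y < 2 <;> by_cases h4 : 2 * n - 1 < circ y + 2 <;>
    simp only [h1, h2, h3, h4, if_true, if_false, Sum.inl.injEq, Sum.inr.injEq, hq, reduceCtorEq,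
      or_true, or_self, or_false, not_true, not_false_iff, true_and, false_and,
      false_or] <;> omega

/-- The numbers `1 = 0 + 1` and `4n - 3 = (2n - 1) + (2n - 2)` are the sums of the boundary
positions of the ends of the upper and of the lower left hook. -/
theorem rel_corner {α : JonesMonoid n} (hn : 0 + 1 < n)
    (hu : upRel α ⟨0, by omega⟩ ⟨0 + 1, hn⟩)
    (hl : loRel α ⟨0, by omega⟩ ⟨0 + 1, hn⟩) {x y : Fin n ⊕ Fin n} (h : α.1.rel x y)
    (hx : Corner x) : circ y = circ x ∨ circ y + circ x = 1 ∨ circ y + circ x = 4 * n - 3 := by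
  by_cases hyx : y = x
  · exact Or.inl (congrArg circ hyx)
  right
  have c0 : circ (Sum.inl ⟨0, by omega⟩ : Fin n ⊕ Fin n) = 0 := rfl
  have c1 : circ (Sum.inl ⟨0 + 1, hn⟩ : Fin n ⊕ Fin n) = 1 := rfl
  have d0 : circ (Sum.inr ⟨0, by omega⟩ : Fin n ⊕ Fin n) = 2 * n - 1 := rfl
  have d1 : circ (Sum.inr ⟨0 + 1, hn⟩ : Fin n ⊕ Fin n) = 2 * n - 1 - 1 := rfl
  have lx := circ_lt x
  have key : ∀ u v : Fin n ⊕ Fin n, α.1.rel u v → u ≠ v → circ x = circ u → circ y = circ v := by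
    intro u v huv hne hxu
    have := circ_injective hxu
    subst this
    rw [α.2.1.eq_of_rel h huv hyx hne.symm]
  unfold Corner at hx
  have hx' : circ x = 0 ∨ circ x = 1 ∨ circ x = 2 * n - 1 ∨ circ x = 2 * n - 1 - 1 := by omega
  rcases hx' with hx | hx | hx | hx
  · have := key _ _ hu (by simp) (hx.trans c0.symm)
    omega
  · have := key _ _ (α.1.rel.symm' hu) (by simp) (hx.trans c1.symm)
    omega
  · have := key _ _ hl (by simp) (hx.trans d0.symm)
    omega
  · have := key _ _ (α.1.rel.symm' hl) (by simp) (hx.trans d1.symm)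
    omega

theorem corner_iff_of_rel {α : JonesMonoid n} (hn : 0 + 1 < n)
    (hu : upRel α ⟨0, by omega⟩ ⟨0 + 1, hn⟩)
    (hl : loRel α ⟨0, by omega⟩ ⟨0 + 1, hn⟩) {x y : Fin n ⊕ Fin n} (h : α.1.rel x y) :
    Corner x ↔ Corner y := by
  have key : ∀ x y : Fin n ⊕ Fin n, α.1.rel x y → Corner x → Corner y := by
    intro x y h hx
    have := rel_corner hn hu hl h hx
    have lx := circ_lt x
    have ly := circ_lt y
    unfold Corner at *
    omega
  exact ⟨key x y h, key y x (α.1.rel.symm' h)⟩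

/-- Replacing the two left hooks by two vertical strands crosses nothing, because they lie at the
edge of the rectangle. The rank goes up, and `hook 0` restores the hooks. -/
theorem exists_hook_mul_eq (α : JonesMonoid n) (hn : 0 + 1 < n)
    (hu : upRel α ⟨0, by omega⟩ ⟨0 + 1, hn⟩) (hl : loRel α ⟨0, by omega⟩ ⟨0 + 1, hn⟩) :
    ∃ β : JonesMonoid n, α.1.rank < β.1.rank ∧ hook 0 hn * β = α := by
  have hiff := openLabel_eq_iff hn α.1.rel
  have hcor := fun {x y : Fin n ⊕ Fin n} (h : α.1.rel x y) => corner_iff_of_rel hn hu hl h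
  have hp : AllPairs (Setoid.ker (openLabel α.1.rel)) := by
    rw [allPairs_iff]
    intro x
    have lx := circ_lt x
    by_cases hx : Corner x
    · obtain ⟨y, hy⟩ := exists_circ_eq (n := n) (i := 2 * n - 1 - circ x) (by omega)
      refine ⟨y, fun e => by subst e; omega, fun z => ?_⟩
      rw [Setoid.ker_def, hiff]
      constructor
      · rintro (⟨-, -, h | h⟩ | ⟨h, -⟩)
        · exact Or.inl (circ_injective h.symm)
        · exact Or.inr (circ_injective (by omega))
        · exact absurd hx h
      · rintro (rfl | rfl)
        · exact Or.inl ⟨hx, hx, Or.inl rfl⟩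
        · refine Or.inl ⟨hx, ?_, Or.inr (by omega)⟩
          unfold Corner at hx ⊢
          omega
    · obtain ⟨y, hy, hyr⟩ := allPairs_iff.1 α.2.1 x
      refine ⟨y, hy, fun z => ?_⟩
      rw [Setoid.ker_def, hiff, ← hyr]
      constructor
      · rintro (⟨h, -⟩ | ⟨-, -, h⟩)
        · exact absurd h hx
        · exact h
      · exact fun h => Or.inr ⟨hx, fun hz => hx ((hcor h).2 hz), h⟩
  have hpl : Planar (Setoid.ker (openLabel α.1.rel)) := by
    intro a b c d hab hbc hcd hac hbd
    have ld := circ_lt d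
    rw [Setoid.ker_def, hiff] at *
    rcases hac with ⟨ha, hc, h1⟩ | ⟨ha, hc, h1⟩ <;> rcases hbd with ⟨hb, hd, h2⟩ | ⟨hb, hd, h2⟩
    · omega
    · exfalso; unfold Corner at *; omega
    · exfalso; unfold Corner at *; omega
    · exact Or.inr ⟨ha, hb, α.2.2 a b c d hab hbc hcd h1 h2⟩
  let β : JonesMonoid n := ⟨⟨Setoid.ker (openLabel α.1.rel)⟩, hp, hpl⟩
  have hβ : ∀ x y, β.1.rel x y ↔ _ := hiff
  refine ⟨β, ?_, ?_⟩
  · rw [rank_eq, rank_eq]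
    refine Set.ncard_lt_ncard (Set.ssubset_iff_of_subset ?_ |>.2 ⟨⟨0, by omega⟩, ?_, ?_⟩)
    · rintro i ⟨j, hj⟩
      have hi : ¬ Corner (Sum.inl i : Fin n ⊕ Fin n) := by
        intro hi
        have := rel_corner hn hu hl hj hi
        simp only [circ, Sum.elim_inl, Sum.elim_inr] at this
        unfold Corner at hi
        simp only [circ, Sum.elim_inl] at hi
        omega
      exact ⟨j, (hβ _ _).2 (Or.inr ⟨hi, fun h => hi ((hcor hj).2 h), hj⟩)⟩
    · refine ⟨⟨0, by omega⟩, (hβ _ _).2 (Or.inl ⟨?_, ?_, Or.inr ?_⟩)⟩ <;>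
        simp only [Corner, circ, Sum.elim_inl, Sum.elim_inr] <;> omega
    · rw [mem_through_iff]
      intro h
      have := congrArg Fin.val (h _ hu)
      simp at this
  · symm
    refine eq_of_le fun x y hxy => ?_
    rcases end_of_hook hn hu hxy with ⟨hx, hy⟩ | ⟨a, b, rfl, rfl, ha, hb⟩
    swap
    · exact hook_mul_upper hn β ha hb
    by_cases hc : Corner x
    · have hc' := (hcor hxy).1 hc
      have low : ∀ x : Fin n ⊕ Fin n, Off 0 x → Corner x → 2 * n - 1 < circ x + 2 := by
        rintro (k | k) h1 h2
        · have := off_inl.1 h1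
          unfold Corner at h2
          simp only [circ, Sum.elim_inl] at h2 ⊢
          omega
        · unfold Corner at h2
          simp only [circ, Sum.elim_inr] at h2 ⊢
          omega
      have hx' := low x hx hc
      have hy' := low y hy hc'
      have lx := circ_lt x
      have ly := circ_lt y
      have cx : circ (Sum.inl ⟨2 * n - 1 - circ x, by omega⟩ : Fin n ⊕ Fin n) =
        2 * n - 1 - circ x := rfl
      have cy : circ (Sum.inl ⟨2 * n - 1 - circ y, by omega⟩ : Fin n ⊕ Fin n) =
        2 * n - 1 - circ y := rfl
      refine hook_mul_rel_of_lower hn β (b := ⟨2 * n - 1 - circ x, by omega⟩)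
        (c := ⟨2 * n - 1 - circ y, by omega⟩) hx hy (by dsimp only; omega)
        (by dsimp only; omega) ((hβ _ _).2 (Or.inl ⟨hc, ?_, Or.inr (by omega)⟩))
        ((hβ _ _).2 (Or.inl ⟨?_, hc', Or.inr (by omega)⟩)) <;>
        unfold Corner <;> omega
    · exact hook_mul_rel hn β hx hy
        ((hβ _ _).2 (Or.inr ⟨hc, fun h => hc ((hcor hxy).2 h), hxy⟩))

/-- Induction on `n - rank`. A diagram of rank below `n` has a hook in each row; both are moved to
the left end by multiplication with hooks, and then opened into strands, which raises the rank. Rank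
`n` leaves only the identity. -/
theorem hookMonoid_eq_top : hookMonoid n = ⊤ := by
  rw [eq_top_iff]
  suffices H : ∀ d (α : JonesMonoid n), n - α.1.rank = d → α ∈ hookMonoid n from
    fun α _ => H _ α rfl
  intro d
  induction d using Nat.strong_induction_on with
  | _ d ih =>
  intro α hd
  rcases Nat.lt_or_ge α.1.rank n with h | h
  · obtain ⟨i, hi, -⟩ := exists_upper_hook h
    have hn : 0 + 1 < n := by omega
    refine mem_hookMonoid_of_shift h hn (fun _ => True) (fun β hβ _ hu => ?_) α rfl trivial
    -- The lower row is handled as the upper row of the reflection; `Q` remembers that the other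
    -- hook is already at the left end.
    rw [← star_star β]
    refine star_mem (mem_hookMonoid_of_shift h hn (fun r => r ⟨0, by omega⟩ ⟨0 + 1, hn⟩)
      (fun γ hγ hl hu' => ?_) (star β) (by rw [rank_star, hβ]) hu)
    obtain ⟨ε, h1, rfl⟩ := exists_hook_mul_eq γ hn hu' hl
    exact mul_mem (hook_mem _) (ih (n - ε.1.rank) (by omega) ε rfl)
  · have key : ∀ β : JonesMonoid n, n ≤ β.1.rank → upRel β = ⊥ := by
      intro β hβ
      have : through β = Set.univ := by
        refine Set.eq_of_subset_of_ncard_le (Set.subset_univ _) ?_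
        rw [← rank_eq, Set.ncard_univ, Nat.card_eq_fintype_card, Fintype.card_fin]
        exact hβ
      refine eq_bot_iff.2 fun x y hxy => ?_
      exact ((mem_through_iff β x).1 (this ▸ Set.mem_univ x) y hxy).symm
    have : α = 1 := by
      refine ext_upRel_loRel ?_ ?_
      · rw [key α h, key 1 rank_one.ge]
      · rw [← upRel_star, ← upRel_star, key _ (by rwa [rank_star]), star_one,
          key 1 rank_one.ge]
    rw [this]
    exact one_mem _

end Jones

/-! ### Projections of rank `r` generate the ideal, and fewer elements do not -/

namespace Jones
open Diagram
variable {n : ℕ}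

instance : Finite (JonesMonoid n) :=
  Finite.of_injective (fun α : JonesMonoid n => fun x y => α.1.rel x y) fun _ _ h =>
    ext_rel (Setoid.ext fun x y => iff_of_eq (congrFun (congrFun h x) y))

/-- The rank is the height reached from `0` after `n` steps of size one. -/
theorem rank_parity (α : JonesMonoid n) : α.1.rank % 2 = n % 2 := by
  have h : ∀ i ≤ n, height α.1.rel i % 2 = i % 2 := by
    intro i
    induction i with
    | zero => intro _; rw [height_zero]
    | succ i ih =>
      intro hi
      have h1 := ih (by omega)
      have h2 := unitSteps_height α.2.1 i (by omega)
      omega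
  rw [← height_mid]
  exact h n le_rfl

theorem mem_hookMonoid (α : JonesMonoid n) : α ∈ hookMonoid n := by
  rw [hookMonoid_eq_top]
  trivial

/-- Induction on the number of hooks in a product. -/
theorem hook_induction {P : JonesMonoid n → Prop} (one : P 1)
    (mul : ∀ (i : ℕ) (hi : i + 1 < n) (α : JonesMonoid n), P α → P (hook i hi * α))
    (α : JonesMonoid n) : P α := by
  have h := mem_hookMonoid α
  induction h using Submonoid.closure_induction_left with
  | one => exact one
  | mul_left x hx y _ ih =>
    obtain ⟨i, hi, rfl⟩ := hx
    exact mul i hi y ih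

/-- Write `w` as a word in hooks and multiply `y` by one hook after the other. The rank falls by at
most two each time and keeps its parity, so it cannot jump over `r`. -/
theorem exists_factor_left {r : ℕ} (y : JonesMonoid n) (hy : r ≤ y.1.rank) (hr : r % 2 = n % 2)
    (w : JonesMonoid n) (hw : (w * y).1.rank ≤ r) :
    ∃ u v : JonesMonoid n, w = u * v ∧ (v * y).1.rank = r := by
  induction w using hook_induction with
  | one =>
    refine ⟨1, 1, (mul_one 1).symm, ?_⟩
    rw [one_mul] at hw ⊢
    omega
  | mul i hi w ih =>
    rcases Nat.lt_or_ge r (w * y).1.rank with h | h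
    · refine ⟨1, hook i hi * w, (one_mul _).symm, ?_⟩
      have h1 := rank_le_hook_mul hi (w * y)
      have h2 := rank_parity (w * y)
      rw [mul_assoc] at hw ⊢
      omega
    · obtain ⟨u, v, rfl, hv⟩ := ih h
      exact ⟨hook i hi * u, v, (mul_assoc _ _ _).symm, hv⟩

theorem exists_factor_right {r : ℕ} (y : JonesMonoid n) (hy : r ≤ y.1.rank) (hr : r % 2 = n % 2)
    (w : JonesMonoid n) (hw : (y * w).1.rank ≤ r) :
    ∃ u v : JonesMonoid n, w = u * v ∧ (y * u).1.rank = r := by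
  obtain ⟨u, v, h1, h2⟩ := exists_factor_left (star y) (by rwa [rank_star]) hr (star w)
    (by rwa [← star_mul, rank_star])
  refine ⟨star v, star u, ?_, ?_⟩
  · rw [← star_mul, ← h1, star_star]
  · rw [← rank_star, star_mul, star_star, h2]

/-- The projections of rank `r`. -/
def projections (n r : ℕ) : Set (JonesMonoid n) := {α | ∃ β, β.1.rank = r ∧ α = β * star β}

/-- A projection is fixed by `star`, so its upper half determines it, and every half path occurs. -/
theorem ncard_projections (n r : ℕ) : (projections n r).ncard = (halfPaths n r).ncard := by
  have hup : ∀ β : JonesMonoid n, upRel (β * star β) = upRel β := fun β =>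
    upRel_mul (rank_mul_star_self β)
  have hsym : ∀ α ∈ projections n r, star α = α := by
    rintro α ⟨β, -, rfl⟩
    rw [star_mul, star_star]
  refine Set.ncard_congr (fun α _ => upPath α) ?_ ?_ ?_
  · rintro α ⟨β, rfl, rfl⟩
    have := upPath_mem (β * star β)
    rwa [rank_mul_star_self] at this
  · intro α β hα hβ h
    have h1 := upPath_eq_iff.1 h
    refine ext_upRel_loRel h1 ?_
    rw [← upRel_star, ← upRel_star, hsym α hα, hsym β hβ, h1]
  · intro p hp
    obtain ⟨α, h1, -⟩ := exists_upPath_star_eq hp hp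
    refine ⟨α * star α, ⟨α, ?_, rfl⟩, ?_⟩
    · have h2 := (upPath_mem α).2.2.1
      rw [h1] at h2
      exact h2.symm.trans hp.2.2.1
    · rw [← h1, upPath_eq_iff, hup]

theorem hook_idem {i : ℕ} (hi : i + 1 < n) : hook i hi * hook i hi = hook i hi :=
  hook_mul_self hi (hook_upper hi (Or.inl rfl) (Or.inr rfl))

/-- The subsemigroup generated by the projections of rank `r`. -/
def projectionClosure (n r : ℕ) : Subsemigroup (JonesMonoid n) :=
  Subsemigroup.closure (projections n r)

section Closure
variable {r : ℕ}

theorem mul_star_mem {α : JonesMonoid n} (h : α.1.rank = r) :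
    α * star α ∈ projectionClosure n r :=
  Subsemigroup.subset_closure ⟨α, h, rfl⟩

/-- As long as the rank stays `r`, a further hook `e` costs two projections: `eα = (eα)(eα)^* · αα^*
· α`, because `e` is an idempotent fixed by `star`. -/
theorem mul_mem_of_rank_eq {x : JonesMonoid n} (hx : x ∈ projectionClosure n r)
    (hxr : x.1.rank = r) (ζ : JonesMonoid n) (h : (ζ * x).1.rank = r) :
    ζ * x ∈ projectionClosure n r := by
  induction ζ using hook_induction with
  | one => rwa [one_mul]
  | mul i hi ζ ih =>
    rw [mul_assoc] at h ⊢
    -- Intermediate products have rank between that of the full product and that of `x`, both equal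
    -- to `r`.
    have h1 : (ζ * x).1.rank = r := le_antisymm ((rank_mul_le_right _ _).trans hxr.le)
      (h.symm.le.trans (rank_mul_le_right _ _))
    have h2 := ih h1
    generalize ζ * x = α at *
    have e : (hook i hi * α) * star (hook i hi * α) * (α * star α) * α = hook i hi * α := by
      have e1 := mul_star_self_mul (hook i hi * α)
      rw [star_mul, star_hook] at e1 ⊢
      have e2 : star α * hook i hi * (hook i hi * α) = star α * hook i hi * α := by
        rw [mul_assoc, ← mul_assoc (hook i hi), hook_idem, ← mul_assoc]
      rw [mul_assoc, mul_star_self_mul]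
      rw [mul_assoc, e2] at e1
      rw [mul_assoc, e1]
    rw [← e]
    exact mul_mem (mul_mem (mul_star_mem h) (mul_star_mem h1)) h2

/-- `β = β (β^* β)` starts from a projection and never leaves rank `r`. -/
theorem mem_of_rank_eq {β : JonesMonoid n} (h : β.1.rank = r) : β ∈ projectionClosure n r := by
  have h1 := mul_star_mem (α := star β) (r := r) (by rw [rank_star, h])
  rw [star_star] at h1
  have h2 : (star β * β).1.rank = r := by
    have := rank_mul_star_self (star β)
    rwa [star_star, rank_star, h] at this
  have e : β * (star β * β) = β := by rw [← mul_assoc, mul_star_self_mul]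
  have := mul_mem_of_rank_eq h1 h2 β (by rw [e, h])
  rwa [e] at this

/-- A hook may push the rank below `r`, but it has rank at least `n - 2 ≥ r` itself. So `d d^*`
splits as `u v` with `hook * u` of rank exactly `r`, and `hook * d = (hook * u)(v d)`; here `v d`
has rank `r` because `u (v d) = d`. -/
theorem hook_mul_mem {d : JonesMonoid n} (hd : d.1.rank = r) (hr : r + 2 ≤ n) {i : ℕ}
    (hi : i + 1 < n) : hook i hi * d ∈ projectionClosure n r := by
  have hg : r ≤ (hook i hi : JonesMonoid n).1.rank := by
    have := rank_le_hook_mul hi (1 : JonesMonoid n)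
    rw [mul_one, rank_one] at this
    omega
  have hle : (hook i hi * (d * star d)).1.rank ≤ r := by
    refine (rank_mul_le_right _ _).trans ?_
    rw [rank_mul_star_self, hd]
  obtain ⟨u, v, huv, hu⟩ := exists_factor_right (hook i hi) hg (hd ▸ rank_parity d) _ hle
  have e : u * (v * d) = d := by rw [← mul_assoc, ← huv, mul_star_self_mul]
  have hv : (v * d).1.rank = r := by
    refine le_antisymm ((rank_mul_le_right _ _).trans hd.le) ?_
    rw [← hd]
    conv_lhs => rw [← e]
    exact rank_mul_le_right _ _
  rw [← e, ← mul_assoc]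
  exact mul_mem (mem_of_rank_eq hu) (mem_of_rank_eq hv)

theorem mul_mem_projectionClosure (hr : r + 2 ≤ n) (u : JonesMonoid n) {t : JonesMonoid n}
    (ht : t ∈ projectionClosure n r) : u * t ∈ projectionClosure n r := by
  induction u using hook_induction with
  | one => rwa [one_mul]
  | mul i hi u ih =>
    rw [mul_assoc]
    generalize u * t = s at ih
    induction ih using Subsemigroup.closure_induction with
    | mem x hx =>
      obtain ⟨β, hβ, rfl⟩ := hx
      exact hook_mul_mem ((rank_mul_star_self β).trans hβ) hr hi
    | mul x y _ hy hx' _ =>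
      rw [← mul_assoc]
      exact mul_mem hx' hy

theorem coe_projectionClosure (hr : r + 2 ≤ n) (hp : r % 2 = n % 2) :
    (projectionClosure n r : Set (JonesMonoid n)) = jonesIdeal n r := by
  ext x
  constructor
  · intro hx
    induction hx using Subsemigroup.closure_induction with
    | mem x hx =>
      obtain ⟨β, hβ, rfl⟩ := hx
      exact ((rank_mul_star_self β).trans hβ).le
    | mul x y _ _ hx _ => exact (rank_mul_le_left x y).trans hx
  · intro hx
    -- Descending from the identity, every element of the ideal has a right factor of rank exactly
    -- `r`.
    obtain ⟨u, v, rfl, hv⟩ := exists_factor_left (r := r) 1 (by rw [rank_one]; omega) hp x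
      (by rw [mul_one]; exact hx)
    rw [mul_one] at hv
    exact mul_mem_projectionClosure hr u (mem_of_rank_eq hv)

/-- An element of rank `r` inherits its upper half from the first generator in any factorisation,
since generators in the ideal have no larger rank. So every half path belongs to some generator. -/
theorem card_ge_of_closure_eq {A : Finset (JonesMonoid n)}
    (hA : (Subsemigroup.closure (A : Set (JonesMonoid n)) : Set (JonesMonoid n))
      = jonesIdeal n r) : (halfPaths n r).ncard ≤ A.card := by
  have key : ∀ x ∈ Subsemigroup.closure (A : Set (JonesMonoid n)), ∃ a ∈ A,
      x.1.rank ≤ a.1.rank ∧ (x.1.rank = a.1.rank → upRel x = upRel a) := by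
    intro x hx
    induction hx using Subsemigroup.closure_induction with
    | mem x hx => exact ⟨x, hx, le_rfl, fun _ => rfl⟩
    | mul x y _ _ hx _ =>
      obtain ⟨a, ha, h1, h2⟩ := hx
      have h3 := rank_mul_le_left x y
      refine ⟨a, ha, h3.trans h1, fun h => ?_⟩
      rw [upRel_mul (by omega)]
      exact h2 (by omega)
  have hsub : halfPaths n r ⊆ upPath '' (A : Set (JonesMonoid n)) := by
    intro p hp
    obtain ⟨α, h1, -⟩ := exists_upPath_star_eq hp hp
    have hα : α.1.rank = r := by
      have h2 := (upPath_mem α).2.2.1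
      rw [h1] at h2
      exact h2.symm.trans hp.2.2.1
    have hmem : α ∈ (Subsemigroup.closure (A : Set (JonesMonoid n)) : Set (JonesMonoid n)) := by
      rw [hA]; exact hα.le
    obtain ⟨a, ha, h2, h3⟩ := key α hmem
    have har : a ∈ jonesIdeal n r := by
      rw [← hA]; exact Subsemigroup.subset_closure ha
    have har : a.1.rank ≤ r := har
    refine ⟨a, ha, ?_⟩
    rw [← h1, upPath_eq_iff]
    exact (h3 (by omega)).symm
  calc (halfPaths n r).ncard ≤ (upPath '' (A : Set (JonesMonoid n))).ncard :=
        Set.ncard_le_ncard hsub (A.finite_toSet.image _)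
    _ ≤ (A : Set (JonesMonoid n)).ncard := Set.ncard_image_le A.finite_toSet
    _ = A.card := Set.ncard_coe_finset A

theorem semigroupRank_jonesIdeal (hr : r + 2 ≤ n) (hp : r % 2 = n % 2) :
    semigroupRank (jonesIdeal n r) = (halfPaths n r).ncard := by
  classical
  have hfin : (projections n r).Finite := Set.toFinite _
  refine le_antisymm (Nat.sInf_le ⟨hfin.toFinset, ?_, ?_⟩) (le_csInf ⟨_, hfin.toFinset, rfl, ?_⟩ ?_)
  · rw [← Set.ncard_eq_toFinset_card _ hfin, ncard_projections]
  · rw [Set.Finite.coe_toFinset]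
    exact coe_projectionClosure hr hp
  · rw [Set.Finite.coe_toFinset]
    exact coe_projectionClosure hr hp
  · rintro m ⟨A, rfl, hA⟩
    exact card_ge_of_closure_eq hA

end Closure
end Jones

/-! ### Semisimple rings and representations of twisted algebras -/

/-- Von Neumann regularity: the left ideal of `x` is generated by an idempotent `e = y x`, and right
multiplication by `e` fixes that ideal. -/
theorem IsSemisimpleRing.exists_mul_mul_eq {R : Type*} [Ring R] [IsSemisimpleRing R] (x : R) :
    ∃ y, x * y * x = x := by
  obtain ⟨e, he, hI⟩ := IsSemisimpleRing.ideal_eq_span_idempotent (Ideal.span {x})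
  obtain ⟨a, ha⟩ := Ideal.mem_span_singleton'.1
    (show x ∈ Ideal.span {e} from hI ▸ Ideal.mem_span_singleton_self x)
  obtain ⟨y, hy⟩ := Ideal.mem_span_singleton'.1
    (show e ∈ Ideal.span {x} from hI ▸ Ideal.mem_span_singleton_self e)
  refine ⟨y, ?_⟩
  rw [mul_assoc, hy, ← ha, mul_assoc, he.eq]

namespace TwistedAlgebra
variable {S R : Type*} [Monoid S] [CommRing R] (ψ : Twisting S R)

/-- The representation of a twisted semigroup algebra belonging to a twisted representation of
the semigroup. -/
noncomputable def lift {E : Type*} [Ring E] [Algebra R E] (f : S → E) (h1 : f 1 = 1)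
    (hm : ∀ a b, f a * f b = ψ.toFun a b • f (a * b)) : TwistedAlgebra ψ →ₐ[R] E :=
  AlgHom.ofLinearMap ((basis ψ).constr R f)
    (by rw [one_def, ← basis_apply, Module.Basis.constr_basis, h1])
    (fun x y => by
      have : (LinearMap.mul R (TwistedAlgebra ψ)).compr₂ ((basis ψ).constr R f) =
          (LinearMap.mul R E).compl₁₂ ((basis ψ).constr R f) ((basis ψ).constr R f) := by
        refine (basis ψ).ext fun a => (basis ψ).ext fun b => ?_
        simp only [LinearMap.compr₂_apply, LinearMap.compl₁₂_apply, LinearMap.mul_apply',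
          Module.Basis.constr_basis, hm]
        rw [basis_apply, basis_apply, of_mul_of, map_smul, ← basis_apply,
          Module.Basis.constr_basis]
      exact LinearMap.congr_fun₂ this x y)

theorem lift_of {E : Type*} [Ring E] [Algebra R E] (f : S → E) (h1 : f 1 = 1)
    (hm : ∀ a b, f a * f b = ψ.toFun a b • f (a * b)) (a : S) : lift ψ f h1 hm (of ψ a) = f a :=
  (basis ψ).constr_basis R f a

/-- A property of elements that is stable under linear combinations holds if it holds for the
basis elements. -/
theorem induction_basis {P : TwistedAlgebra ψ → Prop} (x : TwistedAlgebra ψ) (h0 : P 0)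
    (hadd : ∀ x y, P x → P y → P (x + y)) (hsmul : ∀ (c : R) x, P x → P (c • x))
    (hof : ∀ a, P (of ψ a)) : P x := by
  have : x ∈ Submodule.span R (Set.range (basis ψ)) := (basis ψ).mem_span x
  induction this using Submodule.span_induction with
  | mem x hx => obtain ⟨a, rfl⟩ := hx; exact hof a
  | zero => exact h0
  | add x y _ _ hx hy => exact hadd x y hx hy
  | smul c x _ hx => exact hsmul c x hx

end TwistedAlgebra

/-! ### Cell modules -/

namespace Jones
open Diagram
variable {n : ℕ}

/-- The diagrams with the same lower half as a given one. -/
abbrev LClass (β : JonesMonoid n) : Type := {α : JonesMonoid n // loRel α = loRel β}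

theorem LClass.rank_eq {β : JonesMonoid n} (α : LClass β) : α.1.1.rank = β.1.rank :=
  rank_congr_lo α.2

/-- The product `γα` as an element of the `L`-class of `α`. -/
def LClass.act {β : JonesMonoid n} (γ : JonesMonoid n) (α : LClass β)
    (h : (γ * α.1).1.rank = β.1.rank) : LClass β :=
  ⟨γ * α.1, (loRel_mul (h.trans α.rank_eq.symm)).trans α.2⟩

section Action
variable (δ : ℂ) (β : JonesMonoid n)

open Classical in
/-- The action of a diagram on the linear span of an `L`-class. -/
noncomputable def actOn (γ : JonesMonoid n) : Module.End ℂ (LClass β →₀ ℂ) :=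
  Finsupp.linearCombination ℂ fun α =>
    if h : (γ * α.1).1.rank = β.1.rank then
      Finsupp.single (α.act γ h) ((jonesTwisting n δ).toFun γ α.1) else 0

theorem actOn_single (γ : JonesMonoid n) (α : LClass β) (h : (γ * α.1).1.rank = β.1.rank) :
    actOn δ β γ (Finsupp.single α 1) =
      (jonesTwisting n δ).toFun γ α.1 • Finsupp.single (α.act γ h) 1 := by
  rw [actOn, Finsupp.linearCombination_single, one_smul, dif_pos h, Finsupp.smul_single,
    smul_eq_mul, mul_one]

theorem actOn_single_zero (γ : JonesMonoid n) (α : LClass β)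
    (h : (γ * α.1).1.rank ≠ β.1.rank) : actOn δ β γ (Finsupp.single α 1) = 0 := by
  rw [actOn, Finsupp.linearCombination_single, one_smul, dif_neg h]

theorem actOn_one : actOn δ β 1 = 1 := by
  refine Finsupp.lhom_ext' fun α => LinearMap.ext_ring ?_
  have h : ((1 : JonesMonoid n) * α.1).1.rank = β.1.rank := by rw [one_mul, α.rank_eq]
  have e : α.act 1 h = α := Subtype.ext (one_mul _)
  change actOn δ β 1 (Finsupp.single α 1) = Finsupp.single α 1
  rw [actOn_single δ β 1 α h, (jonesTwisting n δ).one_left, one_smul, e]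

/-- Once the rank has dropped it never recovers, so the truncated products still associate; the
scalars agree by the cocycle identity. -/
theorem actOn_mul (γ γ' : JonesMonoid n) : actOn δ β γ * actOn δ β γ' =
    (jonesTwisting n δ).toFun γ γ' • actOn δ β (γ * γ') := by
  refine Finsupp.lhom_ext' fun α => LinearMap.ext_ring ?_
  change actOn δ β γ (actOn δ β γ' (Finsupp.single α 1)) =
    (jonesTwisting n δ).toFun γ γ' • actOn δ β (γ * γ') (Finsupp.single α 1)
  by_cases h' : (γ' * α.1).1.rank = β.1.rank
  · rw [actOn_single δ β γ' α h', map_smul]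
    by_cases h : (γ * (γ' * α.1)).1.rank = β.1.rank
    · rw [actOn_single δ β γ (α.act γ' h') h,
        actOn_single δ β (γ * γ') α (by rwa [mul_assoc]), smul_smul, smul_smul,
        (jonesTwisting n δ).cocycle, mul_comm]
      congr 2
      exact Subtype.ext (mul_assoc _ _ _).symm
    · rw [actOn_single_zero δ β γ (α.act γ' h') h,
        actOn_single_zero δ β (γ * γ') α (by rwa [mul_assoc]), smul_zero, smul_zero]
  · rw [actOn_single_zero δ β γ' α h', map_zero, actOn_single_zero, smul_zero]
    intro h
    rw [mul_assoc] at h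
    have h1 := rank_mul_le_right γ (γ' * α.1)
    have h2 := rank_mul_le_right γ' α.1
    have h3 := α.rank_eq
    omega

/-- The cell module: the linear span of an `L`-class, where products of smaller rank are
replaced by zero. -/
def CellModule (_δ : ℂ) (β : JonesMonoid n) : Type := LClass β →₀ ℂ

noncomputable instance : AddCommGroup (CellModule δ β) :=
  inferInstanceAs (AddCommGroup (LClass β →₀ ℂ))

noncomputable instance : Module ℂ (CellModule δ β) :=
  inferInstanceAs (Module ℂ (LClass β →₀ ℂ))

/-- The representation of the Temperley–Lieb algebra on a cell module. -/
noncomputable def cellRep : TemperleyLieb n δ →ₐ[ℂ] Module.End ℂ (CellModule δ β) :=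
  TwistedAlgebra.lift (jonesTwisting n δ) (actOn δ β) (actOn_one δ β) (actOn_mul δ β)

noncomputable instance : Module (TemperleyLieb n δ) (CellModule δ β) :=
  Module.compHom (CellModule δ β) (cellRep δ β).toRingHom

theorem smul_eq_cellRep (a : TemperleyLieb n δ) (v : CellModule δ β) :
    a • v = cellRep δ β a v := rfl

instance : IsScalarTower ℂ (TemperleyLieb n δ) (CellModule δ β) where
  smul_assoc c a v := by
    rw [smul_eq_cellRep, smul_eq_cellRep, map_smul, LinearMap.smul_apply]

/-- The basis vector of a cell module belonging to a diagram. -/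
noncomputable def cellBasis (α : LClass β) : CellModule δ β := Finsupp.single α (1 : ℂ)

theorem cell_induction {P : CellModule δ β → Prop} (v : CellModule δ β) (h0 : P 0)
    (hadd : ∀ x y, P x → P y → P (x + y)) (hb : ∀ (c : ℂ) α, P (c • cellBasis δ β α)) : P v := by
  refine Finsupp.induction_linear v h0 hadd fun α c => ?_
  have e : (c • cellBasis δ β α : CellModule δ β) = Finsupp.single α c :=
    (Finsupp.smul_single c α (1 : ℂ)).trans (by rw [smul_eq_mul, mul_one])
  exact e ▸ hb c α

theorem tlBasis_smul (γ : JonesMonoid n) (v : CellModule δ β) :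
    tlBasis δ γ • v = actOn δ β γ v :=
  congrArg (fun f : Module.End ℂ (CellModule δ β) => f v)
    (TwistedAlgebra.lift_of (jonesTwisting n δ) (actOn δ β) (actOn_one δ β) (actOn_mul δ β) γ)

theorem tlBasis_smul_cellBasis (γ : JonesMonoid n) (α : LClass β)
    (h : (γ * α.1).1.rank = β.1.rank) : tlBasis δ γ • cellBasis δ β α =
      (jonesTwisting n δ).toFun γ α.1 • cellBasis δ β (α.act γ h) :=
  (tlBasis_smul δ β γ _).trans (actOn_single δ β γ α h)

theorem tlBasis_smul_cellBasis_zero (γ : JonesMonoid n) (α : LClass β)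
    (h : (γ * α.1).1.rank ≠ β.1.rank) : tlBasis δ γ • cellBasis δ β α = 0 :=
  (tlBasis_smul δ β γ _).trans (actOn_single_zero δ β γ α h)

theorem smul_complex_comm (a : TemperleyLieb n δ) (c : ℂ) (v : CellModule δ β) :
    a • c • v = c • a • v := map_smul (cellRep δ β a) c v

theorem tlBasis_smul_of_rank_lt {γ : JonesMonoid n} (h : γ.1.rank < β.1.rank)
    (v : CellModule δ β) : tlBasis δ γ • v = 0 := by
  refine cell_induction δ β (P := fun v => tlBasis δ γ • v = 0) v (smul_zero _) (fun x y hx hy => by rw [smul_add, hx, hy, add_zero])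
    fun c α => ?_
  rw [smul_complex_comm, tlBasis_smul_cellBasis_zero, smul_zero]
  have := rank_mul_le_left γ α.1
  omega

/-- Homomorphisms from a cell module to another module are given by the images of diagrams. -/
noncomputable def cellLift {M : Type*} [AddCommGroup M] [Module ℂ M]
    [Module (TemperleyLieb n δ) M] [IsScalarTower ℂ (TemperleyLieb n δ) M] (g : LClass β → M)
    (hg : ∀ γ α (h : (γ * α.1).1.rank = β.1.rank),
      tlBasis δ γ • g α = (jonesTwisting n δ).toFun γ α.1 • g (α.act γ h))
    (hg0 : ∀ γ α, (γ * α.1).1.rank ≠ β.1.rank → tlBasis δ γ • g α = 0) :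
    CellModule δ β →ₗ[TemperleyLieb n δ] M where
  toFun v := Finsupp.linearCombination ℂ g v
  map_add' x y := map_add (Finsupp.linearCombination ℂ g) x y
  map_smul' a v := by
    have hc : ∀ (c : ℂ) (x : CellModule δ β), Finsupp.linearCombination ℂ g (c • x) =
        c • Finsupp.linearCombination ℂ g x := fun c x =>
      map_smul (Finsupp.linearCombination ℂ g) c x
    have ha : ∀ (x y : CellModule δ β), Finsupp.linearCombination ℂ g (x + y) =
        Finsupp.linearCombination ℂ g x + Finsupp.linearCombination ℂ g y := fun x y =>
      map_add (Finsupp.linearCombination ℂ g) x y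
    have h0 : Finsupp.linearCombination ℂ g (0 : CellModule δ β) = 0 :=
      map_zero (Finsupp.linearCombination ℂ g)
    have hb : ∀ α, Finsupp.linearCombination ℂ g (cellBasis δ β α) = g α := fun α => by
      rw [cellBasis]
      exact (Finsupp.linearCombination_single ℂ (1 : ℂ) α).trans (one_smul _ _)
    have hcomm : ∀ (c : ℂ) (b : TemperleyLieb n δ) (m : M), b • c • m = c • b • m := by
      intro c b m
      rw [← one_smul (TemperleyLieb n δ) m, ← smul_assoc c, smul_smul, ← smul_assoc c, smul_smul,
        mul_smul_comm, smul_mul_assoc]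
    change Finsupp.linearCombination ℂ g (a • v) = a • Finsupp.linearCombination ℂ g v
    refine TwistedAlgebra.induction_basis (jonesTwisting n δ)
      (P := fun a => Finsupp.linearCombination ℂ g (a • v) = a • Finsupp.linearCombination ℂ g v)
      a ?_ ?_ ?_ ?_
    · rw [zero_smul, zero_smul, h0]
    · intro x y hx hy
      rw [add_smul, add_smul, ha, hx, hy]
    · intro c x hx
      rw [smul_assoc, smul_assoc, hc, hx]
    · intro γ
      refine cell_induction δ β (P := fun v => Finsupp.linearCombination ℂ g (tlBasis δ γ • v) =
        tlBasis δ γ • Finsupp.linearCombination ℂ g v) v ?_ ?_ ?_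
      · rw [smul_zero, h0, smul_zero]
      · intro x y hx hy
        rw [smul_add, ha, ha, smul_add, hx, hy]
      · intro c α
        rw [smul_complex_comm, hc, hc, hb, hcomm]
        congr 1
        by_cases h : (γ * α.1).1.rank = β.1.rank
        · rw [tlBasis_smul_cellBasis δ β γ α h, hg γ α h, hc, hb]
        · rw [tlBasis_smul_cellBasis_zero δ β γ α h, hg0 γ α h, h0]

end Action
end Jones

/-! ### Cell modules over a semisimple algebra -/

namespace Jones
open Diagram
variable {n : ℕ}

section Simple
variable (δ : ℂ) (β : JonesMonoid n)

theorem cellBasis_ne_zero (α : LClass β) : cellBasis δ β α ≠ 0 :=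
  Finsupp.single_ne_zero.2 one_ne_zero

theorem cellLift_cellBasis {M : Type*} [AddCommGroup M] [Module ℂ M]
    [Module (TemperleyLieb n δ) M] [IsScalarTower ℂ (TemperleyLieb n δ) M] (g : LClass β → M)
    (hg : ∀ γ α (h : (γ * α.1).1.rank = β.1.rank),
      tlBasis δ γ • g α = (jonesTwisting n δ).toFun γ α.1 • g (α.act γ h))
    (hg0 : ∀ γ α, (γ * α.1).1.rank ≠ β.1.rank → tlBasis δ γ • g α = 0) (α : LClass β) :
    cellLift δ β g hg hg0 (cellBasis δ β α) = g α :=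
  (Finsupp.linearCombination_single ℂ (1 : ℂ) α).trans (one_smul _ _)

/-- The linear embedding of a cell module into the algebra. -/
noncomputable def cellIncl : CellModule δ β →ₗ[ℂ] TemperleyLieb n δ :=
  Finsupp.linearCombination ℂ fun α : LClass β => tlBasis δ α.1

open Classical in
/-- The linear projection of the algebra onto a cell module. -/
noncomputable def cellProj : TemperleyLieb n δ →ₗ[ℂ] CellModule δ β :=
  (TwistedAlgebra.basis (jonesTwisting n δ)).constr ℂ fun α =>
    if h : loRel α = loRel β then cellBasis δ β ⟨α, h⟩ else 0

theorem cellIncl_cellBasis (α : LClass β) :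
    cellIncl δ β (cellBasis δ β α) = tlBasis δ α.1 :=
  (Finsupp.linearCombination_single ℂ (1 : ℂ) α).trans (one_smul _ _)

theorem cellProj_tlBasis (α : LClass β) :
    cellProj δ β (tlBasis δ α.1) = cellBasis δ β α :=
  ((TwistedAlgebra.basis (jonesTwisting n δ)).constr_basis ℂ _ α.1).trans (dif_pos α.2)

theorem cellProj_tlBasis_zero {α : JonesMonoid n} (h : loRel α ≠ loRel β) :
    cellProj δ β (tlBasis δ α) = 0 :=
  ((TwistedAlgebra.basis (jonesTwisting n δ)).constr_basis ℂ _ α).trans (dif_neg h)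

theorem tlBasis_mul_tlBasis (γ α : JonesMonoid n) :
    tlBasis δ γ * tlBasis δ α = (jonesTwisting n δ).toFun γ α • tlBasis δ (γ * α) :=
  TwistedAlgebra.of_mul_of _ _ _

/-- The action is multiplication in the algebra, cut off to one `L`-class: a product of smaller rank
has another lower half and is projected to zero. -/
theorem smul_eq_cellProj (a : TemperleyLieb n δ) (v : CellModule δ β) :
    a • v = cellProj δ β (a * cellIncl δ β v) := by
  refine TwistedAlgebra.induction_basis (jonesTwisting n δ)
    (P := fun a => a • v = cellProj δ β (a * cellIncl δ β v)) a ?_ ?_ ?_ ?_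
  · rw [zero_smul, zero_mul, map_zero]
  · intro x y hx hy
    rw [add_smul, add_mul, map_add, hx, hy]
  · intro c x hx
    rw [smul_assoc, smul_mul_assoc, map_smul, hx]
  · intro γ
    refine cell_induction δ β (P := fun v => tlBasis δ γ • v =
      cellProj δ β (tlBasis δ γ * cellIncl δ β v)) v ?_ ?_ ?_
    · rw [smul_zero, map_zero, mul_zero, map_zero]
    · intro x y hx hy
      rw [smul_add, map_add, mul_add, map_add, hx, hy]
    · intro c α
      rw [smul_complex_comm, map_smul, mul_smul_comm, map_smul, cellIncl_cellBasis,
        tlBasis_mul_tlBasis, map_smul]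
      congr 1
      by_cases h : (γ * α.1).1.rank = β.1.rank
      · rw [tlBasis_smul_cellBasis δ β γ α h]
        exact congrArg _ (cellProj_tlBasis δ β (α.act γ h)).symm
      · rw [tlBasis_smul_cellBasis_zero δ β γ α h, cellProj_tlBasis_zero, smul_zero]
        exact fun h' => h (rank_congr_lo h')

theorem cellProj_cellIncl (v : CellModule δ β) : cellProj δ β (cellIncl δ β v) = v := by
  have := smul_eq_cellProj δ β 1 v
  rwa [one_mul, one_smul, eq_comm] at this

/-- In the semisimple case the diagrams of the rank of a cell module have no common kernel. -/
theorem exists_tlBasis_smul_ne_zero [IsSemisimpleRing (TemperleyLieb n δ)] {v : CellModule δ β}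
    (hv : v ≠ 0) : ∃ γ : JonesMonoid n, γ.1.rank = β.1.rank ∧ tlBasis δ γ • v ≠ 0 := by
  by_contra hcon
  push Not at hcon
  have hle : ∀ γ : JonesMonoid n, γ.1.rank ≤ β.1.rank → tlBasis δ γ • v = 0 := by
    intro γ h
    rcases h.lt_or_eq with h | h
    · exact tlBasis_smul_of_rank_lt δ β h v
    · exact hcon γ h
  -- A product with left factor from the cell span combines diagrams of rank at most that of `β`,
  -- all of which kill `v`.
  have key : ∀ (w : CellModule δ β) (y : TemperleyLieb n δ), (cellIncl δ β w * y) • v = 0 := by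
    intro w y
    refine cell_induction δ β (P := fun w => (cellIncl δ β w * y) • v = 0) w ?_ ?_ ?_
    · rw [map_zero, zero_mul, zero_smul]
    · intro x y hx hy
      rw [map_add, add_mul, add_smul, hx, hy, add_zero]
    · intro c α
      rw [map_smul, smul_mul_assoc, smul_assoc, cellIncl_cellBasis]
      refine TwistedAlgebra.induction_basis (jonesTwisting n δ)
        (P := fun y => c • (tlBasis δ α.1 * y) • v = 0) y ?_ ?_ ?_ ?_
      · rw [mul_zero, zero_smul, smul_zero]
      · intro x y hx hy
        rw [mul_add, add_smul, smul_add, hx, hy, add_zero]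
      · intro d x hx
        rw [mul_smul_comm, smul_assoc, smul_comm, hx, smul_zero]
      · intro κ
        have h := hle (α.1 * κ) ((rank_mul_le_left _ _).trans α.rank_eq.le)
        change c • (tlBasis δ α.1 * tlBasis δ κ) • v = 0
        rw [tlBasis_mul_tlBasis, smul_assoc, h, smul_zero, smul_zero]
  -- With `x` the image of `v` and `x y x = x`, projecting back gives `v = (x y) • v = 0`.
  obtain ⟨y, hy⟩ := IsSemisimpleRing.exists_mul_mul_eq (cellIncl δ β v)
  apply hv
  rw [← cellProj_cellIncl δ β v, ← hy, ← smul_eq_cellProj, key]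

open Classical in
/-- The pairing of a lower half with a vector. -/
noncomputable def pairing (γ : JonesMonoid n) : CellModule δ β →ₗ[ℂ] ℂ :=
  Finsupp.linearCombination ℂ fun α : LClass β =>
    if (γ * α.1).1.rank = β.1.rank then (jonesTwisting n δ).toFun γ α.1 else 0

theorem pairing_cellBasis (γ : JonesMonoid n) (α : LClass β) :
    open Classical in pairing δ β γ (cellBasis δ β α) =
      if (γ * α.1).1.rank = β.1.rank then (jonesTwisting n δ).toFun γ α.1 else 0 :=
  (Finsupp.linearCombination_single ℂ (1 : ℂ) α).trans (one_smul _ _)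

/-- A product `γα` that keeps the rank has the upper half of `γ` and the lower half of `β`, hence is
always the same diagram `κ`. So `γ` acts with image in one line. -/
theorem tlBasis_smul_eq_pairing {γ : JonesMonoid n} (hγ : γ.1.rank = β.1.rank) {κ : LClass β}
    (hκ : upRel κ.1 = upRel γ) (v : CellModule δ β) :
    tlBasis δ γ • v = pairing δ β γ v • cellBasis δ β κ := by
  refine cell_induction δ β (P := fun v => tlBasis δ γ • v =
    pairing δ β γ v • cellBasis δ β κ) v ?_ ?_ ?_
  · rw [smul_zero, map_zero, zero_smul]
  · intro x y hx hy
    rw [smul_add, map_add, add_smul, hx, hy]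
  · intro c α
    rw [smul_complex_comm, map_smul, smul_assoc, pairing_cellBasis]
    congr 1
    split_ifs with h
    · have e : α.act γ h = κ := by
        refine Subtype.ext (ext_upRel_loRel ?_ ((α.act γ h).2.trans κ.2.symm))
        rw [hκ]
        exact upRel_mul (h.trans hγ.symm)
      rw [tlBasis_smul_cellBasis δ β γ α h, e]
    · rw [tlBasis_smul_cellBasis_zero δ β γ α h, zero_smul]

/-- Diagrams with equal lower halves are left multiples of each other, so they lower the rank of the
same `α`; the loops see only the facing rows. -/
theorem pairing_congr {γ η : JonesMonoid n} (h : loRel γ = loRel η) :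
    pairing δ β γ = pairing δ β η := by
  have key : ∀ {γ η α : JonesMonoid n}, loRel γ = loRel η →
      (γ * α).1.rank ≤ (η * α).1.rank := by
    intro γ η α h
    rw [← mul_star_mul h, mul_assoc]
    exact rank_mul_le_right _ _
  have hl : ∀ α, (jonesTwisting n δ).toFun γ α = (jonesTwisting n δ).toFun η α := fun α =>
    congrArg (δ ^ ·) (loops_congr γ.2.1 η.2.1 α.2.1 α.2.1
      (fun i j => by
        have : loRel γ i j ↔ loRel η i j := by rw [h]
        exact this) fun _ _ => Iff.rfl)
  unfold pairing
  congr 1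
  funext α
  rw [hl, le_antisymm (key h) (key h.symm)]

/-- Some `γ` of full rank maps `v` to a nonzero multiple of a basis vector. Exchanging the upper
half of `γ` keeps the scalar and reaches every other basis vector, so each nonzero `v` generates. -/
theorem isSimpleModule_cellModule [IsSemisimpleRing (TemperleyLieb n δ)] :
    IsSimpleModule (TemperleyLieb n δ) (CellModule δ β) := by
  rw [isSimpleModule_iff_toSpanSingleton_surjective]
  refine ⟨⟨cellBasis δ β ⟨β, rfl⟩, 0, cellBasis_ne_zero δ β _⟩, fun v hv w => ?_⟩
  obtain ⟨γ, hγ, hne⟩ := exists_tlBasis_smul_ne_zero δ β hv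
  have hc : pairing δ β γ v ≠ 0 := by
    intro h
    obtain ⟨κ, h1, h2⟩ := exists_upRel_loRel hγ
    apply hne
    rw [tlBasis_smul_eq_pairing δ β hγ (κ := ⟨κ, h2⟩) h1, h, zero_smul]
  refine cell_induction δ β (P := fun w => ∃ a, LinearMap.toSpanSingleton _ _ v a = w) w ?_ ?_ ?_
  · exact ⟨0, map_zero _⟩
  · rintro x y ⟨a, rfl⟩ ⟨b, rfl⟩
    exact ⟨a + b, map_add _ _ _⟩
  · intro c α
    obtain ⟨η, h1, h2⟩ := exists_upRel_loRel (α := α.1) (β := γ) (α.rank_eq.trans hγ.symm)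
    refine ⟨(c * (pairing δ β γ v)⁻¹) • tlBasis δ η, ?_⟩
    rw [LinearMap.toSpanSingleton_apply, smul_assoc,
      tlBasis_smul_eq_pairing δ β ((rank_congr_lo h2).trans hγ) h1.symm, pairing_congr δ β h2,
      smul_smul, mul_assoc, inv_mul_cancel₀ hc, mul_one]

/-- Let `κ` have the upper half of `β` and the lower half of `β'`. Then `α ↦ α β^* κ` changes only
the lower half, is undone by `κ^* β`, and so respects both ranks and loops. It induces a nonzero
homomorphism of simple modules. -/
theorem nonempty_cellModule_equiv [IsSemisimpleRing (TemperleyLieb n δ)] {β' : JonesMonoid n}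
    (h : β.1.rank = β'.1.rank) :
    Nonempty (CellModule δ β ≃ₗ[TemperleyLieb n δ] CellModule δ β') := by
  obtain ⟨κ, hκ1, hκ2⟩ := exists_upRel_loRel h
  have hκ : κ.1.rank = β'.1.rank := rank_congr_lo hκ2
  have hinv : ∀ α : LClass β, α.1 * star β * κ * (star κ * β) = α.1 := by
    intro α
    rw [mul_assoc (α.1 * star β), star_mul_mul hκ1.symm, mul_star_mul α.2]
  have hrank : ∀ (γ : JonesMonoid n) (α : LClass β),
      (γ * (α.1 * star β * κ)).1.rank = (γ * α.1).1.rank := by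
    intro γ α
    refine le_antisymm ?_ ?_
    · rw [mul_assoc α.1, ← mul_assoc γ]
      exact rank_mul_le_left _ _
    · conv_lhs => rw [← hinv α, ← mul_assoc γ]
      exact rank_mul_le_left _ _
  have hrank1 : ∀ α : LClass β, (α.1 * star β * κ).1.rank = α.1.1.rank := fun α => by
    have := hrank 1 α
    rwa [one_mul, one_mul] at this
  let g : LClass β → LClass β' := fun α => ⟨α.1 * star β * κ, by
    rw [← hκ2]
    exact loRel_mul (by rw [hrank1, α.rank_eq, hκ, h])⟩
  have htw : ∀ (γ : JonesMonoid n) (α : LClass β),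
      (jonesTwisting n δ).toFun γ (g α).1 = (jonesTwisting n δ).toFun γ α.1 := by
    intro γ α
    have hup : upRel (α.1 * star β * κ) = upRel α.1 := by
      have := hrank1 α
      rw [mul_assoc] at this ⊢
      exact upRel_mul this
    exact congrArg (δ ^ ·) (loops_congr γ.2.1 γ.2.1 (g α).1.2.1 α.1.2.1 (fun _ _ => Iff.rfl)
      fun i j => by
        have : upRel (α.1 * star β * κ) i j ↔ upRel α.1 i j := by rw [hup]
        exact this)
  let f : CellModule δ β →ₗ[TemperleyLieb n δ] CellModule δ β' :=
    cellLift δ β (fun α => cellBasis δ β' (g α))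
      (fun γ α hr => by
        have hr' : (γ * (g α).1).1.rank = β'.1.rank := (hrank γ α).trans (hr.trans h)
        rw [tlBasis_smul_cellBasis δ β' γ (g α) hr', htw]
        congr 2
        refine Subtype.ext ?_
        change γ * (α.1 * star β * κ) = γ * α.1 * star β * κ
        simp only [mul_assoc])
      (fun γ α hr => tlBasis_smul_cellBasis_zero δ β' γ (g α) fun h' =>
        hr (((hrank γ α).symm.trans h').trans h.symm))
  have := isSimpleModule_cellModule δ β
  have := isSimpleModule_cellModule δ β'
  have hf : f ≠ 0 := by
    intro h0
    have h1 : cellBasis δ β' (g ⟨β, rfl⟩) = 0 :=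
      (cellLift_cellBasis δ β (fun α => cellBasis δ β' (g α)) _ _ ⟨β, rfl⟩).symm.trans
        (LinearMap.congr_fun h0 _)
    exact cellBasis_ne_zero δ β' _ h1
  exact ⟨LinearEquiv.ofBijective f (LinearMap.bijective_of_ne_zero hf)⟩

theorem rank_le (α : JonesMonoid n) : α.1.rank ≤ n := by
  have := rank_mul_le_right α 1
  rwa [mul_one, rank_one] at this

/-- In the semisimple case every simple module is a cell module. -/
theorem exists_cellModule_equiv [IsSemisimpleRing (TemperleyLieb n δ)] (M : Type*)
    [AddCommGroup M] [Module (TemperleyLieb n δ) M] [IsSimpleModule (TemperleyLieb n δ) M] :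
    ∃ α : JonesMonoid n, Nonempty (M ≃ₗ[TemperleyLieb n δ] CellModule δ α) := by
  classical
  have hnt := IsSimpleModule.nontrivial (TemperleyLieb n δ) M
  -- Minimality of the rank makes `κ ↦ κ • m` respect the vanishing of products of smaller rank.
  have hex : ∃ r, ∃ α : JonesMonoid n, α.1.rank = r ∧ ∃ m : M, tlBasis δ α • m ≠ 0 := by
    obtain ⟨m, hm⟩ := exists_ne (0 : M)
    refine ⟨_, 1, rfl, m, ?_⟩
    rwa [show tlBasis δ (1 : JonesMonoid n) = 1 from rfl, one_smul]
  obtain ⟨α, hα, m, hm⟩ := Nat.find_spec hex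
  have hmin : ∀ κ : JonesMonoid n, κ.1.rank < α.1.rank → tlBasis δ κ • m = 0 := by
    intro κ hκ
    by_contra h
    exact Nat.find_min hex (hα ▸ hκ) ⟨κ, rfl, m, h⟩
  let _ : Module ℂ M := Module.compHom M (algebraMap ℂ (TemperleyLieb n δ))
  have : IsScalarTower ℂ (TemperleyLieb n δ) M := ⟨fun c a x => by
    rw [Algebra.smul_def, mul_smul]
    rfl⟩
  let f : CellModule δ α →ₗ[TemperleyLieb n δ] M :=
    cellLift δ α (fun κ => tlBasis δ κ.1 • m)
      (fun γ κ _ => by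
        rw [smul_smul, tlBasis_mul_tlBasis, smul_assoc]
        rfl)
      (fun γ κ hr => by
        rw [smul_smul, tlBasis_mul_tlBasis, smul_assoc, hmin, smul_zero]
        have h1 := rank_mul_le_right γ κ.1
        have h2 := κ.rank_eq
        omega)
  have := isSimpleModule_cellModule δ α
  have hf : f ≠ 0 := by
    intro h0
    have h1 : tlBasis δ α • m = 0 :=
      (cellLift_cellBasis δ α (fun κ => tlBasis δ κ.1 • m) _ _ ⟨α, rfl⟩).symm.trans
        (LinearMap.congr_fun h0 _)
    exact hm h1
  exact ⟨α, ⟨(LinearEquiv.ofBijective f (LinearMap.bijective_of_ne_zero hf)).symm⟩⟩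

/-- The lower half is fixed, so the basis is indexed by the possible upper halves. -/
theorem finrank_cellModule :
    Module.finrank ℂ (CellModule δ β) = (halfPaths n β.1.rank).ncard := by
  classical
  have := Fintype.ofFinite (LClass β)
  have h1 : Module.finrank ℂ (CellModule δ β) = Fintype.card (LClass β) :=
    Module.finrank_finsupp_self ℂ
  have h2 : Nat.card (LClass β) = {α : JonesMonoid n | loRel α = loRel β}.ncard := rfl
  rw [h1, ← Nat.card_eq_fintype_card, h2]
  refine Set.ncard_congr (fun α _ => upPath α) ?_ ?_ ?_
  · intro α hα
    have := upPath_mem α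
    rwa [rank_congr_lo hα] at this
  · intro α κ hα hκ h
    exact ext_upRel_loRel (upPath_eq_iff.1 h) (hα.trans hκ.symm)
  · intro p hp
    have hβ := upPath_mem (star β)
    rw [rank_star] at hβ
    obtain ⟨α, h1, h2⟩ := exists_upPath_star_eq hp hβ
    exact ⟨α, upPath_eq_iff.1 h2, h1⟩

end Simple
end Jones

/-! ### Conclusion -/

theorem mainTheorem12 (n : ℕ) (hn : 1 ≤ n) (δ : ℂ)
    (hss : IsSemisimpleRing (TemperleyLieb n δ)) :
    ∃ (J : {r : ℕ // ∃ k : ℕ, r + 2 * k = n} → Type)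
      (_ : ∀ r, AddCommGroup (J r)) (_ : ∀ r, Module ℂ (J r))
      (_ : ∀ r, Module (TemperleyLieb n δ) (J r))
      (_ : ∀ r, IsScalarTower ℂ (TemperleyLieb n δ) (J r)),
      (∀ r, IsSimpleModule (TemperleyLieb n δ) (J r)) ∧
      (∀ r s, Nonempty (J r ≃ₗ[TemperleyLieb n δ] J s) → r = s) ∧
      (∀ (M : Type*) [AddCommGroup M] [Module (TemperleyLieb n δ) M],
        IsSimpleModule (TemperleyLieb n δ) M →
          ∃ r, Nonempty (M ≃ₗ[TemperleyLieb n δ] J r)) ∧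
      (∀ r, (∀ α : JonesMonoid n, α.1.rank < r.1 → ∀ x : J r, tlBasis δ α • x = 0) ∧
        ∃ α : JonesMonoid n, α.1.rank = r.1 ∧ ∃ x : J r, tlBasis δ α • x ≠ 0) ∧
      (∀ r, ∀ k : ℕ, r.1 + 2 * k = n → 1 ≤ k →
        Module.finrank ℂ (J r) = semigroupRank (jonesIdeal n r.1) ∧
        (semigroupRank (jonesIdeal n r.1) : ℚ)
          = ((r.1 : ℚ) + 1) / ((n : ℚ) + 1) * ((n + 1).choose k : ℚ)) := by
  have hex : ∀ r : {r : ℕ // ∃ k : ℕ, r + 2 * k = n}, ∃ β : JonesMonoid n, β.1.rank = r.1 :=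
    fun r => r.2.elim fun _ hk => Jones.exists_rank_eq hk
  choose β hβ using hex
  have hzero : ∀ r (α : JonesMonoid n), α.1.rank < r.1 → ∀ x : Jones.CellModule δ (β r),
      tlBasis δ α • x = 0 := fun r α h x =>
    Jones.tlBasis_smul_of_rank_lt δ (β r) (by rwa [hβ]) x
  have hne : ∀ r, ∃ α : JonesMonoid n, α.1.rank = r.1 ∧
      ∃ x : Jones.CellModule δ (β r), tlBasis δ α • x ≠ 0 := by
    intro r
    obtain ⟨γ, h1, h2⟩ := Jones.exists_tlBasis_smul_ne_zero δ (β r)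
      (Jones.cellBasis_ne_zero δ (β r) ⟨β r, rfl⟩)
    exact ⟨γ, h1.trans (hβ r), _, h2⟩
  -- An isomorphism preserves the least rank that acts nontrivially, and this rank is the index.
  have hle : ∀ r s, Nonempty (Jones.CellModule δ (β r) ≃ₗ[TemperleyLieb n δ]
      Jones.CellModule δ (β s)) → s.1 ≤ r.1 := by
    rintro r s ⟨e⟩
    by_contra h
    obtain ⟨α, h1, x, hx⟩ := hne r
    apply hx
    apply e.injective
    rw [map_smul, map_zero]
    exact hzero s α (by omega) _
  refine ⟨fun r => Jones.CellModule δ (β r), fun r => inferInstance, fun r => inferInstance,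
    fun r => inferInstance, fun r => inferInstance,
    fun r => Jones.isSimpleModule_cellModule δ (β r), ?_, ?_, fun r => ⟨hzero r, hne r⟩, ?_⟩
  · rintro r s ⟨e⟩
    exact Subtype.ext (le_antisymm (hle s r ⟨e.symm⟩) (hle r s ⟨e⟩))
  · intro M _ _ _
    obtain ⟨α, ⟨e⟩⟩ := Jones.exists_cellModule_equiv (n := n) δ M
    have h1 := Jones.rank_le α
    have h2 := Jones.rank_parity α
    -- The halving is exact by `rank_parity`.
    let r : {r : ℕ // ∃ k : ℕ, r + 2 * k = n} := ⟨α.1.rank, (n - α.1.rank) / 2, by omega⟩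
    obtain ⟨e'⟩ := Jones.nonempty_cellModule_equiv δ α (β' := β r) (hβ r).symm
    exact ⟨r, ⟨e.trans e'⟩⟩
  · intro r k hk hk1
    have hrank := Jones.semigroupRank_jonesIdeal (n := n) (r := r.1) (by omega) (by omega)
    refine ⟨?_, ?_⟩
    · rw [hrank, Jones.finrank_cellModule, hβ]
    · rw [hrank]
      have h := congrArg (Nat.cast (R := ℚ)) (Diagram.ncard_halfPaths hk)
      push_cast at h
      have hn1 : (n : ℚ) + 1 ≠ 0 := by positivity
      field_simp
      linarith
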